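/- For $\tau=u+iv\in\mathbb H$ put $q^r:=e^{2\pi i r\tau}$, let $\eta(\tau)=q^{1/24}\prod_{n\ge1}(1-q^n)$, and let $\nu_\eta$ be its multiplier: $\eta(\gamma\tau)=\nu_\eta(\gamma)(c\tau+d)^{1/2}\eta(\tau)$ for $\gamma=\left(\begin{smallmatrix}a&b\\c&d\end{smallmatrix}\right)\in\mathrm{SL}_2(\mathbb Z)$ (principal branches throughout). A function $f$ on $\mathbb H$ is *modular of weight $k$ with multiplier $\nu$* if $f(\gamma\tau)=\nu(\gamma)(c\tau+d)^kf(\tau)$ for all $\gamma\in\mathrm{SL}_2(\mathbb Z)$, $\tau\in\mathbb H$. Let $\xi_k f:=2iv^k\,\overline{\partial f/\partial\overline\tau}$, and $$R(0;\tau):=\sum_{n\in\frac12+\mathbb Z}\bigl(\operatorname{sgn}(n)-E(n\sqrt{2v})\bigr)(-1)^{n-\frac12}q^{-n^2/2},\qquad E(x):=2\int_0^xe^{-\pi t^2}\,dt .$$ Consider the following coefficients of the $(2,3,6)$ open Gromov–Witten potential: $$c_y=q^{\frac3{16}}\sum_{n\ge0}(-1)^{n+1}(2n+1)q^{\frac{n(n+1)}2},$$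 $$c_{yz2}=q^{-\frac1{12}}\sum_{n\ge a\ge0}\Bigl((-1)^{n+a}(6n-2a+8)q^{\frac{(n+2)(n+1)}2-\frac{a(a+1)}2}+(2n+4)q^{n+an+1-a^2}\Bigr),$$ $$c_{yz4}=q^{-\frac{17}{48}}\sum_{a,b\ge0,\ n\ge a+b}(-1)^{n+a+b}(6n-2a-2b+7)q^{\frac{(n+1)(n+2)}2-\frac{a(a+1)}2-\frac{b(b+1)}2},$$ and the completions $$\widehat c_{yz2}:=q^{\frac1{12}}c_{yz2}-\tfrac14+\tfrac32\eta^3R(0;\tau),$$ $$\widehat c_{yz4}:=q^{\frac{11}{48}}c_{yz4}+R(0;\tau)\Bigl(-q^{\frac1{12}}c_{yz2}+\tfrac14\Bigr)-\tfrac34R(0;\tau)^2\eta^3 .$$ All these series converge absolutely for every $\tau\in\mathbb H$, and: 1. $c_y=-q^{1/16}\eta^3$; hence $q^{-1/16}c_y$ is a cusp form of weight $3/2$ on $\mathrm{SL}_2(\mathbb Z)$ with multiplier $\nu_\eta^3$. 2. $\widehat c_{yz2}$ is modular of weight $2$ on $\mathrm{SL}_2(\mathbb Z)$ with trivial multiplier,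 it is real-differentiable, and $\xi_2(\widehat c_{yz2})=-\frac{3}{\sqrt2}\,v^{3/2}|\eta|^6$. In particular $c_{yz2}=q^{-1/12}\bigl(\tfrac14+\eta^3h\bigr)$, where $h$ is a mock modular form of weight $1/2$ with multiplier $\nu_\eta^{-3}$ and shadow $-\frac3{\sqrt2}\eta^3$: $h$ is holomorphic on $\mathbb H$ and $O(e^{Cv})$ for some $C$ as $v\to\infty$; $\frac32R(0;\tau)$ is real-differentiable and tends to $0$ as $v\to\infty$; $h+\frac32R(0;\tau)$ is modular of weight $1/2$ with multiplier $\nu_\eta^{-3}$; and $\xi_{1/2}\bigl(h+\frac32R(0;\tau)\bigr)=-\frac3{\sqrt2}\eta^3$, a cusp form of weight $3/2$ with multiplier $\nu_\eta^3$. 3. $\widehat c_{yz4}$ is modular of weight $5/2$ on $\mathrm{SL}_2(\mathbb Z)$ with multiplier $\nu_\eta^{-3}$, and it is a polynomial of degree $2$ in $R(0;\tau)$ over the ring of holomorphic functions on $\mathbb H$. -/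

import Mathlib

open UpperHalfPlane

noncomputable section

namespace GW236

/-- `q ^ r = exp (2 π i r τ)`. -/
def qPow (τ : ℍ) (r : ℂ) : ℂ := Complex.exp (2 * Real.pi * Complex.I * r * (τ : ℂ))

/-- The Dedekind eta function on the upper half-plane (Mathlib's `ModularForm.eta`). -/
def eta (τ : ℍ) : ℂ := ModularForm.eta (τ : ℂ)

/-- The automorphy factor `(c τ + d) ^ k` of real weight `k`, with the principal branch. -/
def autFactor (k : ℝ) (γ : Matrix.SpecialLinearGroup (Fin 2) ℤ) (τ : ℍ) : ℂ :=
  ((γ 1 0 : ℂ) * (τ : ℂ) + (γ 1 1 : ℂ)) ^ (k : ℂ)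

/-- The multiplier of `η`: the factor in `η(γτ) = ν_η(γ) (cτ+d)^(1/2) η(τ)`.
It does not depend on `τ`, so it is read off at `τ = i`. -/
def nuEta (γ : Matrix.SpecialLinearGroup (Fin 2) ℤ) : ℂ :=
  eta (γ • UpperHalfPlane.I) / (autFactor (1 / 2) γ UpperHalfPlane.I * eta UpperHalfPlane.I)

/-- `f` transforms like a modular form of weight `k` on `SL₂(ℤ)` with multiplier `ν`. -/
def TransformsLike (k : ℝ) (ν : Matrix.SpecialLinearGroup (Fin 2) ℤ → ℂ) (f : ℍ → ℂ) : Prop :=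
  ∀ (γ : Matrix.SpecialLinearGroup (Fin 2) ℤ) (τ : ℍ),
    f (γ • τ) = ν γ * autFactor k γ τ * f τ

/-- Holomorphic functions on the upper half-plane. -/
def Holo (f : ℍ → ℂ) : Prop :=
  DifferentiableOn ℂ (fun z : ℂ => f (UpperHalfPlane.ofComplex z)) {z : ℂ | 0 < z.im}

/-- Real differentiable functions (in `u, v`, where `τ = u + i v`) on the upper half-plane. -/
def RealDiff (f : ℍ → ℂ) : Prop :=
  DifferentiableOn ℝ (fun z : ℂ => f (UpperHalfPlane.ofComplex z)) {z : ℂ | 0 < z.im}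

/-- Cusp forms of weight `k` on `SL₂(ℤ)` with multiplier `ν`. -/
structure IsCuspForm (k : ℝ) (ν : Matrix.SpecialLinearGroup (Fin 2) ℤ → ℂ) (f : ℍ → ℂ) :
    Prop where
  holo : Holo f
  transforms : TransformsLike k ν f
  zero_at_cusp : UpperHalfPlane.IsZeroAtImInfty f

/-- The Wirtinger derivative `∂f/∂τ̄ = (∂_u f + i ∂_v f) / 2`. -/
def dbar (f : ℍ → ℂ) (τ : ℍ) : ℂ :=
  (fderiv ℝ (fun z : ℂ => f (UpperHalfPlane.ofComplex z)) (τ : ℂ) 1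
    + Complex.I * fderiv ℝ (fun z : ℂ => f (UpperHalfPlane.ofComplex z)) (τ : ℂ) Complex.I) / 2

/-- The shadow operator `ξ_k f = 2 i v^k conj (∂f/∂τ̄)`. -/
def xi (k : ℝ) (f : ℍ → ℂ) (τ : ℍ) : ℂ :=
  2 * Complex.I * ((τ.im ^ k : ℝ) : ℂ) * (starRingEnd ℂ) (dbar f τ)

/-- `h` is a mock modular form of weight `k` and multiplier `ν` on `SL₂(ℤ)`, with
non-holomorphic completion `h + hminus` and shadow `g`: the function `h` is holomorphic with
at most linear exponential growth at the cusp, `hminus` decays at the cusp, `h + hminus`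
transforms with weight `k`, and `ξ_k (h + hminus) = g` is a cusp form of weight `2 - k`. -/
structure IsMockModular (k : ℝ) (ν : Matrix.SpecialLinearGroup (Fin 2) ℤ → ℂ)
    (h hminus g : ℍ → ℂ) : Prop where
  holo : Holo h
  growth : ∃ C : ℝ, UpperHalfPlane.IsBoundedAtImInfty
    (fun τ : ℍ => (Real.exp (-C * τ.im) : ℂ) * h τ)
  realDiff : RealDiff hminus
  decay : UpperHalfPlane.IsZeroAtImInfty hminus
  transforms : TransformsLike k ν (fun τ => h τ + hminus τ)
  shadow : ∀ τ : ℍ, xi k (fun τ => h τ + hminus τ) τ = g τ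
  shadow_cusp : IsCuspForm (2 - k) (fun γ => (starRingEnd ℂ) (ν γ)) g

/-- `E(x) = 2 ∫_0^x exp(-π t²) dt` (only real arguments occur). -/
def errE (x : ℝ) : ℝ := 2 * ∫ t in (0 : ℝ)..x, Real.exp (-Real.pi * t ^ 2)

/-- The summand of `R(z;τ)` at `n = k + 1/2`. -/
def RTerm (z : ℂ) (τ : ℍ) (k : ℤ) : ℂ :=
  ((Real.sign ((k : ℝ) + 1 / 2)
      - errE (((k : ℝ) + 1 / 2 + z.im / τ.im) * Real.sqrt (2 * τ.im)) : ℝ) : ℂ)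
    * (-1) ^ k * qPow τ (-((k : ℂ) + 1 / 2) ^ 2 / 2)
    * Complex.exp (-2 * Real.pi * Complex.I * ((k : ℂ) + 1 / 2) * z)

/-- The function `R(z;τ)`, a sum over `n ∈ 1/2 + ℤ`. -/
def R (z : ℂ) (τ : ℍ) : ℂ := ∑' k : ℤ, RTerm z τ k

/-- The summand of the series in `c_y`. -/
def cyTerm (τ : ℍ) (n : ℕ) : ℂ :=
  (-1) ^ (n + 1) * (2 * (n : ℂ) + 1) * qPow τ ((n : ℂ) * ((n : ℂ) + 1) / 2)

/-- The coefficient `c_y` of `y³` in the potential `W_q(2,3,6)`. -/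
def cy (τ : ℍ) : ℂ := qPow τ (3 / 16) * ∑' n : ℕ, cyTerm τ n

/-- The summand of the series in `c_{yz2}`, at `p = (n, a)` with `n ≥ a ≥ 0`. -/
def cyz2Term (τ : ℍ) (p : {p : ℕ × ℕ // p.2 ≤ p.1}) : ℂ :=
  let n : ℂ := (p.1.1 : ℂ)
  let a : ℂ := (p.1.2 : ℂ)
  (-1) ^ (p.1.1 + p.1.2) * (6 * n - 2 * a + 8)
      * qPow τ ((n + 2) * (n + 1) / 2 - a * (a + 1) / 2)
    + (2 * n + 4) * qPow τ (n + a * n + 1 - a ^ 2)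

/-- The coefficient `c_{yz2}` of `y²z²` in the potential `W_q(2,3,6)`. -/
def cyz2 (τ : ℍ) : ℂ :=
  qPow τ (-1 / 12) * ∑' p : {p : ℕ × ℕ // p.2 ≤ p.1}, cyz2Term τ p

/-- The summand of the series in `c_{yz4}`, at `p = (n, a, b)` with `a, b ≥ 0`, `n ≥ a + b`. -/
def cyz4Term (τ : ℍ) (p : {p : ℕ × ℕ × ℕ // p.2.1 + p.2.2 ≤ p.1}) : ℂ :=
  let n : ℂ := (p.1.1 : ℂ)
  let a : ℂ := (p.1.2.1 : ℂ)
  let b : ℂ := (p.1.2.2 : ℂ)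
  (-1) ^ (p.1.1 + p.1.2.1 + p.1.2.2) * (6 * n - 2 * a - 2 * b + 7)
    * qPow τ ((n + 1) * (n + 2) / 2 - a * (a + 1) / 2 - b * (b + 1) / 2)

/-- The coefficient `c_{yz4}` of `yz⁴` in the potential `W_q(2,3,6)`. -/
def cyz4 (τ : ℍ) : ℂ :=
  qPow τ (-17 / 48) * ∑' p : {p : ℕ × ℕ × ℕ // p.2.1 + p.2.2 ≤ p.1}, cyz4Term τ p

/-- The completion of `c_{yz2}`. -/
def cyz2Hat (τ : ℍ) : ℂ :=
  qPow τ (1 / 12) * cyz2 τ - 1 / 4 + 3 / 2 * eta τ ^ 3 * R 0 τ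

/-- The completion of `c_{yz4}`. -/
def cyz4Hat (τ : ℍ) : ℂ :=
  qPow τ (11 / 48) * cyz4 τ + R 0 τ * (-(qPow τ (1 / 12) * cyz2 τ) + 1 / 4)
    - 3 / 4 * R 0 τ ^ 2 * eta τ ^ 3

end GW236

end

/-!
Write `x = e^{2πiu}` and `θ(u) = ∑ (-1)^n q^{n(n+1)/2} x^n`, and let
`P = ∑ (-1)^n (2n+1) q^{n(n+1)/2}` (`n ≥ 0`) be its Taylor coefficient at `u = 0`, up to a factor
`2πi`. Jacobi's identity `η³ = q^{1/8} P` (`eta_cube`) gives the assertions on `c_y`: the quotient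
of the two sides is a modular form of weight zero and level one, hence constant.

The double series `c_{yz2}` and the triple series `c_{yz4}` are made of Taylor coefficients at
`u = 0` of an Appell function `L = ∑_{s ≠ 0} (-1)^s q^{s(s+1)/2} x^s / (1 - q^s)` and its
relatives `N`, `L₂`, and of indefinite theta series `F`, `G` of signature `(1, 2)`. The triple
series are reduced to the double ones by two identities, `θ F = L² + N - N(0)` (`theta_mul_serF`)
and `θ G = L N + 3/4 L₂ + (2 N(0) + 1/4) L` (`theta_mul_serG`): the difference of the two sides is
an entire function of `u` with periods `1` and `τ` (in the second case, additive quasi-periods),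
so it is constant. The vanishing of the quasi-period in the second case moreover evaluates `N(0)`
as a Lambert series, that is, `1 + 12 N(0) = E₂`. Comparing Taylor coefficients gives
`serP_mul_serS4`, which expresses `P` times the series of `c_{yz4}` through `E₂`, its derivative
and the coefficient of `L`.

The Appell function is completed to `L̂ = L - θρ/2`, where `ρ` is a series in the error function
with `η³ R(0;τ) = P ρ(0)`. The correction makes `L̂` periodic up to an additive constant, at the
cost of holomorphy in `u`: its Wirtinger derivative is a multiple of `v⁻¹` times the invariant
norm of the Jacobi form `θ` (`jFun`). Hence `L̂(u;τ) - τ⁻¹ L̂(u/τ;-1/τ)` is holomorphic in `u`,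
and by its quasi-periods it is affine (`lHat_neg_inv`). No Mordell integral is needed. Its
derivative at `u = 0` is the transformation law of the completed series `B` (`bHat_neg_inv`): like
`E₂`, it has weight two up to a multiple of `τ`.

Consequently `ĉ_{yz2} = 6 B - E₂ / 4`, in which the anomalies cancel, has weight two
(`cyz2Hat_eq`), and `η³ ĉ_{yz4} = (E₂² - 12 q dE₂/dq) / 48 - ĉ_{yz2}² / 3` has weight four
(`eta_cube_mul_cyz4Hat`). The transformation under all of `SL₂(ℤ)` follows from the generators,
since the weights are now integral; half-integral weights enter only through `η`, whose multiplier
does not depend on `τ` because its 24th power is `1` and `ℍ` is connected (`eta_transforms`). The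
shadows are computed by differentiating series with error function coefficients termwise
(`hasFDerivAt_tsum_errE`): all summands of `∂R(0;τ)/∂τ̄` carry the same factor `v^{-1/2}`, and
what remains is the conjugate of the series of `η³`.
-/

noncomputable section

namespace GW236

/-! ### Two-variable `q`-series -/

section QSeries

variable {ι : Type*}

/-- The summand `c q ^ e x ^ n` of a two-variable `q`-series, with `q = exp (2πiτ)` and
`x = exp (2πiu)`. -/
def qTerm (c : ι → ℂ) (e n : ι → ℕ) (u τ : ℂ) (i : ι) : ℂ :=
  c i * Complex.exp (2 * Real.pi * Complex.I * (e i * τ + n i * u))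

/-- The two-variable `q`-series `∑ c q ^ e x ^ n`. -/
def qSeries (c : ι → ℂ) (e n : ι → ℕ) (u τ : ℂ) : ℂ := ∑' i, qTerm c e n u τ i

/-- Absolute convergence of `∑ c q ^ e x ^ n` for all `|q| < 1` and all `x`, stated for
`|q| = exp (-T)` and `|x| = exp Y`. -/
def Adm (c : ι → ℂ) (e n : ι → ℕ) : Prop :=
  ∀ T : ℝ, 0 < T → ∀ Y : ℝ, Summable fun i => ‖c i‖ * Real.exp (-(e i * T) + n i * Y)

lemma norm_qTerm (c : ι → ℂ) (e n : ι → ℕ) (u τ : ℂ) (i : ι) :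
    ‖qTerm c e n u τ i‖ =
      ‖c i‖ * Real.exp (-(e i * (2 * Real.pi * τ.im)) + n i * (-(2 * Real.pi * u.im))) := by
  rw [qTerm, norm_mul, Complex.norm_exp]
  congr 2
  simp [Complex.mul_re, Complex.mul_im]
  ring

variable {c : ι → ℂ} {e n : ι → ℕ}

lemma Adm.summable (h : Adm c e n) {τ : ℂ} (hτ : 0 < τ.im) (u : ℂ) :
    Summable (qTerm c e n u τ) := by
  refine Summable.of_norm ?_
  simp_rw [norm_qTerm]
  exact h _ (by positivity) _

lemma Adm.of_norm_le (h : Adm c e n) {c' : ι → ℂ} (C : ℝ) (hc : ∀ i, ‖c' i‖ ≤ C * ‖c i‖) :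
    Adm c' e n := fun T hT Y => by
  refine Summable.of_nonneg_of_le (fun i => by positivity) (fun i => ?_) ((h T hT Y).mul_left C)
  rw [← mul_assoc]
  exact mul_le_mul_of_nonneg_right (hc i) (Real.exp_pos _).le

lemma Adm.mul_n (h : Adm c e n) : Adm (fun i => c i * n i) e n := fun T hT Y => by
  refine Summable.of_nonneg_of_le (fun i => by positivity) (fun i => ?_) (h T hT (Y + 1))
  have h1 : (n i : ℝ) ≤ Real.exp (n i) := by
    have := Real.add_one_le_exp (n i : ℝ); linarith
  rw [norm_mul, mul_assoc, Complex.norm_natCast]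
  refine mul_le_mul_of_nonneg_left ?_ (norm_nonneg _)
  calc (n i : ℝ) * Real.exp (-(e i * T) + n i * Y)
      ≤ Real.exp (n i) * Real.exp (-(e i * T) + n i * Y) := by gcongr
    _ = _ := by rw [← Real.exp_add]; ring_nf

lemma Adm.mul_e (h : Adm c e n) : Adm (fun i => c i * e i) e n := fun T hT Y => by
  refine Summable.of_nonneg_of_le (fun i => by positivity) (fun i => ?_)
    ((h (T / 2) (by positivity) Y).mul_left (2 / T))
  have h1 : (e i : ℝ) ≤ 2 / T * Real.exp (e i * (T / 2)) := by
    have := Real.add_one_le_exp (e i * (T / 2) : ℝ)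
    rw [div_mul_eq_mul_div, le_div_iff₀ hT]
    linarith
  rw [norm_mul, mul_assoc, Complex.norm_natCast]
  calc ‖c i‖ * ((e i : ℝ) * Real.exp (-(e i * T) + n i * Y))
      ≤ ‖c i‖ * (2 / T * Real.exp (e i * (T / 2)) * Real.exp (-(e i * T) + n i * Y)) := by gcongr
    _ = 2 / T * (‖c i‖ * (Real.exp (e i * (T / 2)) * Real.exp (-(e i * T) + n i * Y))) := by ring
    _ = _ := by rw [← Real.exp_add]; ring_nf

lemma norm_two_pi_I : ‖(2 * Real.pi * Complex.I : ℂ)‖ = 2 * Real.pi := by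
  simp [Real.pi_pos.le]

lemma Adm.hasDerivAt_u (h : Adm c e n) {τ : ℂ} (hτ : 0 < τ.im) (u : ℂ) :
    HasDerivAt (fun u => qSeries c e n u τ)
      (2 * Real.pi * Complex.I * qSeries (fun i => c i * n i) e n u τ) u := by
  obtain ⟨B, hB⟩ : ∃ B, -u.im < B := exists_gt _
  have hu : u ∈ {w : ℂ | -B < w.im} := by
    change -B < u.im
    linarith
  have hd : ∀ i (w : ℂ), HasDerivAt (fun w => qTerm c e n w τ i)
      (2 * Real.pi * Complex.I * qTerm (fun i => c i * n i) e n w τ i) w := fun i w => by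
    have := ((((hasDerivAt_id w).const_mul (n i : ℂ)).const_add (e i * τ)).const_mul
      (2 * Real.pi * Complex.I)).cexp.const_mul (c i)
    refine this.congr_deriv ?_
    simp only [qTerm, id]; ring
  have hb : ∀ i (w : ℂ), w ∈ {w : ℂ | -B < w.im} →
      ‖2 * Real.pi * Complex.I * qTerm (fun i => c i * n i) e n w τ i‖ ≤
      2 * Real.pi * (‖c i * n i‖ *
        Real.exp (-(e i * (2 * Real.pi * τ.im)) + n i * (2 * Real.pi * B))) := fun i w hw => by
    rw [norm_mul, norm_qTerm, norm_two_pi_I]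
    have : -(2 * Real.pi * w.im) ≤ 2 * Real.pi * B := by
      have hw' : -B < w.im := hw
      nlinarith [Real.pi_pos]
    gcongr
  have := hasDerivAt_tsum_of_isPreconnected
    ((h.mul_n (2 * Real.pi * τ.im) (by positivity) (2 * Real.pi * B)).mul_left
      (2 * Real.pi))
    (isOpen_lt continuous_const Complex.continuous_im)
    (convex_halfSpace_im_gt _).isPreconnected
    (fun i w _ => hd i w) hb hu (h.summable hτ u) hu
  rwa [tsum_mul_left] at this

lemma Adm.hasDerivAt_tau (h : Adm c e n) {τ : ℂ} (hτ : 0 < τ.im) (u : ℂ) :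
    HasDerivAt (fun τ => qSeries c e n u τ)
      (2 * Real.pi * Complex.I * qSeries (fun i => c i * e i) e n u τ) τ := by
  obtain ⟨B, hB, hBτ⟩ := exists_between hτ
  have hu : τ ∈ {w : ℂ | B < w.im} := hBτ
  have hd : ∀ i (w : ℂ), HasDerivAt (fun w => qTerm c e n u w i)
      (2 * Real.pi * Complex.I * qTerm (fun i => c i * e i) e n u w i) w := fun i w => by
    have := ((((hasDerivAt_id w).const_mul (e i : ℂ)).add_const (n i * u)).const_mul
      (2 * Real.pi * Complex.I)).cexp.const_mul (c i)
    refine this.congr_deriv ?_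
    simp only [qTerm, id]; ring
  have hb : ∀ i (w : ℂ), w ∈ {w : ℂ | B < w.im} →
      ‖2 * Real.pi * Complex.I * qTerm (fun i => c i * e i) e n u w i‖ ≤
      2 * Real.pi * (‖c i * e i‖ *
        Real.exp (-(e i * (2 * Real.pi * B)) + n i * (-(2 * Real.pi * u.im)))) := fun i w hw => by
    rw [norm_mul, norm_qTerm, norm_two_pi_I]
    have : B ≤ w.im := le_of_lt hw
    gcongr
  have := hasDerivAt_tsum_of_isPreconnected
    ((h.mul_e (2 * Real.pi * B) (by positivity) (-(2 * Real.pi * u.im))).mul_left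
      (2 * Real.pi))
    (isOpen_lt continuous_const Complex.continuous_im)
    (convex_halfSpace_im_gt _).isPreconnected
    (fun i w _ => hd i w) hb hu (h.summable hτ u) hu
  rwa [tsum_mul_left] at this

lemma qSeries_const_mul (a : ℂ) (u τ : ℂ) :
    qSeries (fun i => a * c i) e n u τ = a * qSeries c e n u τ := by
  simp only [qSeries, qTerm, mul_assoc, tsum_mul_left]

lemma qSeries_add {c' : ι → ℂ} (h : Adm c e n) (h' : Adm c' e n) {τ : ℂ} (hτ : 0 < τ.im) (u : ℂ) :
    qSeries (fun i => c i + c' i) e n u τ = qSeries c e n u τ + qSeries c' e n u τ := by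
  rw [qSeries, qSeries, qSeries, ← (h.summable hτ u).tsum_add (h'.summable hτ u)]
  exact tsum_congr fun i => by simp only [qTerm]; ring

lemma qSeries_add_one (u τ : ℂ) : qSeries c e n (u + 1) τ = qSeries c e n u τ := by
  refine tsum_congr fun i => ?_
  rw [qTerm, qTerm]
  congr 1
  rw [Complex.exp_eq_exp_iff_exists_int]
  exact ⟨n i, by push_cast; ring⟩

lemma qSeries_tau_add_one (u τ : ℂ) : qSeries c e n u (τ + 1) = qSeries c e n u τ := by
  refine tsum_congr fun i => ?_
  rw [qTerm, qTerm]
  congr 1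
  rw [Complex.exp_eq_exp_iff_exists_int]
  exact ⟨e i, by push_cast; ring⟩

/-- A `q`-series without constant term is `O(q)` at the cusp. -/
lemma Adm.norm_qSeries_le (h : Adm c e n) (he : ∀ i, 1 ≤ e i) :
    ∃ C : ℝ, ∀ τ : ℂ, 1 ≤ τ.im → ‖qSeries c e n 0 τ‖ ≤ C * Real.exp (-(2 * Real.pi * τ.im)) := by
  refine ⟨∑' i, Real.exp (2 * Real.pi) * (‖c i‖ * Real.exp (-(e i * (2 * Real.pi)) + n i * 0)),
    fun τ hτ => ?_⟩
  have hs := ((h (2 * Real.pi) (by positivity) 0).mul_left (Real.exp (2 * Real.pi)))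
  rw [← tsum_mul_right]
  refine tsum_of_norm_bounded (hs.mul_right _).hasSum fun i => ?_
  rw [norm_qTerm]
  have : -((e i : ℝ) * (2 * Real.pi * τ.im)) ≤
      2 * Real.pi + (-(e i * (2 * Real.pi))) + (-(2 * Real.pi * τ.im)) := by
    have h1 : (1 : ℝ) ≤ e i := by exact_mod_cast he i
    nlinarith [mul_nonneg (mul_nonneg Real.pi_pos.le (sub_nonneg.2 h1)) (sub_nonneg.2 hτ)]
  calc _ = ‖c i‖ * Real.exp (-((e i : ℝ) * (2 * Real.pi * τ.im))) := by simp
    _ ≤ ‖c i‖ * Real.exp (2 * Real.pi + (-(e i * (2 * Real.pi))) + (-(2 * Real.pi * τ.im))) := by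
      gcongr
    _ = _ := by rw [Real.exp_add, Real.exp_add]; simp; ring

lemma qSeries_equiv {κ : Type*} (f : κ ≃ ι) (u τ : ℂ) :
    qSeries (c ∘ f) (e ∘ f) (n ∘ f) u τ = qSeries c e n u τ :=
  f.tsum_eq (qTerm c e n u τ)

end QSeries

/-! ### Triangular numbers and convergence -/

/-- The triangular number `n (n + 1) / 2`. -/
def tri (n : ℕ) : ℕ := n * (n + 1) / 2

lemma two_mul_tri (n : ℕ) : 2 * tri n = n * (n + 1) :=
  Nat.mul_div_cancel' (Nat.even_mul_succ_self n).two_dvd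

lemma tri_succ (n : ℕ) : tri (n + 1) = tri n + (n + 1) := by
  have h1 := two_mul_tri n
  have h2 := two_mul_tri (n + 1)
  nlinarith

lemma tri_cast (n : ℕ) : (tri n : ℂ) = n * (n + 1) / 2 := by
  have h := congrArg (Nat.cast : ℕ → ℂ) (two_mul_tri n)
  push_cast at h
  linear_combination h / 2

lemma tri_cast_real (n : ℕ) : (tri n : ℝ) = n * (n + 1) / 2 := by
  have h := congrArg (Nat.cast : ℕ → ℝ) (two_mul_tri n)
  push_cast at h
  linear_combination h / 2

lemma summable_exp_tri {T : ℝ} (hT : 0 < T) (Y : ℝ) :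
    Summable fun k : ℕ => Real.exp (-(tri (k + 1) * T) + (k + 1) * Y) := by
  refine Summable.of_nonneg_of_le (fun k => by positivity) (fun k => ?_)
    ((Real.summable_exp_neg_nat).mul_left (Real.exp ((Y + 1) ^ 2 / (2 * T))))
  rw [← Real.exp_add]
  refine Real.exp_le_exp.2 ?_
  rw [tri_cast_real]
  push_cast
  have h : (Y + 1) ^ 2 / (2 * T) = (Y + 1) ^ 2 / T / 2 := by field_simp
  have h2 : ((k + 1 : ℝ) * T - (Y + 1)) ^ 2 / T =
      (k + 1) ^ 2 * T - 2 * (k + 1) * (Y + 1) + (Y + 1) ^ 2 / T := by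
    field_simp
    ring
  have h3 : 0 ≤ ((k + 1 : ℝ) * T - (Y + 1)) ^ 2 / T := by positivity
  have h4 : 0 ≤ (k + 1 : ℝ) * T := by positivity
  rw [h]
  nlinarith

lemma summable_odd_pow_exp (w : ℕ) {T : ℝ} (hT : 0 < T) :
    Summable fun j : ℕ => (2 * j + 1 : ℝ) ^ w * Real.exp (-(j * T)) := by
  have h := (summable_nat_add_iff 1).2 (Real.summable_pow_mul_exp_neg_nat_mul w hT)
  refine Summable.of_nonneg_of_le (fun k => by positivity) (fun k => ?_)
    (h.mul_left (2 ^ w * Real.exp T))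
  push_cast
  calc (2 * k + 1 : ℝ) ^ w * Real.exp (-(k * T))
      ≤ (2 * (k + 1) : ℝ) ^ w * Real.exp (-(k * T)) := by gcongr; linarith
    _ = 2 ^ w * ((k + 1 : ℝ) ^ w * (Real.exp T * Real.exp (-T * (k + 1)))) := by
      rw [mul_pow, ← Real.exp_add]; ring_nf
    _ = _ := by ring

/-! ### The Appell-type series and their quasi-periodicity -/

/-- The exponent of `q` in `H_w`, at `(n, j)` with `s = n + 1`. -/
def expH (p : ℕ × ℕ) : ℕ := tri (p.1 + 1) + (p.1 + 1) * p.2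

/-- The coefficient `(-1)^s (2j+1)^w` of `H_w`, with `s = n + 1`. -/
def coeffH (w : ℕ) (p : ℕ × ℕ) : ℂ := (-1) ^ (p.1 + 1) * (2 * p.2 + 1) ^ w

/-- The exponent of `q` in `K_w`, at `(k, l, m)` with `K = k + 1`. -/
def expK (p : ℕ × ℕ × ℕ) : ℕ :=
  tri (p.1 + 1) + (p.1 + 1) * (p.2.1 + p.2.2) + p.2.1 * p.2.2

/-- The coefficient `(-1)^K (2l+1)^w` of `K_w`, with `K = k + 1`. -/
def coeffK (w : ℕ) (p : ℕ × ℕ × ℕ) : ℂ := (-1) ^ (p.1 + 1) * (2 * p.2.1 + 1) ^ w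

lemma norm_two_mul_add_one (j : ℕ) : ‖(2 * j + 1 : ℂ)‖ = 2 * j + 1 := by
  have := Complex.norm_natCast (2 * j + 1)
  push_cast at this
  exact this

lemma adm_thetaPlus : Adm (fun k : ℕ => (-1 : ℂ) ^ (k + 1)) (fun k => tri (k + 1))
    (fun k => k + 1) := fun T hT Y => by
  simpa using summable_exp_tri hT Y

lemma adm_H (w : ℕ) : Adm (coeffH w) expH (fun p => p.1 + 1) := fun T hT Y => by
  refine Summable.of_nonneg_of_le (fun p => by positivity) (fun p => ?_)
    (((summable_exp_tri hT Y).mul_of_nonneg (summable_odd_pow_exp w hT)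
      (fun _ => by positivity) (fun _ => by positivity)))
  have h1 : ‖coeffH w p‖ = (2 * p.2 + 1 : ℝ) ^ w := by
    simp [coeffH, norm_two_mul_add_one]
  have h2 : -((expH p : ℝ) * T) + ((p.1 + 1 : ℕ) : ℝ) * Y ≤
      (-(tri (p.1 + 1) * T) + (p.1 + 1) * Y) + -(p.2 * T) := by
    simp only [expH]
    push_cast
    have : 0 ≤ (p.1 : ℝ) * p.2 * T := by positivity
    nlinarith
  rw [h1]
  calc _ ≤ (2 * p.2 + 1 : ℝ) ^ w *
        Real.exp ((-(tri (p.1 + 1) * T) + (p.1 + 1) * Y) + -(p.2 * T)) := by gcongr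
    _ = _ := by rw [Real.exp_add]; ring

lemma adm_K (w : ℕ) : Adm (coeffK w) expK (fun p => p.1 + 1) := fun T hT Y => by
  have hs := (summable_exp_tri hT Y).mul_of_nonneg
    ((summable_odd_pow_exp w hT).mul_of_nonneg (summable_odd_pow_exp 0 hT)
      (fun _ => by positivity) (fun _ => by positivity)) (fun _ => by positivity)
      (fun _ => by simp only [Pi.zero_apply]; positivity)
  refine Summable.of_nonneg_of_le (fun p => by positivity) (fun p => ?_) hs
  have h1 : ‖coeffK w p‖ = (2 * p.2.1 + 1 : ℝ) ^ w := by
    simp [coeffK, norm_two_mul_add_one]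
  have h2 : -((expK p : ℝ) * T) + ((p.1 + 1 : ℕ) : ℝ) * Y ≤
      (-(tri (p.1 + 1) * T) + (p.1 + 1) * Y) + (-(p.2.1 * T) + -(p.2.2 * T)) := by
    simp only [expK]
    push_cast
    have : 0 ≤ ((p.1 : ℝ) * (p.2.1 + p.2.2) + p.2.1 * p.2.2) * T := by positivity
    nlinarith
  rw [h1]
  calc _ ≤ (2 * p.2.1 + 1 : ℝ) ^ w *
        Real.exp ((-(tri (p.1 + 1) * T) + (p.1 + 1) * Y) + (-(p.2.1 * T) + -(p.2.2 * T))) := by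
        gcongr
    _ = _ := by
      rw [Real.exp_add, Real.exp_add (-(p.2.1 * T) : ℝ)]; ring

lemma adm_sigma (w : ℕ) : Adm (fun p : ℕ × ℕ => (2 * p.1 + 1 : ℂ) ^ w)
    (fun p => (p.1 + 1) * (p.2 + 1)) (fun _ => 0) := fun T hT Y => by
  refine Summable.of_nonneg_of_le (fun p => by positivity) (fun p => ?_)
    (((summable_odd_pow_exp w hT).mul_of_nonneg (summable_odd_pow_exp 0 hT)
      (fun _ => by positivity) (fun _ => by positivity)))
  rw [norm_pow, norm_two_mul_add_one]
  have h2 : -((((p.1 + 1) * (p.2 + 1) : ℕ) : ℝ) * T) + ((0 : ℕ) : ℝ) * Y ≤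
      -(p.1 * T) + -(p.2 * T) := by
    push_cast
    have : 0 ≤ ((p.1 : ℝ) * p.2 + 1) * T := by positivity
    nlinarith
  calc _ ≤ (2 * p.1 + 1 : ℝ) ^ w * Real.exp (-(p.1 * T) + -(p.2 * T)) := by gcongr
    _ = _ := by rw [Real.exp_add]; ring

/-- The half theta series `∑_{s ≥ 1} (-1)^s q^(s(s+1)/2) x^s`. -/
def thetaPlus (u τ : ℂ) : ℂ :=
  qSeries (fun k : ℕ => (-1 : ℂ) ^ (k + 1)) (fun k => tri (k + 1)) (fun k => k + 1) u τ

/-- `H_w = ∑_{s ≥ 1, j ≥ 0} (-1)^s (2j+1)^w q^(s(s+1)/2 + sj) x^s`. -/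
def serH (w : ℕ) (u τ : ℂ) : ℂ := qSeries (coeffH w) expH (fun p => p.1 + 1) u τ

/-- `K_w = ∑_{K ≥ 1, l, m ≥ 0} (-1)^K (2l+1)^w q^(K(K+1)/2 + Kl + Km + lm) x^K`. -/
def serK (w : ℕ) (u τ : ℂ) : ℂ := qSeries (coeffK w) expK (fun p => p.1 + 1) u τ

/-- `∑_{l, m ≥ 1} (2l-1)^w q^(lm)`. -/
def serSigma (w : ℕ) (τ : ℂ) : ℂ :=
  qSeries (fun p : ℕ × ℕ => (2 * p.1 + 1 : ℂ) ^ w) (fun p => (p.1 + 1) * (p.2 + 1))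
    (fun _ => 0) 0 τ

section Peel

variable {f : ℕ × ℕ → ℂ} {g : ℕ × ℕ × ℕ → ℂ}

lemma tsum_peel {ι : Type*} {f : ℕ × ι → ℂ} (hf : Summable f) :
    ∑' p, f p = ∑' i, f (0, i) + ∑' p : ℕ × ι, f (p.1 + 1, p.2) := by
  have h2 : Summable fun p : ℕ × ι => f (p.1 + 1, p.2) :=
    hf.comp_injective (i := fun p : ℕ × ι => (p.1 + 1, p.2)) fun a b h => by
      simp only [Prod.mk.injEq, add_left_inj] at h
      exact Prod.ext h.1 h.2
  rw [hf.tsum_prod, h2.tsum_prod, hf.prod.tsum_eq_zero_add]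

lemma tsum_peel_snd (hf : Summable f) :
    ∑' p, f p = ∑' i, f (i, 0) + ∑' p : ℕ × ℕ, f (p.1, p.2 + 1) := by
  have h := tsum_peel (f := f ∘ Prod.swap) ((Equiv.prodComm ℕ ℕ).summable_iff.2 hf)
  have e1 := (Equiv.prodComm ℕ ℕ).tsum_eq f
  have e2 := (Equiv.prodComm ℕ ℕ).tsum_eq fun p : ℕ × ℕ => f (p.1, p.2 + 1)
  rw [← e1, ← e2]
  exact h

/-- Exchange the first two of three coordinates. -/
def swap12 : ℕ × ℕ × ℕ ≃ ℕ × ℕ × ℕ where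
  toFun p := (p.2.1, p.1, p.2.2)
  invFun p := (p.2.1, p.1, p.2.2)
  left_inv _ := rfl
  right_inv _ := rfl

/-- Exchange the last two of three coordinates. -/
def swap23 : ℕ × ℕ × ℕ ≃ ℕ × ℕ × ℕ where
  toFun p := (p.1, p.2.2, p.2.1)
  invFun p := (p.1, p.2.2, p.2.1)
  left_inv _ := rfl
  right_inv _ := rfl

lemma tsum_peel_mid (hg : Summable g) :
    ∑' p, g p = ∑' p : ℕ × ℕ, g (p.1, 0, p.2) + ∑' p : ℕ × ℕ × ℕ, g (p.1, p.2.1 + 1, p.2.2) := by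
  have h := tsum_peel (f := g ∘ swap12) (swap12.summable_iff.2 hg)
  have e1 := swap12.tsum_eq g
  have e2 := swap12.tsum_eq fun p : ℕ × ℕ × ℕ => g (p.1, p.2.1 + 1, p.2.2)
  rw [← e1, ← e2]
  exact h

lemma tsum_peel_last (hg : Summable g) :
    ∑' p, g p = ∑' p : ℕ × ℕ, g (p.1, p.2, 0) + ∑' p : ℕ × ℕ × ℕ, g (p.1, p.2.1, p.2.2 + 1) := by
  have h := tsum_peel_mid (g := g ∘ swap23) (swap23.summable_iff.2 hg)
  have e1 := swap23.tsum_eq g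
  have e2 := swap23.tsum_eq fun p : ℕ × ℕ × ℕ => g (p.1, p.2.1, p.2.2 + 1)
  rw [← e1, ← e2]
  exact h

end Peel

section Shift

variable {ι : Type*} {c : ι → ℂ} {e n : ι → ℕ}

lemma qTerm_shift (u τ : ℂ) (i : ι) :
    qTerm c e n (u + τ) τ i = qTerm c (fun i => e i + n i) n u τ i := by
  rw [qTerm, qTerm]; push_cast; ring_nf

lemma serH_peel {τ : ℂ} (hτ : 0 < τ.im) (u : ℂ) (w : ℕ) : serH w u τ = thetaPlus u τ +
    qSeries (fun p : ℕ × ℕ => (-1) ^ (p.1 + 1) * (2 * p.2 + 3 : ℂ) ^ w) expH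
      (fun p => p.1 + 1) (u + τ) τ := by
  rw [serH, qSeries, tsum_peel_snd ((adm_H w).summable hτ u), thetaPlus, qSeries]
  congr 1
  · refine tsum_congr fun k => ?_
    simp [qTerm, coeffH, expH]
  · refine tsum_congr fun p => ?_
    rw [qTerm_shift]
    simp only [qTerm, coeffH, expH]
    push_cast
    ring_nf

lemma serH_zero_shift {τ : ℂ} (hτ : 0 < τ.im) (u : ℂ) :
    serH 0 (u + τ) τ = serH 0 u τ - thetaPlus u τ := by
  rw [serH_peel hτ u 0, serH, add_sub_cancel_left]
  congr 1

lemma serH_one_shift {τ : ℂ} (hτ : 0 < τ.im) (u : ℂ) :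
    serH 1 (u + τ) τ = serH 1 u τ - 2 * serH 0 u τ + thetaPlus u τ := by
  have h0 := serH_zero_shift hτ u
  have : qSeries (fun p : ℕ × ℕ => (-1) ^ (p.1 + 1) * (2 * p.2 + 3 : ℂ) ^ 1) expH
      (fun p => p.1 + 1) (u + τ) τ = serH 1 (u + τ) τ + 2 * serH 0 (u + τ) τ := by
    rw [serH, serH, ← qSeries_const_mul, ← qSeries_add (adm_H 1)
      ((adm_H 0).of_norm_le 2 fun i => by simp) hτ]
    congr 1
    funext p
    simp only [coeffH]
    ring
  rw [serH_peel hτ u 1, this, h0]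
  ring

lemma serH_two_shift {τ : ℂ} (hτ : 0 < τ.im) (u : ℂ) : serH 2 (u + τ) τ =
    serH 2 u τ - 4 * serH 1 u τ + 4 * serH 0 u τ - thetaPlus u τ := by
  have h0 := serH_zero_shift hτ u
  have h1 := serH_one_shift hτ u
  have : qSeries (fun p : ℕ × ℕ => (-1) ^ (p.1 + 1) * (2 * p.2 + 3 : ℂ) ^ 2) expH
      (fun p => p.1 + 1) (u + τ) τ =
        serH 2 (u + τ) τ + 4 * serH 1 (u + τ) τ + 4 * serH 0 (u + τ) τ := by
    have a1 : Adm (fun i => 4 * coeffH 1 i) expH (fun p => p.1 + 1) :=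
      (adm_H 1).of_norm_le 4 fun i => by simp
    have a0 : Adm (fun i => 4 * coeffH 0 i) expH (fun p => p.1 + 1) :=
      (adm_H 0).of_norm_le 4 fun i => by simp
    rw [serH, serH, serH, ← qSeries_const_mul, ← qSeries_const_mul, add_assoc,
      ← qSeries_add a1 a0 hτ, ← qSeries_add (adm_H 2) ?_ hτ]
    · congr 1
      funext p
      simp only [coeffH]
      ring
    · intro T hT Y
      refine Summable.of_nonneg_of_le (fun p => by positivity) (fun p => ?_)
        ((a1 T hT Y).add (a0 T hT Y))
      rw [← add_mul]
      gcongr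
      exact norm_add_le _ _
  rw [serH_peel hτ u 2, this, h0, h1]
  ring

/-- The part of `K_w` with `l, m ≥ 1`, with `(2l-1)^w` in place of `(2l+1)^w`. -/
def serKInner (w : ℕ) (u τ : ℂ) : ℂ :=
  ∑' p : ℕ × ℕ × ℕ, (-1) ^ (p.1 + 1) * (2 * p.2.1 + 1 : ℂ) ^ w *
    Complex.exp (2 * Real.pi * Complex.I * ((expK (p.1, p.2.1 + 1, p.2.2 + 1) : ℕ) * τ +
      (p.1 + 1 : ℕ) * u))

/-- The translation `(K, l, m) ↦ (K - 1, l + 1, m + 1)` of the summation lattice realises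
`u ↦ u + τ`; its boundary contributes the plane `K = 0`. -/
lemma serK_shift {τ : ℂ} (hτ : 0 < τ.im) (u : ℂ) (w : ℕ) : serK w (u + τ) τ =
    -(Complex.exp (2 * Real.pi * Complex.I * (u + τ))) * (serSigma w τ + serKInner w u τ) := by
  set X := Complex.exp (2 * Real.pi * Complex.I * (u + τ)) with hX
  let g : ℕ × ℕ × ℕ → ℂ := fun p => (-1) ^ p.1 * (2 * p.2.1 + 1 : ℂ) ^ w *
    Complex.exp (2 * Real.pi * Complex.I *
      ((tri p.1 + p.1 * (p.2.1 + 1 + (p.2.2 + 1)) + (p.2.1 + 1) * (p.2.2 + 1) : ℕ) * τ +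
        (p.1 : ℕ) * u))
  have hterm : ∀ p, qTerm (coeffK w) expK (fun p => p.1 + 1) (u + τ) τ p = -X * g p := by
    intro p
    rw [qTerm_shift]
    simp only [g, hX, qTerm, coeffK, expK, tri_succ]
    rw [show ∀ a b c d : ℂ, -a * (b * c * d) = -(b * c) * (a * d) by intros; ring,
      ← Complex.exp_add, pow_succ]
    push_cast
    ring_nf
  have hs : Summable g := by
    have := (adm_K w).summable hτ (u + τ)
    have h2 : qTerm (coeffK w) expK (fun p => p.1 + 1) (u + τ) τ = fun p => -X * g p :=
      funext hterm
    rw [h2] at this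
    exact (summable_mul_left_iff (neg_ne_zero.2 (Complex.exp_ne_zero _))).1 this
  rw [serK, qSeries, tsum_congr hterm, tsum_mul_left, tsum_peel hs]
  congr 2
  rw [serSigma, qSeries]
  refine tsum_congr fun p => ?_
  simp [g, qTerm, tri]

lemma serK_peel {τ : ℂ} (hτ : 0 < τ.im) (u : ℂ) (w : ℕ) : serK w u τ = serH 0 u τ +
    ((serH w u τ - thetaPlus u τ) +
      ∑' p : ℕ × ℕ × ℕ, (-1) ^ (p.1 + 1) * (2 * p.2.1 + 3 : ℂ) ^ w *
        Complex.exp (2 * Real.pi * Complex.I * ((expK (p.1, p.2.1 + 1, p.2.2 + 1) : ℕ) * τ +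
        (p.1 + 1 : ℕ) * u))) := by
  have hs := (adm_K w).summable hτ u
  have hs2 : Summable fun p : ℕ × ℕ × ℕ =>
      qTerm (coeffK w) expK (fun p => p.1 + 1) u τ (p.1, p.2.1 + 1, p.2.2) :=
    hs.comp_injective (i := fun p : ℕ × ℕ × ℕ => (p.1, p.2.1 + 1, p.2.2)) fun a b h => by
      simp only [Prod.mk.injEq, add_left_inj] at h
      exact Prod.ext h.1 (Prod.ext h.2.1 h.2.2)
  rw [serK, qSeries, tsum_peel_mid hs, tsum_peel_last hs2, serH_peel hτ u w, add_sub_cancel_left]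
  congr 1
  · rw [serH, qSeries]
    refine tsum_congr fun p => ?_
    simp [qTerm, coeffK, expK, coeffH, expH]
  · congr 1
    · rw [qSeries]
      refine tsum_congr fun p => ?_
      rw [qTerm_shift]
      simp only [qTerm, coeffK, expK, expH]
      push_cast
      ring_nf
    · refine tsum_congr fun p => ?_
      simp only [qTerm, coeffK]
      push_cast
      ring_nf

lemma summable_serKInner {τ : ℂ} (hτ : 0 < τ.im) (u : ℂ) (w : ℕ) : Summable fun p : ℕ × ℕ × ℕ =>
    (-1) ^ (p.1 + 1) * (2 * p.2.1 + 1 : ℂ) ^ w *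
    Complex.exp (2 * Real.pi * Complex.I * ((expK (p.1, p.2.1 + 1, p.2.2 + 1) : ℕ) * τ +
      (p.1 + 1 : ℕ) * u)) := by
  have hs := (adm_K w).summable hτ u
  have hs2 := (hs.comp_injective (i := fun p : ℕ × ℕ × ℕ => (p.1, p.2.1 + 1, p.2.2 + 1))
    fun a b h => by
      simp only [Prod.mk.injEq, add_left_inj] at h
      exact Prod.ext h.1 (Prod.ext h.2.1 h.2.2)).norm
  refine Summable.of_norm_bounded hs2 fun p => ?_
  simp only [Function.comp, qTerm, coeffK, norm_mul, norm_pow]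
  rw [norm_two_mul_add_one, norm_two_mul_add_one]
  push_cast
  gcongr
  linarith

lemma serKInner_zero {τ : ℂ} (hτ : 0 < τ.im) (u : ℂ) :
    serKInner 0 u τ = serK 0 u τ - 2 * serH 0 u τ + thetaPlus u τ := by
  rw [serK_peel hτ u 0, serKInner]
  simp only [pow_zero]
  ring

lemma serKInner_one {τ : ℂ} (hτ : 0 < τ.im) (u : ℂ) : serKInner 1 u τ =
    serK 1 u τ - 2 * serK 0 u τ + 3 * serH 0 u τ - serH 1 u τ - thetaPlus u τ := by
  have h := serKInner_zero hτ u
  have : (∑' p : ℕ × ℕ × ℕ, (-1) ^ (p.1 + 1) * (2 * p.2.1 + 3 : ℂ) ^ 1 *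
        Complex.exp (2 * Real.pi * Complex.I * ((expK (p.1, p.2.1 + 1, p.2.2 + 1) : ℕ) * τ +
        (p.1 + 1 : ℕ) * u))) = serKInner 1 u τ + 2 * serKInner 0 u τ := by
    rw [serKInner, serKInner, ← tsum_mul_left, ← (summable_serKInner hτ u 1).tsum_add
      ((summable_serKInner hτ u 0).mul_left 2)]
    exact tsum_congr fun p => by ring
  rw [serK_peel hτ u 1, this, h]
  ring

lemma serK_zero_shift {τ : ℂ} (hτ : 0 < τ.im) (u : ℂ) :
    serK 0 (u + τ) τ = -(Complex.exp (2 * Real.pi * Complex.I * (u + τ))) *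
      (serK 0 u τ - 2 * serH 0 u τ + thetaPlus u τ + serSigma 0 τ) := by
  rw [serK_shift hτ, serKInner_zero hτ]; ring

lemma serK_one_shift {τ : ℂ} (hτ : 0 < τ.im) (u : ℂ) :
    serK 1 (u + τ) τ = -(Complex.exp (2 * Real.pi * Complex.I * (u + τ))) *
      (serK 1 u τ - 2 * serK 0 u τ + 3 * serH 0 u τ - serH 1 u τ - thetaPlus u τ
        + serSigma 1 τ) := by
  rw [serK_shift hτ, serKInner_one hτ]; ring

end Shift

/-! ### Quasi-periodic entire functions -/

lemma differentiable_deriv {f : ℂ → ℂ} (hf : Differentiable ℂ f) : Differentiable ℂ (deriv f) :=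
  fun _ => ((hf.differentiableOn (s := Set.univ)).deriv isOpen_univ).differentiableAt
    Filter.univ_mem

/-- An entire elliptic function is constant. -/
lemma entire_const_of_periodic {τ : ℂ} (hτ : 0 < τ.im) {f : ℂ → ℂ} (hf : Differentiable ℂ f)
    (h1 : ∀ u, f (u + 1) = f u) (h2 : ∀ u, f (u + τ) = f u) (u v : ℂ) : f u = f v := by
  have h1' : ∀ (m : ℤ) u, f (u + m) = f u := fun m u => by
    have : Function.Periodic f 1 := h1
    simpa using this.int_mul m u
  have h2' : ∀ (m : ℤ) u, f (u + m * τ) = f u := fun m u =>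
    (show Function.Periodic f τ from h2).int_mul m u
  refine hf.apply_eq_apply_of_bounded ?_ u v
  have hK : IsCompact (Set.Icc (0 : ℝ) 1 ×ℂ Set.Icc (0 : ℝ) τ.im) :=
    isCompact_Icc.reProdIm isCompact_Icc
  refine ((hK.image hf.continuous).isBounded).subset ?_
  rintro _ ⟨z, rfl⟩
  -- Translate `z` by periods into `[0, 1] × [0, Im τ]`.
  set n := ⌊z.im / τ.im⌋
  set w := z - n * τ with hw
  set m := ⌊w.re⌋
  refine ⟨w - m, ?_, ?_⟩
  · rw [Complex.mem_reProdIm]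
    have him : (w - m).im = z.im - n * τ.im := by simp [hw]
    have hn1 := Int.floor_le (z.im / τ.im)
    have hn2 := Int.lt_floor_add_one (z.im / τ.im)
    rw [le_div_iff₀ hτ] at hn1
    rw [div_lt_iff₀ hτ] at hn2
    refine ⟨⟨?_, ?_⟩, ?_, ?_⟩
    · simpa using Int.floor_le w.re
    · simpa using (Int.lt_floor_add_one w.re).le.trans (by rw [add_comm])
    · rw [him]; linarith
    · rw [him]; linarith
  · have e1 : f (w - m) = f w := by simpa using (h1' m (w - m)).symm
    have e2 : f w = f z := by simpa [hw] using (h2' n (z - n * τ)).symm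
    rw [e1, e2]

/-- An entire function with additive quasi-periods `α` along `1` and `β` along `τ` is affine. -/
lemma entire_affine_of_quasiperiodic {τ : ℂ} (hτ : 0 < τ.im) {f : ℂ → ℂ}
    (hf : Differentiable ℂ f) {α β : ℂ} (h1 : ∀ u, f (u + 1) = f u + α)
    (h2 : ∀ u, f (u + τ) = f u + β) : β = α * τ ∧ ∀ u, f u = f 0 + α * u := by
  have hd := differentiable_deriv hf
  have hper : ∀ (p γ : ℂ), (∀ u, f (u + p) = f u + γ) → ∀ u, deriv f (u + p) = deriv f u := by
    intro p γ h u
    rw [← deriv_comp_add_const, funext h, deriv_add_const]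
  have hc := entire_const_of_periodic hτ hd (hper 1 α h1) (hper τ β h2)
  have haff : ∀ u, f u = f 0 + deriv f 0 * u := by
    have hg : Differentiable ℂ fun u => f u - deriv f 0 * u := by fun_prop
    have hg' : ∀ u, deriv (fun u => f u - deriv f 0 * u) u = 0 := fun u => by
      have := ((hf u).hasDerivAt.sub ((hasDerivAt_id u).const_mul (deriv f 0))).deriv
      simp only [id] at this
      rw [show (fun u => f u - deriv f 0 * u) = (f - fun y => deriv f 0 * y) from rfl, this,
        hc u 0]
      ring
    intro u
    have : f u - deriv f 0 * u = f 0 - deriv f 0 * 0 := is_const_of_deriv_eq_zero hg hg' u 0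
    linear_combination this
  have hα : deriv f 0 = α := by
    have a := h1 0
    rw [haff (0 + 1)] at a
    linear_combination a
  refine ⟨?_, fun u => by rw [← hα]; exact haff u⟩
  have b := h2 0
  rw [haff (0 + τ), hα] at b
  linear_combination -b

/-! ### The theta function -/

/-- The theta function `∑_{n ∈ ℤ} (-1)^n q^(n(n+1)/2) x^n`. -/
def theta (u τ : ℂ) : ℂ := jacobiTheta₂ (u + 1 / 2 + τ / 2) τ

lemma theta_add_one (u τ : ℂ) : theta (u + 1) τ = theta u τ := by
  rw [theta, theta, ← jacobiTheta₂_add_left (u + 1 / 2 + τ / 2)]; ring_nf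

lemma theta_add_tau (u τ : ℂ) :
    theta (u + τ) τ = -Complex.exp (-(2 * Real.pi * Complex.I * (u + τ))) * theta u τ := by
  rw [theta, theta, show u + τ + 1 / 2 + τ / 2 = (u + 1 / 2 + τ / 2) + τ by ring,
    jacobiTheta₂_add_left', show -Real.pi * Complex.I * (τ + 2 * (u + 1 / 2 + τ / 2)) =
      -(2 * Real.pi * Complex.I * (u + τ)) - Real.pi * Complex.I by ring, Complex.exp_sub,
      Complex.exp_pi_mul_I]
  ring

lemma theta_zero (τ : ℂ) : theta 0 τ = 0 := by
  have h : jacobiTheta₂ (1 / 2 + τ / 2) τ = jacobiTheta₂ (1 / 2 - τ / 2) τ := by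
    rw [← jacobiTheta₂_neg_left, ← jacobiTheta₂_add_left]; ring_nf
  have h2 : jacobiTheta₂ (1 / 2 + τ / 2) τ = -jacobiTheta₂ (1 / 2 - τ / 2) τ := by
    rw [show 1 / 2 + τ / 2 = (1 / 2 - τ / 2) + τ by ring, jacobiTheta₂_add_left',
      show -Real.pi * Complex.I * (τ + 2 * (1 / 2 - τ / 2)) = -(Real.pi * Complex.I) by ring,
      Complex.exp_neg, Complex.exp_pi_mul_I]
    norm_num
  rw [theta, zero_add]
  linear_combination (h + h2) / 2

lemma theta_hasDerivAt {τ : ℂ} (hτ : 0 < τ.im) (u : ℂ) :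
    HasDerivAt (fun u => theta u τ) (jacobiTheta₂' (u + 1 / 2 + τ / 2) τ) u := by
  have h := hasDerivAt_jacobiTheta₂_fst (u + 1 / 2 + τ / 2) hτ
  have h2 : HasDerivAt (fun u : ℂ => u + 1 / 2 + τ / 2) 1 u :=
    ((hasDerivAt_id u).add_const _).add_const _
  simpa [theta, Function.comp_def] using h.comp u h2

lemma exp_neg_one_pow (n : ℤ) : Complex.exp (n * (Real.pi * Complex.I)) = (-1) ^ n := by
  rw [Complex.exp_int_mul, Complex.exp_pi_mul_I]

lemma theta_term (n : ℤ) (u τ : ℂ) : jacobiTheta₂_term n (u + 1 / 2 + τ / 2) τ =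
    (-1) ^ n * Complex.exp (2 * Real.pi * Complex.I * (n * (n + 1) / 2 * τ + n * u)) := by
  rw [jacobiTheta₂_term, ← exp_neg_one_pow, ← Complex.exp_add]
  ring_nf

lemma thetaPlus_term (u τ : ℂ) (k : ℕ) :
    qTerm (fun k : ℕ => (-1 : ℂ) ^ (k + 1)) (fun k => tri (k + 1)) (fun k => k + 1) u τ k =
      jacobiTheta₂_term ((k + 1 : ℕ) : ℤ) (u + 1 / 2 + τ / 2) τ := by
  rw [theta_term, qTerm, tri_cast, zpow_natCast]
  push_cast
  ring_nf

lemma thetaPlus_term_neg (u τ : ℂ) (k : ℕ) :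
    qTerm (fun k : ℕ => (-1 : ℂ) ^ (k + 1)) (fun k => tri (k + 1)) (fun k => k + 1) (-u - τ) τ k =
      jacobiTheta₂_term (-((k : ℤ) + 1)) (u + 1 / 2 + τ / 2) τ := by
  rw [theta_term, qTerm, tri_cast, zpow_neg, ← inv_zpow, inv_neg_one,
    show ((k : ℤ) + 1) = ((k + 1 : ℕ) : ℤ) by push_cast; ring, zpow_natCast]
  push_cast
  ring_nf

lemma theta_eq {τ : ℂ} (hτ : 0 < τ.im) (u : ℂ) :
    theta u τ = 1 + thetaPlus u τ + thetaPlus (-u - τ) τ := by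
  have hs := (summable_jacobiTheta₂_term_iff (u + 1 / 2 + τ / 2) τ).2 hτ
  have h1 : HasSum (fun n : ℕ => jacobiTheta₂_term (n : ℤ) (u + 1 / 2 + τ / 2) τ)
      (1 + thetaPlus u τ) := by
    have hs1 : Summable fun n : ℕ => jacobiTheta₂_term (n : ℤ) (u + 1 / 2 + τ / 2) τ :=
      hs.comp_injective Nat.cast_injective
    have h0 := hs1.hasSum
    have hz : jacobiTheta₂_term ((0 : ℕ) : ℤ) (u + 1 / 2 + τ / 2) τ = 1 := by
      simp [jacobiTheta₂_term]
    rw [hs1.tsum_eq_zero_add, hz, ← tsum_congr (thetaPlus_term u τ)] at h0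
    exact h0
  have h2 : HasSum (fun n : ℕ => jacobiTheta₂_term (-((n : ℤ) + 1)) (u + 1 / 2 + τ / 2) τ)
      (thetaPlus (-u - τ) τ) := by
    rw [← funext (thetaPlus_term_neg u τ)]
    exact (adm_thetaPlus.summable hτ (-u - τ)).hasSum
  have h3 := (HasSum.of_nat_of_neg_add_one
    (f := fun n : ℤ => jacobiTheta₂_term n (u + 1 / 2 + τ / 2) τ) h1 h2).tsum_eq
  rw [theta, jacobiTheta₂, h3]

/-- The series `P = ∑_{n ≥ 0} (-1)^n (2n+1) q^(n(n+1)/2)`. -/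
def serP (τ : ℂ) : ℂ :=
  qSeries (fun n : ℕ => (-1 : ℂ) ^ n * (2 * n + 1)) tri (fun _ => 0) 0 τ

lemma hasSum_serP {τ : ℂ} (hτ : 0 < τ.im) :
    HasSum (fun n : ℕ => qTerm (fun n : ℕ => (-1 : ℂ) ^ n * (2 * n + 1)) tri (fun _ => 0) 0 τ n)
      (jacobiTheta₂' (1 / 2 + τ / 2) τ / (2 * Real.pi * Complex.I)) := by
  have h := (hasSum_jacobiTheta₂'_term (1 / 2 + τ / 2) hτ).div_const (2 * Real.pi * Complex.I)
  have h2 := h.nat_add_neg_add_one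
  convert! h2 using 1
  funext k
  have hpi := Complex.two_pi_I_ne_zero
  have key : ∀ n : ℤ, jacobiTheta₂'_term n (1 / 2 + τ / 2) τ / (2 * Real.pi * Complex.I) =
      n * ((-1) ^ n * Complex.exp (2 * Real.pi * Complex.I * (n * (n + 1) / 2 * τ))) := fun n => by
    have := theta_term n 0 τ
    rw [zero_add, mul_zero, add_zero] at this
    rw [jacobiTheta₂'_term, this]
    field_simp
  rw [key, key, qTerm, tri_cast, zpow_neg, ← inv_zpow, inv_neg_one, zpow_add_one₀ (by norm_num),
    zpow_natCast]
  push_cast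
  ring_nf

lemma theta_deriv_zero {τ : ℂ} (hτ : 0 < τ.im) :
    jacobiTheta₂' (0 + 1 / 2 + τ / 2) τ = 2 * Real.pi * Complex.I * serP τ := by
  have := (hasSum_serP hτ).tsum_eq
  rw [serP, qSeries, this, zero_add]
  have hpi := Complex.two_pi_I_ne_zero
  field_simp

/-! ### The two theta identities -/

/-- `x = exp (2πiu)`. -/
def ex (u : ℂ) : ℂ := Complex.exp (2 * Real.pi * Complex.I * u)

lemma ex_ne_zero (u : ℂ) : ex u ≠ 0 := Complex.exp_ne_zero _

lemma ex_add (u v : ℂ) : ex (u + v) = ex u * ex v := by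
  rw [ex, ex, ex, ← Complex.exp_add]; ring_nf

lemma ex_neg (u : ℂ) : ex (-u) = (ex u)⁻¹ := by
  rw [ex, ex, ← Complex.exp_neg]; ring_nf

lemma ex_zero : ex 0 = 1 := by simp [ex]

lemma ex_one : ex 1 = 1 := by rw [ex, mul_one, Complex.exp_two_pi_mul_I]

lemma ex_hasDerivAt (u : ℂ) : HasDerivAt ex (2 * Real.pi * Complex.I * ex u) u := by
  have := ((hasDerivAt_id u).const_mul (2 * Real.pi * Complex.I)).cexp
  refine this.congr_deriv ?_
  simp only [ex, id]; ring

/-- The odd function `∑_{s ≠ 0} (-1)^s q^(s(s+1)/2) x^s / (1 - q^s)`. -/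
def serL (u τ : ℂ) : ℂ := serH 0 u τ - serH 0 (-u) τ

/-- The even function `∑_{s ≠ 0} (-1)^s q^(s(s+1)/2) (1 + q^s) x^s / (1 - q^s)^2`. -/
def serN (u τ : ℂ) : ℂ := serH 1 u τ + serH 1 (-u) τ

/-- The odd function obtained from `H_2`. -/
def serL2 (u τ : ℂ) : ℂ := serH 2 u τ - serH 2 (-u) τ

/-- The indefinite theta function `∑ (-1)^k q^(k(k+1)/2 + kl + km + lm) x^k`, over the two
cones `k > 0, l, m ≥ 0` and `k ≤ 0, l, m < 0`. -/
def serF (u τ : ℂ) : ℂ := serK 0 u τ - ex u * serK 0 (-u) τ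

/-- The series `serF` with an additional factor `2l + 1` in the summand. -/
def serG (u τ : ℂ) : ℂ := serK 1 u τ + ex u * serK 1 (-u) τ

lemma theta_add_tau' (u τ : ℂ) : theta (u + τ) τ = -(ex u * ex τ)⁻¹ * theta u τ := by
  rw [theta_add_tau, ← ex_add, ← ex_neg, ex]; ring_nf

lemma serK_zero_shift' {τ : ℂ} (hτ : 0 < τ.im) (u : ℂ) : serK 0 (u + τ) τ = -(ex u * ex τ) *
    (serK 0 u τ - 2 * serH 0 u τ + thetaPlus u τ + serSigma 0 τ) := by
  rw [serK_zero_shift hτ, ← ex_add, ex]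

lemma serK_one_shift' {τ : ℂ} (hτ : 0 < τ.im) (u : ℂ) : serK 1 (u + τ) τ = -(ex u * ex τ) *
    (serK 1 u τ - 2 * serK 0 u τ + 3 * serH 0 u τ - serH 1 u τ - thetaPlus u τ
      + serSigma 1 τ) := by
  rw [serK_one_shift hτ, ← ex_add, ex]

section Backward

lemma serH_zero_back {τ : ℂ} (hτ : 0 < τ.im) (u : ℂ) :
    serH 0 (-u - τ) τ = serH 0 (-u) τ + thetaPlus (-u - τ) τ := by
  have := serH_zero_shift hτ (-u - τ)
  rw [sub_add_cancel] at this
  rw [this]; ring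

lemma serH_one_back {τ : ℂ} (hτ : 0 < τ.im) (u : ℂ) :
    serH 1 (-u - τ) τ = serH 1 (-u) τ + 2 * serH 0 (-u) τ + thetaPlus (-u - τ) τ := by
  have := serH_one_shift hτ (-u - τ)
  rw [sub_add_cancel, serH_zero_back hτ] at this
  rw [this]; ring

lemma serH_two_back {τ : ℂ} (hτ : 0 < τ.im) (u : ℂ) :
    serH 2 (-u - τ) τ = serH 2 (-u) τ + 4 * serH 1 (-u) τ + 4 * serH 0 (-u) τ
      + thetaPlus (-u - τ) τ := by
  have := serH_two_shift hτ (-u - τ)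
  rw [sub_add_cancel, serH_zero_back hτ, serH_one_back hτ] at this
  rw [this]; ring

lemma serK_zero_back {τ : ℂ} (hτ : 0 < τ.im) (u : ℂ) :
    serK 0 (-u - τ) τ = -ex u * serK 0 (-u) τ + 2 * serH 0 (-u) τ + thetaPlus (-u - τ) τ
      - serSigma 0 τ := by
  have := serK_zero_shift' hτ (-u - τ)
  rw [← ex_add, sub_add_cancel, ex_neg, serH_zero_back hτ] at this
  rw [this]
  have := ex_ne_zero u
  field_simp
  ring

lemma serK_one_back {τ : ℂ} (hτ : 0 < τ.im) (u : ℂ) :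
    serK 1 (-u - τ) τ = -ex u * serK 1 (-u) τ - 2 * ex u * serK 0 (-u) τ + 3 * serH 0 (-u) τ
      + serH 1 (-u) τ + thetaPlus (-u - τ) τ - 2 * serSigma 0 τ - serSigma 1 τ := by
  have := serK_one_shift' hτ (-u - τ)
  rw [← ex_add, sub_add_cancel, ex_neg, serH_zero_back hτ, serH_one_back hτ,
    serK_zero_back hτ] at this
  rw [this]
  have := ex_ne_zero u
  field_simp
  ring

end Backward

lemma serL_shift {τ : ℂ} (hτ : 0 < τ.im) (u : ℂ) :
    serL (u + τ) τ = serL u τ + 1 - theta u τ := by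
  rw [serL, serL, theta_eq hτ, neg_add', serH_zero_shift hτ, serH_zero_back hτ]; ring

lemma serN_shift {τ : ℂ} (hτ : 0 < τ.im) (u : ℂ) :
    serN (u + τ) τ = serN u τ - 2 * serL u τ + theta u τ - 1 := by
  rw [serN, serN, serL, theta_eq hτ, neg_add', serH_one_shift hτ, serH_one_back hτ]; ring

lemma serL2_shift {τ : ℂ} (hτ : 0 < τ.im) (u : ℂ) :
    serL2 (u + τ) τ = serL2 u τ - 4 * serN u τ + 4 * serL u τ + 1 - theta u τ := by
  rw [serL2, serL2, serN, serL, theta_eq hτ, neg_add', serH_two_shift hτ, serH_two_back hτ]; ring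

lemma serF_shift {τ : ℂ} (hτ : 0 < τ.im) (u : ℂ) : serF (u + τ) τ =
    -(ex u * ex τ) * (serF u τ - 2 * serL u τ + theta u τ - 1) := by
  rw [serF, serF, serL, theta_eq hτ, neg_add', serK_zero_shift' hτ, serK_zero_back hτ, ex_add]
  ring

lemma serG_shift {τ : ℂ} (hτ : 0 < τ.im) (u : ℂ) : serG (u + τ) τ =
    -(ex u * ex τ) * (serG u τ - 2 * serF u τ + 3 * serL u τ - serN u τ + 1 - theta u τ
      + 2 * (serSigma 0 τ + serSigma 1 τ)) := by
  rw [serG, serG, serF, serL, serN, theta_eq hτ, neg_add', serK_one_shift' hτ, serK_one_back hτ,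
    ex_add]
  ring

/-- The `u`-derivative of `H_w`, up to the factor `2πi`. -/
def serHd (w : ℕ) (u τ : ℂ) : ℂ :=
  qSeries (fun p => coeffH w p * (p.1 + 1 : ℕ)) expH (fun p => p.1 + 1) u τ

/-- The second `u`-derivative of `H_w`, up to the factor `(2πi)^2`. -/
def serHdd (w : ℕ) (u τ : ℂ) : ℂ :=
  qSeries (fun p => coeffH w p * (p.1 + 1 : ℕ) * (p.1 + 1 : ℕ)) expH (fun p => p.1 + 1) u τ

/-- The `u`-derivative of `K_w`, up to the factor `2πi`. -/
def serKd (w : ℕ) (u τ : ℂ) : ℂ :=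
  qSeries (fun p => coeffK w p * (p.1 + 1 : ℕ)) expK (fun p => p.1 + 1) u τ

section Deriv

local notation "κ" => (2 * Real.pi * Complex.I : ℂ)

lemma serH_hasDerivAt (w : ℕ) {τ : ℂ} (hτ : 0 < τ.im) (u : ℂ) :
    HasDerivAt (fun u => serH w u τ) (κ * serHd w u τ) u :=
  (adm_H w).hasDerivAt_u hτ u

lemma serHd_hasDerivAt (w : ℕ) {τ : ℂ} (hτ : 0 < τ.im) (u : ℂ) :
    HasDerivAt (fun u => serHd w u τ) (κ * serHdd w u τ) u :=
  (adm_H w).mul_n.hasDerivAt_u hτ u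

lemma serK_hasDerivAt (w : ℕ) {τ : ℂ} (hτ : 0 < τ.im) (u : ℂ) :
    HasDerivAt (fun u => serK w u τ) (κ * serKd w u τ) u :=
  (adm_K w).hasDerivAt_u hτ u

lemma hasDerivAt_comp_neg' {f : ℂ → ℂ} {f' u : ℂ} (h : HasDerivAt f f' (-u)) :
    HasDerivAt (fun u => f (-u)) (-f') u := by
  have := h.comp u (hasDerivAt_neg u)
  simpa [Function.comp_def] using this

lemma serL_hasDerivAt {τ : ℂ} (hτ : 0 < τ.im) (u : ℂ) :
    HasDerivAt (fun u => serL u τ) (κ * (serHd 0 u τ + serHd 0 (-u) τ)) u :=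
  ((serH_hasDerivAt 0 hτ u).sub (hasDerivAt_comp_neg' (serH_hasDerivAt 0 hτ (-u)))).congr_deriv
    (by ring)

lemma serN_hasDerivAt {τ : ℂ} (hτ : 0 < τ.im) (u : ℂ) :
    HasDerivAt (fun u => serN u τ) (κ * (serHd 1 u τ - serHd 1 (-u) τ)) u :=
  ((serH_hasDerivAt 1 hτ u).add (hasDerivAt_comp_neg' (serH_hasDerivAt 1 hτ (-u)))).congr_deriv
    (by ring)

lemma serL2_hasDerivAt {τ : ℂ} (hτ : 0 < τ.im) (u : ℂ) :
    HasDerivAt (fun u => serL2 u τ) (κ * (serHd 2 u τ + serHd 2 (-u) τ)) u :=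
  ((serH_hasDerivAt 2 hτ u).sub (hasDerivAt_comp_neg' (serH_hasDerivAt 2 hτ (-u)))).congr_deriv
    (by ring)

lemma serF_hasDerivAt {τ : ℂ} (hτ : 0 < τ.im) (u : ℂ) :
    HasDerivAt (fun u => serF u τ)
      (κ * (serKd 0 u τ - ex u * serK 0 (-u) τ + ex u * serKd 0 (-u) τ)) u :=
  ((serK_hasDerivAt 0 hτ u).sub ((ex_hasDerivAt u).mul
    (hasDerivAt_comp_neg' (serK_hasDerivAt 0 hτ (-u))))).congr_deriv (by ring)

lemma serG_hasDerivAt {τ : ℂ} (hτ : 0 < τ.im) (u : ℂ) :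
    HasDerivAt (fun u => serG u τ)
      (κ * (serKd 1 u τ + ex u * serK 1 (-u) τ - ex u * serKd 1 (-u) τ)) u :=
  ((serK_hasDerivAt 1 hτ u).add ((ex_hasDerivAt u).mul
    (hasDerivAt_comp_neg' (serK_hasDerivAt 1 hτ (-u))))).congr_deriv (by ring)

end Deriv

lemma serH_add_one (w : ℕ) (u τ : ℂ) : serH w (u + 1) τ = serH w u τ := qSeries_add_one u τ

lemma serH_neg_add_one (w : ℕ) (u τ : ℂ) : serH w (-(u + 1)) τ = serH w (-u) τ := by
  rw [← serH_add_one w (-(u + 1))]; ring_nf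

lemma serK_add_one (w : ℕ) (u τ : ℂ) : serK w (u + 1) τ = serK w u τ := qSeries_add_one u τ

lemma serK_neg_add_one (w : ℕ) (u τ : ℂ) : serK w (-(u + 1)) τ = serK w (-u) τ := by
  rw [← serK_add_one w (-(u + 1))]; ring_nf

lemma serL_zero (τ : ℂ) : serL 0 τ = 0 := by simp [serL]

lemma serL2_zero (τ : ℂ) : serL2 0 τ = 0 := by simp [serL2]

/-- Both sides have the same quasi-periods, so that their difference is an entire elliptic
function. -/
theorem theta_mul_serF {τ : ℂ} (hτ : 0 < τ.im) (u : ℂ) :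
    theta u τ * serF u τ = serL u τ ^ 2 + serN u τ - serN 0 τ := by
  let D : ℂ → ℂ := fun u => theta u τ * serF u τ - serL u τ ^ 2 - serN u τ
  have hD : Differentiable ℂ D := fun u =>
    (((theta_hasDerivAt hτ u).mul (serF_hasDerivAt hτ u)).sub
      ((serL_hasDerivAt hτ u).pow 2)).sub (serN_hasDerivAt hτ u) |>.differentiableAt
  have h1 : ∀ u, D (u + 1) = D u := fun u => by
    simp only [D, theta_add_one, serF, serL, serN, serH_add_one, serH_neg_add_one, serK_add_one,
      serK_neg_add_one, ex_add, ex_one, mul_one]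
  have h2 : ∀ u, D (u + τ) = D u := fun u => by
    simp only [D]
    rw [theta_add_tau', serF_shift hτ, serL_shift hτ, serN_shift hτ]
    have := ex_ne_zero u
    have := ex_ne_zero τ
    field_simp
    ring
  have := entire_const_of_periodic hτ hD h1 h2 u 0
  simp only [D, theta_zero, serL_zero] at this
  linear_combination this

/-- The difference of both sides of the second identity is entire, `1`-periodic, and has a
constant additive `τ`-period; hence that constant vanishes, which evaluates `serN 0`. -/
theorem theta_mul_serG {τ : ℂ} (hτ : 0 < τ.im) :
    serN 0 τ = -(serSigma 0 τ + serSigma 1 τ) ∧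
    ∀ u, theta u τ * serG u τ = serL u τ * serN u τ + 3 / 4 * serL2 u τ
      + (2 * serN 0 τ + 1 / 4) * serL u τ := by
  let a : ℂ := -(serSigma 0 τ + serSigma 1 τ)
  let D : ℂ → ℂ := fun u => theta u τ * serG u τ - serL u τ * serN u τ - 3 / 4 * serL2 u τ
    - (2 * a + 1 / 4) * serL u τ
  have hD : Differentiable ℂ D := fun u =>
    (((((theta_hasDerivAt hτ u).mul (serG_hasDerivAt hτ u)).sub
      ((serL_hasDerivAt hτ u).mul (serN_hasDerivAt hτ u))).sub
      ((serL2_hasDerivAt hτ u).const_mul _)).sub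
      ((serL_hasDerivAt hτ u).const_mul _)).differentiableAt
  have h1 : ∀ u, D (u + 1) = D u + 0 := fun u => by
    simp only [D, theta_add_one, serG, serL, serL2, serN, serH_add_one, serH_neg_add_one,
      serK_add_one, serK_neg_add_one, ex_add, ex_one, mul_one, add_zero]
  -- The constant `serN 0` enters through `theta_mul_serF`.
  have h2 : ∀ u, D (u + τ) = D u + 2 * (serN 0 τ - a) := fun u => by
    have hF := theta_mul_serF hτ u
    simp only [D]
    rw [theta_add_tau', serG_shift hτ, serL_shift hτ, serN_shift hτ, serL2_shift hτ]
    have e1 := ex_ne_zero u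
    have e2 := ex_ne_zero τ
    rw [show ∀ A B C : ℂ, -A⁻¹ * B * (-A * C) = A⁻¹ * A * (B * C) by intros; ring,
      inv_mul_cancel₀ (mul_ne_zero e1 e2)]
    simp only [a]
    linear_combination (-2) * hF
  obtain ⟨hβ, hc⟩ := entire_affine_of_quasiperiodic hτ hD h1 h2
  have hN : serN 0 τ = a := by
    rw [zero_mul] at hβ
    linear_combination hβ / 2
  refine ⟨hN, fun u => ?_⟩
  have := hc u
  simp only [D, theta_zero, serL_zero, serL2_zero] at this
  rw [hN]
  linear_combination this

/-! ### Taylor coefficients at the origin -/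

section Taylor

local notation "κ" => (2 * Real.pi * Complex.I : ℂ)

/-- The second Taylor coefficient of `theta_mul_serF`. -/
lemma serP_mul_serK_zero {τ : ℂ} (hτ : 0 < τ.im) :
    serP τ * (2 * serKd 0 0 τ - serK 0 0 τ) = 4 * serHd 0 0 τ ^ 2 + serHdd 1 0 τ := by
  have dθ : Differentiable ℂ fun u => theta u τ := fun u => (theta_hasDerivAt hτ u).differentiableAt
  have dF : Differentiable ℂ fun u => serF u τ := fun u => (serF_hasDerivAt hτ u).differentiableAt
  have dL : Differentiable ℂ fun u => serL u τ := fun u => (serL_hasDerivAt hτ u).differentiableAt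
  have hF0 : serF 0 τ = 0 := by simp [serF, ex_zero]
  -- The identity `theta_mul_serF`, differentiated once at every `u`.
  have e1 : ∀ u, deriv (fun u => theta u τ) u * serF u τ + theta u τ * deriv (fun u => serF u τ) u
      - 2 * serL u τ * deriv (fun u => serL u τ) u = κ * (serHd 1 u τ - serHd 1 (-u) τ) := by
    intro u
    have h1 := (((dθ u).hasDerivAt.mul (dF u).hasDerivAt).sub ((dL u).hasDerivAt.pow 2)).unique
      (((serN_hasDerivAt hτ u).sub_const (serN 0 τ)).congr_of_eventuallyEq
        (Filter.Eventually.of_forall fun u => by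
          have := theta_mul_serF hτ u
          simp only [Pi.sub_apply, Pi.mul_apply, Pi.pow_apply]
          linear_combination this))
    push_cast at h1
    linear_combination h1
  have h2 := ((((differentiable_deriv dθ 0).hasDerivAt.mul (dF 0).hasDerivAt).add
    ((dθ 0).hasDerivAt.mul (differentiable_deriv dF 0).hasDerivAt)).sub
    (((dL 0).hasDerivAt.const_mul 2).mul (differentiable_deriv dL 0).hasDerivAt)).unique
    ((((serHd_hasDerivAt 1 hτ 0).sub (hasDerivAt_comp_neg' (by
      rw [neg_zero]; exact serHd_hasDerivAt 1 hτ 0))).const_mul κ).congr_of_eventuallyEq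
      (Filter.Eventually.of_forall e1))
  rw [(theta_hasDerivAt hτ 0).deriv, (serF_hasDerivAt hτ 0).deriv, (serL_hasDerivAt hτ 0).deriv,
    theta_zero, serL_zero, hF0, theta_deriv_zero hτ, neg_zero, ex_zero] at h2
  have hκ : κ ^ 2 ≠ 0 := pow_ne_zero 2 Complex.two_pi_I_ne_zero
  apply mul_left_cancel₀ hκ
  linear_combination h2 / 2

/-- The first Taylor coefficient of `theta_mul_serG`. -/
lemma serP_mul_serK_one {τ : ℂ} (hτ : 0 < τ.im) :
    serP τ * serK 1 0 τ = (3 * serN 0 τ + 1 / 4) * serHd 0 0 τ + 3 / 4 * serHd 2 0 τ := by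
  have h := ((theta_hasDerivAt hτ 0).mul (serG_hasDerivAt hτ 0)).unique
    (((((serL_hasDerivAt hτ 0).mul (serN_hasDerivAt hτ 0)).add
      ((serL2_hasDerivAt hτ 0).const_mul (3 / 4))).add
      ((serL_hasDerivAt hτ 0).const_mul (2 * serN 0 τ + 1 / 4))).congr_of_eventuallyEq
      (Filter.Eventually.of_forall fun u => (theta_mul_serG hτ).2 u))
  rw [theta_zero, serL_zero, theta_deriv_zero hτ, serG, neg_zero, ex_zero] at h
  apply mul_left_cancel₀ Complex.two_pi_I_ne_zero
  linear_combination h / 2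

/-- The `τ`-derivative of `serN 0`. -/
lemma serN_hasDerivAt_tau {τ : ℂ} (hτ : 0 < τ.im) :
    HasDerivAt (fun τ => serN 0 τ) (κ * (serHd 2 0 τ + serHdd 1 0 τ)) τ := by
  have h : (fun τ => serN 0 τ) = fun τ => 2 * serH 1 0 τ := by
    funext τ; rw [serN, neg_zero]; ring
  rw [h]
  refine (((adm_H 1).hasDerivAt_tau hτ 0).const_mul 2).congr_deriv ?_
  rw [serHd, serHdd, ← qSeries_add ((adm_H 2).mul_n) ((adm_H 1).mul_n.mul_n) hτ]
  rw [show ∀ a b : ℂ, 2 * (a * b) = a * (2 * b) by intros; ring, ← qSeries_const_mul]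
  congr 2
  funext p
  simp only [expH, coeffH]
  push_cast
  rw [tri_cast]
  push_cast
  ring

/-- The series `∑ (-1)^(n+a+b) (6n - 2a - 2b + 7) q^(...)` of `c_{yz4}`, at `k = n - a - b`. -/
def serS4 (τ : ℂ) : ℂ :=
  qSeries (fun p : ℕ × ℕ × ℕ => (-1) ^ p.1 * (6 * p.1 + 4 * p.2.1 + 4 * p.2.2 + 7 : ℂ)) expK
    (fun p => p.1 + 1) 0 τ

lemma expK_swap (p : ℕ × ℕ × ℕ) : expK (swap23 p) = expK p := by
  simp only [expK, swap23, Equiv.coe_fn_mk]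
  ring

/-- The coefficient of `K_1` with the roles of `l` and `m` exchanged. -/
def coeffK' (p : ℕ × ℕ × ℕ) : ℂ := (-1) ^ (p.1 + 1) * (2 * p.2.2 + 1)

lemma coeffK'_eq (p : ℕ × ℕ × ℕ) : coeffK' p = coeffK 1 (swap23 p) := by
  simp [coeffK, coeffK', swap23]

lemma adm_K' : Adm coeffK' expK (fun p => p.1 + 1) := fun T hT Y => by
  refine ((swap23.summable_iff).2 (adm_K 1 T hT Y)).congr fun p => ?_
  simp only [Function.comp, coeffK'_eq, expK_swap]
  rfl

lemma qSeries_coeffK' (τ : ℂ) : qSeries coeffK' expK (fun p => p.1 + 1) 0 τ = serK 1 0 τ := by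
  rw [serK, ← qSeries_equiv (c := coeffK 1) swap23]
  congr 1
  · exact funext coeffK'_eq
  · exact (funext expK_swap).symm

lemma Adm.add {ι : Type*} {c c' : ι → ℂ} {e n : ι → ℕ} (h : Adm c e n) (h' : Adm c' e n) :
    Adm (fun i => c i + c' i) e n := fun T hT Y => by
  refine Summable.of_nonneg_of_le (fun p => by positivity) (fun p => ?_)
    ((h T hT Y).add (h' T hT Y))
  rw [← add_mul]
  gcongr
  exact norm_add_le _ _

lemma Adm.const_mul {ι : Type*} {c : ι → ℂ} {e n : ι → ℕ} (h : Adm c e n) (a : ℂ) :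
    Adm (fun i => a * c i) e n :=
  h.of_norm_le ‖a‖ fun _ => (norm_mul _ _).le

lemma coeffS4_eq (p : ℕ × ℕ × ℕ) :
    (-1) ^ p.1 * (6 * p.1 + 4 * p.2.1 + 4 * p.2.2 + 7 : ℂ) =
      (-6) * (coeffK 0 p * (p.1 + 1 : ℕ)) + (3 * coeffK 0 p + ((-2) * coeffK 1 p +
        (-2) * coeffK' p)) := by
  simp only [coeffK, coeffK']
  push_cast
  ring

lemma adm_S4 : Adm (fun p : ℕ × ℕ × ℕ => (-1) ^ p.1 * (6 * p.1 + 4 * p.2.1 + 4 * p.2.2 + 7 : ℂ))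
    expK (fun p => p.1 + 1) := by
  rw [funext coeffS4_eq]
  exact ((adm_K 0).mul_n.const_mul _).add
    (((adm_K 0).const_mul _).add (((adm_K 1).const_mul _).add (adm_K'.const_mul _)))

lemma serS4_eq {τ : ℂ} (hτ : 0 < τ.im) :
    serS4 τ = -(3 * (2 * serKd 0 0 τ - serK 0 0 τ) + 4 * serK 1 0 τ) := by
  rw [serS4, funext coeffS4_eq, qSeries_add ((adm_K 0).mul_n.const_mul _)
    (((adm_K 0).const_mul _).add (((adm_K 1).const_mul _).add (adm_K'.const_mul _))) hτ,
    qSeries_add ((adm_K 0).const_mul _) (((adm_K 1).const_mul _).add (adm_K'.const_mul _)) hτ,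
    qSeries_add ((adm_K 1).const_mul _) (adm_K'.const_mul _) hτ,
    qSeries_const_mul, qSeries_const_mul, qSeries_const_mul, qSeries_const_mul, qSeries_coeffK']
  rw [← serK, ← serK, ← serKd]
  ring

/-- The product of `P` with the series of `c_{yz4}` is a polynomial in Taylor coefficients of the
Appell-type series. -/
theorem serP_mul_serS4 {τ : ℂ} (hτ : 0 < τ.im) :
    serP τ * serS4 τ = -12 * serHd 0 0 τ ^ 2 - (1 + 12 * serN 0 τ) * serHd 0 0 τ
      - 3 * (serHd 2 0 τ + serHdd 1 0 τ) := by
  rw [serS4_eq hτ]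
  linear_combination (-3) * serP_mul_serK_zero hτ - 4 * serP_mul_serK_one hτ

end Taylor

/-! ### The series of `c_{yz2}` and `c_{yz4}` -/

/-- Pairs `n ≥ a ≥ 0`, parametrised by `(n - a, a)`. -/
def pairEquiv : ℕ × ℕ ≃ {p : ℕ × ℕ // p.2 ≤ p.1} where
  toFun p := ⟨(p.1 + p.2, p.2), Nat.le_add_left _ _⟩
  invFun p := (p.1.1 - p.1.2, p.1.2)
  left_inv p := by simp
  right_inv p := by
    have := p.2
    ext <;> simp [Nat.sub_add_cancel this]

/-- Triples with `n ≥ a + b`, parametrised by `(n - a - b, a, b)`. -/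
def tripleEquiv : ℕ × ℕ × ℕ ≃ {p : ℕ × ℕ × ℕ // p.2.1 + p.2.2 ≤ p.1} where
  toFun p := ⟨(p.1 + (p.2.1 + p.2.2), p.2.1, p.2.2), Nat.le_add_left _ _⟩
  invFun p := (p.1.1 - (p.1.2.1 + p.1.2.2), p.1.2.1, p.1.2.2)
  left_inv p := by simp
  right_inv p := by
    have := p.2
    ext <;> simp [Nat.sub_add_cancel this]

lemma cyTerm_eq (τ : ℍ) : cyTerm τ =
    fun n => -qTerm (fun n : ℕ => (-1 : ℂ) ^ n * (2 * n + 1)) tri (fun _ => 0) 0 (τ : ℂ) n := by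
  funext n
  rw [cyTerm, qTerm, qPow, tri_cast, pow_succ]
  push_cast
  ring_nf

lemma cyz4Term_eq (τ : ℍ) : cyz4Term τ ∘ tripleEquiv =
    qTerm (fun p : ℕ × ℕ × ℕ => (-1) ^ p.1 * (6 * p.1 + 4 * p.2.1 + 4 * p.2.2 + 7 : ℂ)) expK
      (fun p => p.1 + 1) 0 (τ : ℂ) := by
  funext p
  obtain ⟨k, l, m⟩ := p
  simp only [Function.comp, tripleEquiv, Equiv.coe_fn_mk, cyz4Term, qTerm, qPow, expK]
  have : (-1 : ℂ) ^ (k + (l + m) + l + m) = (-1) ^ k := by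
    rw [show k + (l + m) + l + m = k + 2 * (l + m) by ring, pow_add, pow_mul]; norm_num
  rw [this]
  push_cast
  rw [tri_cast]
  push_cast
  ring_nf

/-- At `(n, a) = (k + l, l)` the first half of the summand belongs to the `u`-derivative of `H_0`
and to `H_1`. In the second half `(k+1)(l+1)` is the exponent and `2n + 4 = 2(k+1) + 2(l+1)` is
split symmetrically, which leads to divisor sums. -/
lemma cyz2Term_eq (τ : ℍ) : cyz2Term τ ∘ pairEquiv = fun p =>
    qTerm (fun p => (-6) * (coeffH 0 p * (p.1 + 1 : ℕ)) + (-2) * coeffH 1 p) expH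
      (fun p => p.1 + 1) 0 (τ : ℂ) p +
    (qTerm (fun p : ℕ × ℕ => (2 * p.1 + 1 : ℂ) ^ 1 + (2 * p.1 + 1 : ℂ) ^ 0)
      (fun p => (p.1 + 1) * (p.2 + 1)) (fun _ => 0) 0 (τ : ℂ) p +
    qTerm (fun p : ℕ × ℕ => (2 * p.1 + 1 : ℂ) ^ 1 + (2 * p.1 + 1 : ℂ) ^ 0)
      (fun p => (p.1 + 1) * (p.2 + 1)) (fun _ => 0) 0 (τ : ℂ) p.swap) := by
  funext p
  obtain ⟨k, l⟩ := p
  simp only [Function.comp, pairEquiv, Equiv.coe_fn_mk, cyz2Term, qTerm, qPow, expH, coeffH,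
    Prod.swap]
  have : (-1 : ℂ) ^ (k + l + l) = (-1) ^ k := by
    rw [show k + l + l = k + 2 * l by ring, pow_add, pow_mul]; norm_num
  rw [this]
  push_cast
  rw [tri_cast]
  push_cast
  ring_nf

lemma summable_cyTerm (τ : ℍ) : Summable (cyTerm τ) := by
  rw [cyTerm_eq]
  have h := (hasSum_serP τ.2).summable
  exact h.neg

lemma summable_cyz4Term (τ : ℍ) : Summable (cyz4Term τ) := by
  rw [← tripleEquiv.summable_iff, cyz4Term_eq]
  exact adm_S4.summable τ.2 0

lemma adm_cyz2 : Adm (fun p => (-6) * (coeffH 0 p * (p.1 + 1 : ℕ)) + (-2) * coeffH 1 p) expH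
      (fun p => p.1 + 1) :=
  ((adm_H 0).mul_n.const_mul _).add ((adm_H 1).const_mul _)

lemma adm_sigma_add : Adm (fun p : ℕ × ℕ => (2 * p.1 + 1 : ℂ) ^ 1 + (2 * p.1 + 1 : ℂ) ^ 0)
      (fun p => (p.1 + 1) * (p.2 + 1)) (fun _ => 0) :=
  (adm_sigma 1).add (adm_sigma 0)

lemma summable_cyz2Term (τ : ℍ) : Summable (cyz2Term τ) := by
  rw [← pairEquiv.summable_iff, cyz2Term_eq]
  exact (adm_cyz2.summable τ.2 0).add ((adm_sigma_add.summable τ.2 0).add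
    ((Equiv.prodComm ℕ ℕ).summable_iff.2 (adm_sigma_add.summable τ.2 0)))

lemma tsum_cyTerm (τ : ℍ) : ∑' n, cyTerm τ n = -serP τ := by
  rw [cyTerm_eq, tsum_neg]; rfl

lemma tsum_cyz4Term (τ : ℍ) : ∑' p, cyz4Term τ p = serS4 τ := by
  rw [← tripleEquiv.tsum_eq]
  exact congrArg tsum (cyz4Term_eq τ) |>.trans rfl

lemma tsum_cyz2Term (τ : ℍ) : ∑' p, cyz2Term τ p = -6 * serHd 0 0 τ - 3 * serN 0 τ := by
  have hs := adm_sigma_add.summable τ.2 0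
  have h1 : ∑' p, cyz2Term τ p = ∑' p, (cyz2Term τ ∘ pairEquiv) p := (pairEquiv.tsum_eq _).symm
  have h2 := (Equiv.prodComm ℕ ℕ).tsum_eq (qTerm
    (fun p : ℕ × ℕ => (2 * p.1 + 1 : ℂ) ^ 1 + (2 * p.1 + 1 : ℂ) ^ 0)
      (fun p => (p.1 + 1) * (p.2 + 1)) (fun _ => 0) 0 (τ : ℂ))
  simp only [Equiv.prodComm_apply] at h2
  have h3 := qSeries_add (adm_sigma 1) (adm_sigma 0) τ.2 0
  have h4 := qSeries_add ((adm_H 0).mul_n.const_mul (-6)) ((adm_H 1).const_mul (-2)) τ.2 0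
  rw [qSeries_const_mul, qSeries_const_mul, ← serHd, ← serH] at h4
  rw [← serSigma, ← serSigma] at h3
  have hs' : Summable fun p : ℕ × ℕ => qTerm
      (fun p : ℕ × ℕ => (2 * p.1 + 1 : ℂ) ^ 1 + (2 * p.1 + 1 : ℂ) ^ 0)
      (fun p => (p.1 + 1) * (p.2 + 1)) (fun _ => 0) 0 (τ : ℂ) p.swap :=
    (Equiv.prodComm ℕ ℕ).summable_iff.2 hs
  rw [h1, cyz2Term_eq, (adm_cyz2.summable τ.2 0).tsum_add (hs.add hs'), hs.tsum_add hs', h2]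
  rw [← qSeries, ← qSeries, h3, h4]
  have hN : serN 0 (τ : ℂ) = 2 * serH 1 0 τ := by rw [serN, neg_zero]; ring
  have hσ := (theta_mul_serG τ.2).1
  rw [hN] at hσ ⊢
  -- The divisor sums are `-serN 0` by the second theta identity.
  linear_combination 2 * hσ

/-! ### The eta function and the Eisenstein series of weight two -/

lemma coe_S_smul (z : ℍ) : ((ModularGroup.S • z : ℍ) : ℂ) = -1 / (z : ℂ) := by
  rw [modular_S_smul]
  simp [neg_div, inv_neg]

lemma coe_T_smul (z : ℍ) : ((ModularGroup.T • z : ℍ) : ℂ) = z + 1 := by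
  rw [modular_T_smul]
  simp [add_comm]

/-- The Lambert series of `E₂` is `serN 0`, by the second theta identity. -/
lemma E2_eq_serN (z : ℍ) : EisensteinSeries.E2 z = 1 + 12 * serN 0 z := by
  have hq := UpperHalfPlane.norm_exp_two_pi_I_lt_one z
  rw [EisensteinSeries.E2_eq_tsum_cexp, (theta_mul_serG z.im_pos).1,
    ← tsum_prod_pow_eq_tsum_sigma 1 hq, ← (summable_prod_mul_pow 1 hq).tsum_prod,
    ← (Equiv.prodComm _ _).tsum_eq, ← (Equiv.pnatEquivNat.symm.prodCongr
      Equiv.pnatEquivNat.symm).tsum_eq, serSigma, serSigma,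
    ← qSeries_add (adm_sigma 0) (adm_sigma 1) z.im_pos]
  have : ∀ p : ℕ × ℕ, qTerm (fun p : ℕ × ℕ => (2 * p.1 + 1 : ℂ) ^ 0 + (2 * p.1 + 1 : ℂ) ^ 1)
      (fun p => (p.1 + 1) * (p.2 + 1)) (fun _ => 0) 0 z p = 2 * ((p.1 + 1 : ℕ) ^ 1 *
        Complex.exp (2 * Real.pi * Complex.I * z) ^ ((p.2 + 1) * (p.1 + 1))) := fun p => by
    rw [qTerm, ← Complex.exp_nat_mul]
    push_cast
    ring_nf
  rw [qSeries, tsum_congr this, tsum_mul_left]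
  simp only [Equiv.prodCongr_apply, Prod.map, Equiv.pnatEquivNat_symm_apply, Equiv.prodComm_apply,
    Prod.swap, Nat.succPNat_coe, Nat.succ_eq_add_one]
  ring

lemma serN_zero_neg_inv {τ : ℂ} (hτ : 0 < τ.im) : 1 + 12 * serN 0 (-1 / τ) =
    τ ^ 2 * (1 + 12 * serN 0 τ) + 6 * τ / (Real.pi * Complex.I) := by
  have h := congrFun (EisensteinSeries.E2_slash_action ModularGroup.S) ⟨τ, hτ⟩
  have h0 : τ ≠ 0 := fun h => by simp [h] at hτ
  have hpi : (Real.pi : ℂ) ≠ 0 := by exact_mod_cast Real.pi_ne_zero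
  rw [ModularForm.SL_slash_apply, ModularGroup.denom_S, E2_eq_serN, coe_S_smul, Pi.sub_apply,
    Pi.smul_apply, EisensteinSeries.D2_S, E2_eq_serN, riemannZeta_two, smul_eq_mul] at h
  simp only [Int.reduceNeg, zpow_neg] at h
  have h2 : (1 + 12 * serN 0 (-1 / τ)) = τ ^ 2 * (1 + 12 * serN 0 τ -
      1 / (2 * (Real.pi ^ 2 / 6)) * (2 * Real.pi * Complex.I / τ)) := by
    rw [← h]
    field_simp
  rw [h2]
  field_simp
  linear_combination (-6) * Complex.I_sq

/-- The derivative `q d/dq` of the Eisenstein series `1 + 12 * serN 0`. -/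
def dE2 (τ : ℂ) : ℂ := 12 * (serHd 2 0 τ + serHdd 1 0 τ)

/-- `E₂² - 12 q dE₂/dq` has weight four (it is `E₄`). -/
lemma E2_sq_sub_neg_inv {τ : ℂ} (hτ : 0 < τ.im) :
    (1 + 12 * serN 0 (-1 / τ)) ^ 2 - 12 * dE2 (-1 / τ) =
      τ ^ 4 * ((1 + 12 * serN 0 τ) ^ 2 - 12 * dE2 τ) := by
  have h0 : τ ≠ 0 := fun h => by simp [h] at hτ
  have hpi : (Real.pi : ℂ) ≠ 0 := by exact_mod_cast Real.pi_ne_zero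
  have hI := Complex.I_ne_zero
  have hτ' : 0 < (-1 / τ).im := by
    have := (ModularGroup.S • (⟨τ, hτ⟩ : ℍ)).im_pos
    rwa [← UpperHalfPlane.coe_im, coe_S_smul] at this
  have hd : HasDerivAt (fun τ : ℂ => -1 / τ) (1 / τ ^ 2) τ := by
    simpa [div_eq_mul_inv] using (hasDerivAt_inv h0).const_mul (-1)
  have h1 := (((serN_hasDerivAt_tau hτ').comp τ hd).const_mul 12).const_add 1
  have h2 := ((hasDerivAt_pow 2 τ).mul (((serN_hasDerivAt_tau hτ).const_mul 12).const_add 1)).add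
    (((hasDerivAt_id τ).const_mul 6).div_const (Real.pi * Complex.I))
  have h3 := h1.congr_of_eventuallyEq (f₁ := fun τ => τ ^ 2 * (1 + 12 * serN 0 τ) +
      6 * τ / (Real.pi * Complex.I)) (by
    filter_upwards [(isOpen_lt continuous_const Complex.continuous_im).mem_nhds hτ] with w hw
    exact (serN_zero_neg_inv hw).symm)
  have h4 := h3.unique h2
  rw [serN_zero_neg_inv hτ]
  -- The derivative of the transformation law of `E₂`.
  have h5 : dE2 (-1 / τ) = τ ^ 2 / (2 * Real.pi * Complex.I) * (2 * τ * (1 + 12 * serN 0 τ) +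
      τ ^ 2 * (2 * Real.pi * Complex.I * dE2 τ) + 6 / (Real.pi * Complex.I)) := by
    simp only [dE2] at h4 ⊢
    simp only [Nat.cast_ofNat, Nat.add_one_sub_one, pow_one, mul_one] at h4
    have h6 : 12 * (serHd 2 0 (-1 / τ) + serHdd 1 0 (-1 / τ)) = τ ^ 2 / (2 * Real.pi * Complex.I) *
      (12 * (2 * Real.pi * Complex.I * (serHd 2 0 (-1 / τ) + serHdd 1 0 (-1 / τ)) *
        (1 / τ ^ 2))) := by
      field_simp
    rw [h6, h4]
    ring
  rw [h5]
  field_simp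
  ring

lemma eta_ne_zero (τ : ℍ) : eta τ ≠ 0 := ModularForm.eta_ne_zero τ.2

lemma eta_S (τ : ℍ) : eta (ModularGroup.S • τ) = (-Complex.I * τ) ^ (1 / 2 : ℂ) * eta τ := by
  have h := ModularForm.eta_comp_eq_csqrt_I_inv τ.2
  rw [eta, eta, coe_S_smul]
  simp only [Function.comp_apply, Pi.smul_apply, Pi.mul_apply, smul_eq_mul] at h
  rw [h, ← mul_assoc]
  congr 1
  have h0 := τ.ne_zero
  have harg : (Complex.log (-Complex.I * τ)) = Complex.log (-Complex.I) + Complex.log τ := by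
    rw [Complex.log_mul_eq_add_log_iff (by simp) h0, Complex.arg_neg_I]
    have h1 : 0 ≤ Complex.arg τ := Complex.arg_nonneg_iff.2 τ.im_pos.le
    have h2 := Complex.arg_le_pi (τ : ℂ)
    have := Real.pi_pos
    constructor <;> linarith
  rw [Complex.cpow_def_of_ne_zero (by simp [h0]), harg, Complex.sqrt, Complex.sqrt,
    Complex.cpow_def_of_ne_zero h0, Complex.cpow_def_of_ne_zero Complex.I_ne_zero,
    ← Complex.exp_neg, ← Complex.exp_add, Complex.log_neg_I, Complex.log_I]
  ring_nf

lemma eta_T (τ : ℍ) :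
    eta (ModularGroup.T • τ) = Complex.exp (Real.pi * Complex.I / 12) * eta τ := by
  rw [eta, eta, coe_T_smul, ModularForm.eta, ModularForm.eta]
  have h1 : ∀ n : ℕ, ModularForm.eta_q n ((τ : ℂ) + 1) = ModularForm.eta_q n τ := fun n => by
    rw [ModularForm.eta_q_eq_pow, ModularForm.eta_q_eq_pow, mul_add, Complex.exp_add, mul_one,
      Complex.exp_two_pi_mul_I, mul_one]
  simp only [h1, Function.Periodic.qParam]
  rw [← mul_assoc, ← Complex.exp_add]
  push_cast
  ring_nf

lemma autFactor_base_ne_zero (γ : Matrix.SpecialLinearGroup (Fin 2) ℤ) (τ : ℍ) :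
    (γ 1 0 : ℂ) * (τ : ℂ) + (γ 1 1 : ℂ) ≠ 0 := by
  rw [← ModularGroup.denom_apply]
  exact UpperHalfPlane.denom_ne_zero _ τ

lemma autFactor_ne_zero (k : ℝ) (γ : Matrix.SpecialLinearGroup (Fin 2) ℤ) (τ : ℍ) :
    autFactor k γ τ ≠ 0 := by
  rw [autFactor, Complex.cpow_def_of_ne_zero (autFactor_base_ne_zero γ τ)]
  exact Complex.exp_ne_zero _

lemma autFactor_add (k l : ℝ) (γ : Matrix.SpecialLinearGroup (Fin 2) ℤ) (τ : ℍ) :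
    autFactor (k + l) γ τ = autFactor k γ τ * autFactor l γ τ := by
  rw [autFactor, autFactor, autFactor, Complex.ofReal_add,
    Complex.cpow_add _ _ (autFactor_base_ne_zero γ τ)]

lemma autFactor_natCast (k : ℕ) (γ : Matrix.SpecialLinearGroup (Fin 2) ℤ) (τ : ℍ) :
    autFactor k γ τ = ((γ 1 0 : ℂ) * (τ : ℂ) + (γ 1 1 : ℂ)) ^ k := by
  rw [autFactor, Complex.ofReal_natCast, Complex.cpow_natCast]

lemma autFactor_half_pow (k : ℕ) (γ : Matrix.SpecialLinearGroup (Fin 2) ℤ) (τ : ℍ) :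
    autFactor (1 / 2) γ τ ^ k = autFactor (k / 2) γ τ := by
  rw [autFactor, autFactor, ← Complex.cpow_nat_mul]
  congr 1
  push_cast
  ring

/-- Invariance under the two generators of the modular group implies invariance. -/
lemma transformsLike_of_generators (k : ℕ) {f : ℍ → ℂ}
    (hS : ∀ τ : ℍ, f (ModularGroup.S • τ) = (τ : ℂ) ^ k * f τ)
    (hT : ∀ τ : ℍ, f (ModularGroup.T • τ) = f τ) : TransformsLike k (fun _ => 1) f := by
  intro γ τ
  have h := congrFun (SlashInvariantForm.slash_action_generators_SL2Z (f := f) (k := k)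
    (by
      ext z
      rw [ModularForm.SL_slash_apply, ModularGroup.denom_S, hS, zpow_neg, zpow_natCast]
      field_simp [z.ne_zero])
    (by
      ext z
      rw [ModularForm.SL_slash_apply, hT, ModularGroup.denom_apply]
      simp [ModularGroup.T]) γ) τ
  rw [ModularForm.SL_slash_apply, ModularGroup.denom_apply, zpow_neg, zpow_natCast] at h
  have h0 := autFactor_base_ne_zero γ τ
  rw [one_mul, autFactor_natCast, ← h]
  field_simp

lemma TransformsLike.congr_weight {k l : ℝ} {ν : Matrix.SpecialLinearGroup (Fin 2) ℤ → ℂ}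
    {f : ℍ → ℂ} (h : TransformsLike k ν f) (hk : k = l) : TransformsLike l ν f := hk ▸ h

lemma eta_pow_24_transforms (γ : Matrix.SpecialLinearGroup (Fin 2) ℤ) (τ : ℍ) :
    eta (γ • τ) ^ 24 = ((γ 1 0 : ℂ) * (τ : ℂ) + (γ 1 1 : ℂ)) ^ 12 * eta τ ^ 24 := by
  have h := congrFun (SlashInvariantForm.slash_action_generators_SL2Z
    ModularForm.discriminant_S_invariant ModularForm.discriminant_T_invariant γ) τ
  rw [ModularForm.SL_slash_apply, ModularGroup.denom_apply, zpow_neg, ModularForm.discriminant,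
    ModularForm.discriminant] at h
  have h0 := autFactor_base_ne_zero γ τ
  rw [eta, eta, ← h]
  field_simp

lemma continuous_smul_modular (γ : Matrix.SpecialLinearGroup (Fin 2) ℤ) :
    Continuous fun τ : ℍ => γ • τ :=
  continuous_const_smul (Matrix.SpecialLinearGroup.toGL
    (Matrix.SpecialLinearGroup.map (Int.castRingHom ℝ) γ))

lemma continuous_eta : Continuous eta := by
  rw [continuous_iff_continuousAt]
  intro τ
  exact (ModularForm.differentiableAt_eta_of_mem_upperHalfPlaneSet τ.2).continuousAt.comp
    UpperHalfPlane.continuous_coe.continuousAt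

lemma continuous_autFactor (k : ℝ) (γ : Matrix.SpecialLinearGroup (Fin 2) ℤ) :
    Continuous (autFactor k γ) := by
  by_cases hc : γ 1 0 = 0
  · have : autFactor k γ = fun _ => ((γ 1 1 : ℤ) : ℂ) ^ (k : ℂ) := by
      funext τ
      simp [autFactor, hc]
    rw [this]
    exact continuous_const
  · have : Continuous fun τ : ℍ => (γ 1 0 : ℂ) * (τ : ℂ) + (γ 1 1 : ℂ) := by
      have := UpperHalfPlane.continuous_coe
      fun_prop
    refine this.cpow continuous_const fun τ => Or.inr ?_
    simp only [Complex.add_im, Complex.mul_im, Complex.intCast_re, Complex.intCast_im, zero_mul,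
      add_zero]
    exact mul_ne_zero (by exact_mod_cast hc) τ.im_pos.ne'

lemma eta_ratio_pow (γ : Matrix.SpecialLinearGroup (Fin 2) ℤ) (τ : ℍ) :
    (eta (γ • τ) / (autFactor (1 / 2) γ τ * eta τ)) ^ 24 = 1 := by
  rw [div_pow, mul_pow, eta_pow_24_transforms, autFactor_half_pow,
    show (((24 : ℕ) : ℝ) / 2) = ((12 : ℕ) : ℝ) by norm_num, autFactor_natCast]
  exact div_self (mul_ne_zero (pow_ne_zero _ (autFactor_base_ne_zero γ τ))
    (pow_ne_zero _ (eta_ne_zero τ)))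

lemma nuEta_pow (γ : Matrix.SpecialLinearGroup (Fin 2) ℤ) : nuEta γ ^ 24 = 1 :=
  eta_ratio_pow γ UpperHalfPlane.I

/-- The quotient `η(γτ) / ((cτ+d)^(1/2) η(τ))` is continuous in `τ` and its values are `24`-th
roots of unity, so it is constant on the connected space `ℍ`. -/
lemma eta_transforms : TransformsLike (1 / 2) nuEta eta := by
  intro γ τ
  have hcont : Continuous fun τ : ℍ => eta (γ • τ) / (autFactor (1 / 2) γ τ * eta τ) :=
    (continuous_eta.comp (continuous_smul_modular γ)).div
      ((continuous_autFactor _ γ).mul continuous_eta)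
      fun τ => mul_ne_zero (autFactor_ne_zero _ γ τ) (eta_ne_zero τ)
  have hfin : {z : ℂ | z ^ 24 = 1}.Finite := by
    refine (Polynomial.nthRoots 24 (1 : ℂ)).toFinset.finite_toSet.subset fun z hz => ?_
    simpa [Polynomial.mem_nthRoots] using hz
  have h := isPreconnected_univ.constant_of_mapsTo hfin.isDiscrete hcont.continuousOn
    (fun τ _ => eta_ratio_pow γ τ) (Set.mem_univ τ) (Set.mem_univ UpperHalfPlane.I)
  change _ = nuEta γ at h
  rw [← h, mul_assoc, div_mul_cancel₀ _ (mul_ne_zero (autFactor_ne_zero _ γ τ) (eta_ne_zero τ))]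

lemma nuEta_ne_zero (γ : Matrix.SpecialLinearGroup (Fin 2) ℤ) : nuEta γ ≠ 0 := fun h => by
  simpa [h] using nuEta_pow γ

lemma conj_nuEta (γ : Matrix.SpecialLinearGroup (Fin 2) ℤ) :
    (starRingEnd ℂ) (nuEta γ ^ (-3 : ℤ)) = nuEta γ ^ 3 := by
  have h : ‖nuEta γ‖ = 1 := Complex.norm_eq_one_of_pow_eq_one (nuEta_pow γ) (by norm_num)
  rw [zpow_neg, map_inv₀, ← Complex.inv_eq_conj (by
    rw [norm_zpow, h, one_zpow]), inv_inv]
  norm_cast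

lemma eta_cube_transforms : TransformsLike (3 / 2) (fun γ => nuEta γ ^ 3) (fun τ => eta τ ^ 3) := by
  intro γ τ
  beta_reduce
  rw [eta_transforms γ τ, mul_pow, mul_pow, autFactor_half_pow]
  norm_num

/-- Dividing by `η³` lowers the weight by `3/2`. -/
lemma TransformsLike.of_mul_eta_cube {k : ℝ} {f : ℍ → ℂ}
    (h : TransformsLike (k + 3 / 2) (fun _ => 1) (fun τ => eta τ ^ 3 * f τ)) :
    TransformsLike k (fun γ => nuEta γ ^ (-3 : ℤ)) f := by
  intro γ τ
  have h1 := h γ τ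
  beta_reduce at h1
  have h2 := eta_cube_transforms γ τ
  beta_reduce at h2
  rw [h2, autFactor_add] at h1
  have e1 := nuEta_ne_zero γ
  have e2 := autFactor_ne_zero (3 / 2) γ τ
  have e3 := eta_ne_zero τ
  have e4 : nuEta γ ^ (-3 : ℤ) = (nuEta γ ^ 3)⁻¹ := by rw [zpow_neg]; norm_cast
  beta_reduce
  rw [e4]
  field_simp
  have h5 : eta τ ^ 3 * autFactor (3 / 2) γ τ ≠ 0 := mul_ne_zero (pow_ne_zero _ e3) e2
  apply mul_left_cancel₀ h5
  linear_combination h1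

/-! ### Jacobi's identity for the cube of the eta function -/

lemma adm_serP_tail : Adm (fun k : ℕ => (-1 : ℂ) ^ (k + 1) * (2 * (k + 1 : ℕ) + 1))
    (fun k => tri (k + 1)) (fun _ => 0) := fun T hT Y => by
  refine Summable.of_nonneg_of_le (fun k => by positivity) (fun k => ?_) (summable_exp_tri hT 2)
  rw [norm_mul, norm_two_mul_add_one, norm_pow, norm_neg, norm_one, one_pow, one_mul,
    Real.exp_add, mul_comm]
  push_cast
  rw [zero_mul, Real.exp_zero, mul_one, Real.exp_add]
  gcongr
  have := Real.add_one_le_exp ((k + 1 : ℝ) * 2)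
  linarith

lemma serP_eq {τ : ℂ} (hτ : 0 < τ.im) : serP τ = 1 +
    qSeries (fun k : ℕ => (-1 : ℂ) ^ (k + 1) * (2 * (k + 1 : ℕ) + 1))
      (fun k => tri (k + 1)) (fun _ => 0) 0 τ := by
  rw [serP, qSeries, (hasSum_serP hτ).summable.tsum_eq_zero_add, qSeries]
  congr 1
  simp [qTerm, tri]

lemma serP_differentiableAt {τ : ℂ} (hτ : 0 < τ.im) : DifferentiableAt ℂ serP τ := by
  have h := (adm_serP_tail.hasDerivAt_tau hτ 0).differentiableAt.const_add 1
  refine h.congr_of_eventuallyEq ?_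
  filter_upwards [(isOpen_lt continuous_const Complex.continuous_im).mem_nhds hτ] with w hw
  exact serP_eq hw

lemma serP_sub_one_bound : ∃ C : ℝ, ∀ τ : ℂ, 1 ≤ τ.im →
    ‖serP τ - 1‖ ≤ C * Real.exp (-(2 * Real.pi * τ.im)) := by
  obtain ⟨C, hC⟩ := adm_serP_tail.norm_qSeries_le fun k => by
    rw [tri_succ]; omega
  refine ⟨C, fun τ hτ => ?_⟩
  rw [serP_eq (by linarith), add_sub_cancel_left]
  exact hC τ hτ

lemma tendsto_exp_neg_im (a : ℝ) (ha : 0 < a) :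
    Filter.Tendsto (fun τ : ℍ => Real.exp (-(a * τ.im))) atImInfty (nhds 0) := by
  refine Real.tendsto_exp_neg_atTop_nhds_zero.comp ?_
  exact (Filter.tendsto_comap (f := UpperHalfPlane.im)).const_mul_atTop ha

lemma tendsto_serP : Filter.Tendsto (fun τ : ℍ => serP τ) atImInfty (nhds 1) := by
  obtain ⟨C, hC⟩ := serP_sub_one_bound
  rw [tendsto_iff_norm_sub_tendsto_zero]
  have h := (tendsto_exp_neg_im (2 * Real.pi) (by positivity)).const_mul C
  rw [mul_zero] at h
  refine squeeze_zero' (Filter.Eventually.of_forall fun τ => norm_nonneg _) ?_ h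
  rw [Filter.eventually_iff, UpperHalfPlane.atImInfty_mem]
  exact ⟨1, fun τ hτ => hC τ hτ⟩

lemma tendsto_eta_prod : Filter.Tendsto (fun τ : ℍ => ∏' n : ℕ, (1 - ModularForm.eta_q n τ))
    atImInfty (nhds 1) := by
  have h := (ModularForm.differentiableOn_tprod_one_sub_pow.differentiableAt
    (Metric.isOpen_ball.mem_nhds (Metric.mem_ball_self one_pos))).continuousAt.tendsto
  have h0 : ∏' n : ℕ, (1 - (0 : ℂ) ^ (n + 1)) = 1 := by simp
  rw [h0] at h
  exact h.comp (qParam_tendsto_atImInfty one_pos)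

/-- The function `q^(1/8) P`, which is `η³` by Jacobi's identity. -/
def serT (τ : ℂ) : ℂ := Complex.exp (2 * Real.pi * Complex.I * τ / 8) * serP τ

lemma neg_inv_im_pos {τ : ℂ} (hτ : 0 < τ.im) : 0 < (-1 / τ).im := by
  have := (ModularGroup.S • (⟨τ, hτ⟩ : ℍ)).im_pos
  rwa [← UpperHalfPlane.coe_im, coe_S_smul] at this

/-- The functional equation of the `z`-derivative of the Jacobi theta function at the zero
`z = 1/2 + τ/2`, which is mapped to a zero by `z ↦ z/τ`. -/
lemma serT_neg_inv {τ : ℂ} (hτ : 0 < τ.im) :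
    serT (-1 / τ) = ((-Complex.I * τ) ^ (1 / 2 : ℂ)) ^ 3 * serT τ := by
  have h0 : τ ≠ 0 := fun h => by simp [h] at hτ
  have hτ' := neg_inv_im_pos hτ
  have hpi : (Real.pi : ℂ) ≠ 0 := by exact_mod_cast Real.pi_ne_zero
  have hI := Complex.I_ne_zero
  have hs : ((-Complex.I * τ) ^ (1 / 2 : ℂ)) ^ 2 = -Complex.I * τ := by
    rw [← Complex.cpow_nat_mul]
    norm_num
  set s := (-Complex.I * τ) ^ (1 / 2 : ℂ) with hsdef
  have hs0 : s ≠ 0 := fun h => by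
    rw [h] at hs
    simp [h0] at hs
  have h := jacobiTheta₂'_functional_equation (1 / 2 + τ / 2) τ
  rw [← hsdef] at h
  have hz : (1 / 2 + τ / 2) / τ = -(0 + 1 / 2 + -1 / τ / 2) + 1 := by
    field_simp
    ring
  have e1 := theta_deriv_zero hτ
  have e2 := theta_deriv_zero hτ'
  have e3 := theta_zero (-1 / τ)
  rw [theta] at e3
  rw [hz, jacobiTheta₂'_add_left, jacobiTheta₂'_neg_left, jacobiTheta₂_add_left,
    jacobiTheta₂_neg_left, e2, e3, mul_zero, sub_zero, ← zero_add (1 / 2 : ℂ), e1] at h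
  have hexp : Complex.exp (-Real.pi * Complex.I * (0 + 1 / 2 + τ / 2) ^ 2 / τ) =
      Complex.exp (2 * Real.pi * Complex.I * (-1 / τ) / 8) * -Complex.I *
        (Complex.exp (2 * Real.pi * Complex.I * τ / 8))⁻¹ := by
    rw [← Complex.exp_neg, ← Complex.exp_neg_pi_div_two_mul_I, ← Complex.exp_add, ← Complex.exp_add]
    congr 1
    field_simp
    ring
  rw [hexp] at h
  rw [serT, serT, pow_succ, hs]
  have he := Complex.exp_ne_zero (2 * Real.pi * Complex.I * τ / 8)
  have h2 : serP τ = 1 / s * (Complex.exp (2 * Real.pi * Complex.I * (-1 / τ) / 8) * -Complex.I *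
      (Complex.exp (2 * Real.pi * Complex.I * τ / 8))⁻¹) / τ * (-serP (-1 / τ)) := by
    apply mul_left_cancel₀ Complex.two_pi_I_ne_zero
    rw [h]
    ring
  rw [h2]
  field_simp
  linear_combination serP (-(1 / τ)) * Complex.I_sq

lemma serT_add_one (τ : ℂ) : serT (τ + 1) = Complex.exp (Real.pi * Complex.I / 4) * serT τ := by
  rw [serT, serT, serP, serP, qSeries_tau_add_one, ← mul_assoc, ← Complex.exp_add]
  ring_nf

/-- The quotient of both sides of Jacobi's identity is a modular form of weight zero. -/
def jacobiQuotient (τ : ℍ) : ℂ := serT τ / eta τ ^ 3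

lemma jacobiQuotient_S :
    SlashAction.map (0 : ℤ) ModularGroup.S jacobiQuotient = jacobiQuotient := by
  ext τ
  have h0 : (-Complex.I * (τ : ℂ)) ^ (1 / 2 : ℂ) ≠ 0 := by
    rw [Complex.cpow_def_of_ne_zero (by simp [τ.ne_zero])]
    exact Complex.exp_ne_zero _
  rw [ModularForm.SL_slash_apply, neg_zero, zpow_zero, mul_one, jacobiQuotient, jacobiQuotient,
    eta_S, coe_S_smul, serT_neg_inv τ.im_pos, mul_pow, mul_div_mul_left _ _ (pow_ne_zero 3 h0)]

lemma jacobiQuotient_T :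
    SlashAction.map (0 : ℤ) ModularGroup.T jacobiQuotient = jacobiQuotient := by
  ext τ
  rw [ModularForm.SL_slash_apply, neg_zero, zpow_zero, mul_one, jacobiQuotient, jacobiQuotient,
    eta_T, coe_T_smul, serT_add_one, mul_pow, ← Complex.exp_nat_mul,
    show ((3 : ℕ) : ℂ) * (Real.pi * Complex.I / 12) = Real.pi * Complex.I / 4 by push_cast; ring,
    mul_div_mul_left _ _ (Complex.exp_ne_zero _)]

lemma tendsto_jacobiQuotient : Filter.Tendsto jacobiQuotient atImInfty (nhds 1) := by
  have h := tendsto_serP.div (tendsto_eta_prod.pow 3) (by norm_num)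
  rw [one_pow, div_one] at h
  refine h.congr fun τ => ?_
  have he := Complex.exp_ne_zero (2 * Real.pi * Complex.I * τ / 24)
  have hp := ModularForm.eta_tprod_ne_zero τ.2
  rw [jacobiQuotient, serT, eta, ModularForm.eta, mul_pow, Function.Periodic.qParam,
    ← Complex.exp_nat_mul]
  push_cast
  rw [show 3 * (2 * Real.pi * Complex.I * (τ : ℂ) / 24) = 2 * Real.pi * Complex.I * τ / 8 by ring,
    mul_div_mul_left _ _ (Complex.exp_ne_zero _)]
  rfl

lemma serT_differentiableAt {τ : ℂ} (hτ : 0 < τ.im) : DifferentiableAt ℂ serT τ := by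
  refine DifferentiableAt.mul ?_ (serP_differentiableAt hτ)
  fun_prop

/-- The weight zero modular form underlying Jacobi's identity. -/
def jacobiForm : ModularForm (Matrix.SpecialLinearGroup.mapGL ℝ :
    Matrix.SpecialLinearGroup (Fin 2) ℤ →* _).range 0 where
  toFun := jacobiQuotient
  slash_action_eq' A hA := by
    obtain ⟨A, rfl⟩ := hA
    exact SlashInvariantForm.slash_action_generators_SL2Z jacobiQuotient_S jacobiQuotient_T A
  holo' := by
    rw [UpperHalfPlane.mdifferentiable_iff]
    refine DifferentiableOn.congr (f := fun z => serT z / ModularForm.eta z ^ 3)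
      (fun z hz => ((serT_differentiableAt hz).div
        ((ModularForm.differentiableAt_eta_of_mem_upperHalfPlaneSet hz).pow 3)
        (pow_ne_zero 3 (ModularForm.eta_ne_zero hz))).differentiableWithinAt) fun z hz => ?_
    simp [jacobiQuotient, eta, ofComplex_apply_of_im_pos hz]
  bdd_at_cusps' hc := by
    rw [Subgroup.IsArithmetic.isCusp_iff_isCusp_SL2Z] at hc
    rw [OnePoint.isBoundedAt_iff_forall_SL2Z hc]
    intro γ _
    rw [SlashInvariantForm.slash_action_generators_SL2Z jacobiQuotient_S jacobiQuotient_T]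
    exact tendsto_jacobiQuotient.isBigO_one ℝ

/-- Jacobi's identity `η³ = q^(1/8) ∑ (-1)^n (2n+1) q^(n(n+1)/2)`. -/
theorem eta_cube (τ : ℍ) : eta τ ^ 3 = serT τ := by
  obtain ⟨c, hc⟩ := ModularFormClass.levelOne_weight_zero_const jacobiForm
  have hc' : jacobiQuotient = fun _ => c := hc
  have h1 : c = 1 := tendsto_nhds_unique
    (by rw [hc']; exact tendsto_const_nhds) tendsto_jacobiQuotient
  have h2 := congrFun hc' τ
  rw [jacobiQuotient, h1, div_eq_one_iff_eq (pow_ne_zero 3 (eta_ne_zero τ))] at h2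
  exact h2.symm

/-! ### The error function -/

lemma errE_hasDerivAt (x : ℝ) : HasDerivAt errE (2 * Real.exp (-Real.pi * x ^ 2)) x := by
  have hc : Continuous fun t : ℝ => Real.exp (-Real.pi * t ^ 2) := by fun_prop
  exact (intervalIntegral.integral_hasDerivAt_right (hc.intervalIntegrable _ _)
    (hc.stronglyMeasurableAtFilter _ _) hc.continuousAt).const_mul 2

lemma errE_neg (x : ℝ) : errE (-x) = -errE x := by
  have h := intervalIntegral.integral_comp_neg (a := 0) (b := x)
    (fun t : ℝ => Real.exp (-Real.pi * t ^ 2))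
  simp only [neg_sq, neg_zero] at h
  rw [errE, errE, h, intervalIntegral.integral_symm]
  ring

lemma one_sub_errE_eq {x : ℝ} (hx : 0 ≤ x) :
    1 - errE x = 2 * ∫ t in Set.Ioi x, Real.exp (-Real.pi * t ^ 2) := by
  have h := intervalIntegral.integral_Ioi_sub_Ioi
    (integrable_exp_neg_mul_sq Real.pi_pos).integrableOn hx
  rw [integral_gaussian_Ioi, div_self Real.pi_ne_zero, Real.sqrt_one] at h
  rw [errE, ← h]
  ring

lemma one_sub_errE_nonneg {x : ℝ} (hx : 0 ≤ x) : 0 ≤ 1 - errE x := by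
  rw [one_sub_errE_eq hx]
  exact mul_nonneg zero_le_two (MeasureTheory.setIntegral_nonneg measurableSet_Ioi
    fun t _ => (Real.exp_pos _).le)

lemma one_sub_errE_le {x : ℝ} (hx : 0 ≤ x) : 1 - errE x ≤ Real.exp (-Real.pi * x ^ 2) := by
  have hi := integrable_exp_neg_mul_sq Real.pi_pos
  have h :=
    (MeasureTheory.measurePreserving_add_right MeasureTheory.volume x).setIntegral_preimage_emb
    (measurableEmbedding_addRight x) (fun t : ℝ => Real.exp (-Real.pi * t ^ 2)) (Set.Ioi x)
  have hp : (fun t : ℝ => t + x) ⁻¹' Set.Ioi x = Set.Ioi 0 := by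
    ext t; simp
  rw [hp] at h
  -- `(t + x)² ≥ t² + x²` for nonnegative `t` and `x`.
  have h2 : ∫ t in Set.Ioi (0 : ℝ), Real.exp (-Real.pi * (t + x) ^ 2) ≤
      ∫ t in Set.Ioi (0 : ℝ), Real.exp (-Real.pi * x ^ 2) * Real.exp (-Real.pi * t ^ 2) := by
    refine MeasureTheory.setIntegral_mono_on (hi.comp_add_right x).integrableOn
      (hi.const_mul _).integrableOn measurableSet_Ioi fun t ht => ?_
    rw [← Real.exp_add]
    refine Real.exp_le_exp.2 ?_
    have : 0 ≤ Real.pi * (t * x) := mul_nonneg Real.pi_pos.le (mul_nonneg (le_of_lt ht) hx)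
    nlinarith
  rw [MeasureTheory.integral_const_mul, integral_gaussian_Ioi, div_self Real.pi_ne_zero,
    Real.sqrt_one, h] at h2
  rw [one_sub_errE_eq hx]
  linarith

lemma abs_errE_le (x : ℝ) : |errE x| ≤ 1 := by
  have key : ∀ y : ℝ, 0 ≤ y → |errE y| ≤ 1 := fun y hy => by
    have h1 := one_sub_errE_nonneg hy
    have h2 := one_sub_errE_le hy
    have h3 : Real.exp (-Real.pi * y ^ 2) ≤ 1 := Real.exp_le_one_iff.2 (by
      have := Real.pi_pos; nlinarith [sq_nonneg y])
    rw [abs_le]; constructor <;> linarith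
  rcases le_total 0 x with h | h
  · exact key x h
  · simpa [errE_neg] using key (-x) (by linarith)

lemma one_sub_errE_shift_le {n a v : ℝ} (hn : 0 < n) (hv : 0 < v) :
    |1 - errE ((n + a) * Real.sqrt (2 * v))| ≤
      2 * Real.exp (2 * Real.pi * v * a ^ 2) *
        Real.exp (-Real.pi * ((n + a) * Real.sqrt (2 * v)) ^ 2) := by
  have hpi := Real.pi_pos
  -- If `n + a` has the wrong sign, then `(n + a)² ≤ a²`, and the trivial bound `2` suffices.
  rcases le_total 0 (n + a) with h | h
  · have hx : 0 ≤ (n + a) * Real.sqrt (2 * v) := by positivity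
    rw [abs_of_nonneg (one_sub_errE_nonneg hx)]
    refine (one_sub_errE_le hx).trans ?_
    have h1 : 1 ≤ Real.exp (2 * Real.pi * v * a ^ 2) := Real.one_le_exp (by positivity)
    have := Real.exp_pos (-Real.pi * ((n + a) * Real.sqrt (2 * v)) ^ 2)
    nlinarith
  · have h1 := abs_errE_le ((n + a) * Real.sqrt (2 * v))
    have h2 : |1 - errE ((n + a) * Real.sqrt (2 * v))| ≤ 2 := by
      rw [abs_le] at h1 ⊢
      constructor <;> linarith
    refine h2.trans ?_
    rw [mul_assoc, ← Real.exp_add, mul_pow, Real.sq_sqrt (by positivity)]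
    have h3 : (n + a) ^ 2 ≤ a ^ 2 := by nlinarith
    have : 1 ≤ Real.exp (2 * Real.pi * v * a ^ 2 + -Real.pi * ((n + a) ^ 2 * (2 * v))) := by
      refine Real.one_le_exp ?_
      have : 0 ≤ Real.pi * v * (a ^ 2 - (n + a) ^ 2) :=
        mul_nonneg (by positivity) (by linarith)
      nlinarith
    linarith

/-- The coefficients `sgn n - E((n + a) √(2v))` have Gaussian decay in `n`. -/
lemma abs_sign_sub_errE_le {n : ℝ} (a : ℝ) {v : ℝ} (hn : n ≠ 0) (hv : 0 < v) :
    |Real.sign n - errE ((n + a) * Real.sqrt (2 * v))| ≤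
      2 * Real.exp (2 * Real.pi * v * a ^ 2) *
        Real.exp (-Real.pi * ((n + a) * Real.sqrt (2 * v)) ^ 2) := by
  rcases lt_or_gt_of_ne hn with h | h
  · have := one_sub_errE_shift_le (a := -a) (neg_pos.2 h) hv
    rw [show (-n + -a) * Real.sqrt (2 * v) = -((n + a) * Real.sqrt (2 * v)) by ring, errE_neg,
      neg_sq, neg_sq] at this
    rw [Real.sign_of_neg h, ← abs_neg]
    convert! this using 2
    ring
  · rw [Real.sign_of_pos h]
    exact one_sub_errE_shift_le h hv

/-! ### Differentiation of series with error function coefficients -/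

/-- The Wirtinger derivative `∂/∂w̄` read off from a real derivative. -/
def dbarL (D : ℂ →L[ℝ] ℂ) : ℂ := (D 1 + Complex.I * D Complex.I) / 2

lemma summable_exp_quadratic {c : ℝ} (hc : 0 < c) (C : ℝ) :
    Summable fun k : ℤ => Real.exp (-c * k ^ 2 + C * |(k : ℝ)| + C) := by
  have h := (summable_pow_mul_jacobiTheta₂_term_bound (C / (2 * Real.pi))
    (T := c / Real.pi) (by positivity) 0).mul_right (Real.exp C)
  refine h.congr fun k => ?_
  rw [pow_zero, one_mul, ← Real.exp_add]
  congr 1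
  push_cast
  field_simp
  ring

lemma sq_mul_exp_quadratic_le (c C : ℝ) (k : ℤ) :
    (1 + |(k : ℝ)|) ^ 2 * Real.exp (-c * k ^ 2 + C * |(k : ℝ)| + C) ≤
      Real.exp (-c * k ^ 2 + (C + 2) * |(k : ℝ)| + (C + 2)) := by
  have h1 : (1 + |(k : ℝ)|) ^ 2 ≤ Real.exp (2 * |(k : ℝ)|) := by
    rw [two_mul, Real.exp_add, ← sq]
    have := Real.add_one_le_exp |(k : ℝ)|
    gcongr
    linarith
  calc _ ≤ Real.exp (2 * |(k : ℝ)|) * Real.exp (-c * k ^ 2 + C * |(k : ℝ)| + C) := by gcongr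
    _ = Real.exp (2 * |(k : ℝ)| + (-c * k ^ 2 + C * |(k : ℝ)| + C)) := (Real.exp_add _ _).symm
    _ ≤ _ := Real.exp_le_exp.2 (by linarith)

/-- Termwise differentiation of `∑ (s_k - E(X_k(w))) exp(A_k(w))`, for holomorphic `A_k` and real
`X_k`: only the error functions contribute to the Wirtinger derivative of the sum. -/
theorem hasFDerivAt_tsum_errE {U : Set ℂ} (hU : IsOpen U) (hUc : IsPreconnected U)
    {s : ℤ → ℝ} {X : ℤ → ℂ → ℝ} {A : ℤ → ℂ → ℂ} {X' : ℤ → ℂ → (ℂ →L[ℝ] ℝ)} {A' : ℤ → ℂ → ℂ}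
    {M₀ M₁ M₂ c C : ℝ} (hc : 0 < c)
    (hX : ∀ k, ∀ w ∈ U, HasFDerivAt (X k) (X' k w) w)
    (hA : ∀ k, ∀ w ∈ U, HasDerivAt (A k) (A' k w) w)
    (hs : ∀ k, ∀ w ∈ U, |s k - errE (X k w)| ≤ M₀ * Real.exp (-Real.pi * X k w ^ 2))
    (hX' : ∀ k, ∀ w ∈ U, ‖X' k w‖ ≤ M₁ * (1 + |(k : ℝ)|) ^ 2)
    (hA' : ∀ k, ∀ w ∈ U, ‖A' k w‖ ≤ M₂ * (1 + |(k : ℝ)|) ^ 2)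
    (hE : ∀ k : ℤ, ∀ w ∈ U, -Real.pi * X k w ^ 2 + (A k w).re ≤ -c * k ^ 2 + C * |(k : ℝ)| + C)
    {w : ℂ} (hw : w ∈ U) :
    (Summable fun k => ((s k - errE (X k w) : ℝ) : ℂ) * Complex.exp (A k w)) ∧
    ∃ D : ℂ →L[ℝ] ℂ,
      HasFDerivAt (fun w => ∑' k, ((s k - errE (X k w) : ℝ) : ℂ) * Complex.exp (A k w)) D w ∧
      dbarL D = ∑' k, -(((X' k w 1 : ℝ) : ℂ) + Complex.I * (X' k w Complex.I : ℝ)) *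
        Complex.exp (-Real.pi * X k w ^ 2 + A k w) := by
  have hM₀ : 0 ≤ M₀ := by
    have h := (abs_nonneg _).trans (hs 0 w hw)
    exact nonneg_of_mul_nonneg_left h (Real.exp_pos _)
  have hnorm : ∀ k, ∀ w ∈ U, Real.exp (-Real.pi * X k w ^ 2) * Real.exp ((A k w).re) ≤
      Real.exp (-c * k ^ 2 + C * |(k : ℝ)| + C) := fun k w hw => by
    rw [← Real.exp_add]
    exact Real.exp_le_exp.2 (hE k w hw)
  have hterm : ∀ k, ∀ w ∈ U, ‖((s k - errE (X k w) : ℝ) : ℂ) * Complex.exp (A k w)‖ ≤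
      M₀ * Real.exp (-c * k ^ 2 + C * |(k : ℝ)| + C) := fun k w hw => by
    rw [norm_mul, Complex.norm_real, Real.norm_eq_abs, Complex.norm_exp]
    calc _ ≤ M₀ * Real.exp (-Real.pi * X k w ^ 2) * Real.exp ((A k w).re) := by
          gcongr; exact hs k w hw
      _ ≤ _ := by
          rw [mul_assoc]; gcongr; exact hnorm k w hw
  have hsum : ∀ w ∈ U, Summable fun k => ((s k - errE (X k w) : ℝ) : ℂ) * Complex.exp (A k w) :=
    fun w hw => Summable.of_norm_bounded ((summable_exp_quadratic hc C).mul_left M₀)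
      fun k => hterm k w hw
  refine ⟨hsum w hw, ?_⟩
  let D : ℤ → ℂ → (ℂ →L[ℝ] ℂ) := fun k w =>
    ((s k - errE (X k w) : ℝ) : ℂ) • (Complex.exp (A k w) • ((A' k w) • (1 : ℂ →L[ℝ] ℂ))) +
      Complex.exp (A k w) • Complex.ofRealCLM.comp
        (-((2 * Real.exp (-Real.pi * X k w ^ 2)) • X' k w))
  have hD : ∀ k, ∀ w ∈ U, HasFDerivAt
      (fun w => ((s k - errE (X k w) : ℝ) : ℂ) * Complex.exp (A k w)) (D k w) w := fun k w hw => by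
    have h1 : HasFDerivAt (fun w => ((s k - errE (X k w) : ℝ) : ℂ)) (Complex.ofRealCLM.comp
        (-((2 * Real.exp (-Real.pi * X k w ^ 2)) • X' k w))) w :=
      Complex.ofRealCLM.hasFDerivAt.comp w
        (((errE_hasDerivAt (X k w)).comp_hasFDerivAt w (hX k w hw)).const_sub (s k))
    have h2 : HasFDerivAt (fun w => Complex.exp (A k w))
        (Complex.exp (A k w) • ((A' k w) • (1 : ℂ →L[ℝ] ℂ))) w := by
      have := ((hA k w hw).cexp.complexToReal_fderiv)
      rwa [mul_smul] at this
    exact h1.mul h2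
  have hDn : ∀ k, ∀ w ∈ U, ‖D k w‖ ≤ (M₀ * M₂ + 2 * M₁) *
      Real.exp (-c * k ^ 2 + (C + 2) * |(k : ℝ)| + (C + 2)) := fun k w hw => by
    have hM₁ : 0 ≤ M₁ * (1 + |(k : ℝ)|) ^ 2 := (norm_nonneg _).trans (hX' k w hw)
    have hM₁' : 0 ≤ M₁ := nonneg_of_mul_nonneg_left hM₁ (by positivity)
    have hM₂ : 0 ≤ M₂ * (1 + |(k : ℝ)|) ^ 2 := (norm_nonneg _).trans (hA' k w hw)
    have hM₂' : 0 ≤ M₂ := nonneg_of_mul_nonneg_left hM₂ (by positivity)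
    have hone : ‖(1 : ℂ →L[ℝ] ℂ)‖ ≤ 1 := ContinuousLinearMap.norm_id_le
    have h1 : ‖((s k - errE (X k w) : ℝ) : ℂ) • (Complex.exp (A k w) •
        ((A' k w) • (1 : ℂ →L[ℝ] ℂ)))‖ ≤
        M₀ * Real.exp (-Real.pi * X k w ^ 2) * (Real.exp ((A k w).re) *
          (M₂ * (1 + |(k : ℝ)|) ^ 2 * 1)) := by
      rw [norm_smul, norm_smul, norm_smul, Complex.norm_real, Real.norm_eq_abs, Complex.norm_exp]
      gcongr
      · exact hs k w hw
      · exact hA' k w hw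
    have h2 : ‖Complex.exp (A k w) • Complex.ofRealCLM.comp
        (-((2 * Real.exp (-Real.pi * X k w ^ 2)) • X' k w))‖ ≤ Real.exp ((A k w).re) *
          (1 * (2 * Real.exp (-Real.pi * X k w ^ 2) * (M₁ * (1 + |(k : ℝ)|) ^ 2))) := by
      rw [norm_smul, Complex.norm_exp]
      gcongr
      refine (ContinuousLinearMap.opNorm_comp_le _ _).trans ?_
      rw [Complex.ofRealCLM_norm, norm_neg, norm_smul, Real.norm_of_nonneg (by positivity)]
      gcongr
      exact hX' k w hw
    calc ‖D k w‖ ≤ _ := (norm_add_le _ _).trans (add_le_add h1 h2)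
      _ = (M₀ * M₂ + 2 * M₁) * ((1 + |(k : ℝ)|) ^ 2 *
          (Real.exp (-Real.pi * X k w ^ 2) * Real.exp ((A k w).re))) := by ring
      _ ≤ (M₀ * M₂ + 2 * M₁) * ((1 + |(k : ℝ)|) ^ 2 *
          Real.exp (-c * k ^ 2 + C * |(k : ℝ)| + C)) := by
        gcongr; exact hnorm k w hw
      _ ≤ _ := by gcongr; exact sq_mul_exp_quadratic_le c C k
  have hg := (summable_exp_quadratic hc (C + 2)).mul_left (M₀ * M₂ + 2 * M₁)
  refine ⟨∑' k, D k w, hasFDerivAt_tsum_of_isPreconnected hg hU hUc hD hDn hw (hsum w hw) hw, ?_⟩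
  have hDs : HasSum (fun k => D k w) (∑' k, D k w) :=
    (Summable.of_norm_bounded hg fun k => hDn k w hw).hasSum
  -- The holomorphic part of each summand drops out of the Wirtinger derivative.
  have e1 := hDs.mapL (ContinuousLinearMap.apply ℝ ℂ (1 : ℂ))
  have e2 := hDs.mapL (ContinuousLinearMap.apply ℝ ℂ Complex.I)
  have e3 := ((e1.add (e2.mul_left Complex.I)).div_const 2).tsum_eq
  refine e3.symm.trans (tsum_congr fun k => ?_)
  simp only [ContinuousLinearMap.apply_apply, D, add_apply,
    smul_apply, ContinuousLinearMap.comp_apply, neg_apply,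
    Complex.ofRealCLM_apply, smul_eq_mul, one_apply_eq_self]
  rw [Complex.exp_add]
  push_cast
  linear_combination ((s k : ℂ) - errE (X k w)) * (Complex.exp (A k w) * A' k w) / 2 * Complex.I_sq

/-! ### The elliptic completion term -/

/-- The exponent of the `k`-th term of `theta`. -/
def thetaExponent (u τ : ℂ) (k : ℤ) : ℂ :=
  2 * Real.pi * Complex.I * k * (u + 1 / 2 + τ / 2) + Real.pi * Complex.I * k ^ 2 * τ

/-- The summands of `rho`. -/
def rhoTerm (u τ : ℂ) (k : ℤ) : ℂ :=
  ((Real.sign ((k : ℝ) + 1 / 2)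
      - errE (((k : ℝ) + 1 / 2 + u.im / τ.im) * Real.sqrt (2 * τ.im)) : ℝ) : ℂ)
    * Complex.exp (-thetaExponent u τ k)

/-- The function `q^(1/8) x^(1/2) R(u;τ)` with `x = exp(2πiu)`. -/
def rho (u τ : ℂ) : ℂ := ∑' k : ℤ, rhoTerm u τ k

lemma int_add_half_ne_zero (k : ℤ) : (k : ℝ) + 1 / 2 ≠ 0 := fun h => by
  have : (2 * k + 1 : ℤ) = 0 := by
    have h2 : (2 * k + 1 : ℝ) = 0 := by linarith
    exact_mod_cast h2
  omega

lemma theta_eq_tsum (u τ : ℂ) : theta u τ = ∑' k, Complex.exp (thetaExponent u τ k) := rfl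

lemma abs_add_half_le (k : ℤ) : |(k : ℝ) + 1 / 2| ≤ 1 + |(k : ℝ)| := by
  have := abs_add_le (k : ℝ) (1 / 2)
  norm_num at this ⊢
  linarith

/-- The series `rho` converges absolutely, and its Wirtinger derivative is a multiple of the
conjugate of `theta`. -/
theorem rho_hasFDerivAt {τ : ℂ} (hτ : 0 < τ.im) (u : ℂ) : Summable (rhoTerm u τ) ∧
    ∃ D : ℂ →L[ℝ] ℂ, HasFDerivAt (fun w => rho w τ) D u ∧
      dbarL D = -Complex.I * (Real.sqrt (2 * τ.im) / τ.im : ℝ) * ((starRingEnd ℂ) (theta u τ) *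
        (Real.exp (-(2 * Real.pi / τ.im) * (u.im + τ.im / 2) ^ 2) : ℝ)) := by
  set v := τ.im with hv
  set r := ‖u‖ + 1 with hr
  have hpi := Real.pi_pos
  have hr0 : 0 < r := by positivity
  have him : ∀ w ∈ Metric.ball (0 : ℂ) r, |w.im| ≤ r := fun w hw => by
    rw [mem_ball_zero_iff] at hw
    exact (Complex.abs_im_le_norm w).trans hw.le
  have key := hasFDerivAt_tsum_errE (U := Metric.ball (0 : ℂ) r) Metric.isOpen_ball
    (convex_ball _ _).isPreconnected
    (s := fun k => Real.sign ((k : ℝ) + 1 / 2))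
    (X := fun k w => ((k : ℝ) + 1 / 2 + w.im / v) * Real.sqrt (2 * v))
    (A := fun k w => -thetaExponent w τ k)
    (X' := fun _ _ => (Real.sqrt (2 * v) / v) • Complex.imCLM)
    (A' := fun k _ => -(2 * Real.pi * Complex.I * k))
    (M₀ := 2 * Real.exp (2 * Real.pi * v * (r / v) ^ 2)) (M₁ := Real.sqrt (2 * v) / v)
    (M₂ := 2 * Real.pi) (c := Real.pi * v) (C := Real.pi * v + 2 * Real.pi * r)
    (by positivity)
    (fun k w _ => by
      have h := (((Complex.imCLM.hasFDerivAt (x := w)).mul_const v⁻¹).const_add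
        ((k : ℝ) + 1 / 2)).mul_const (Real.sqrt (2 * v))
      refine h.congr_fderiv ?_
      rw [smul_smul, div_eq_mul_inv])
    (fun k w _ => by
      have h := ((((hasDerivAt_id w).add_const (1 / 2 : ℂ)).add_const (τ / 2)).const_mul
        (2 * Real.pi * Complex.I * k)).add_const (Real.pi * Complex.I * k ^ 2 * τ)
      exact h.neg.congr_deriv (by simp))
    (fun k w hw => by
      refine (abs_sign_sub_errE_le (w.im / v) (int_add_half_ne_zero k) hτ).trans ?_
      have h1 : (w.im / v) ^ 2 ≤ (r / v) ^ 2 := by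
        rw [sq_le_sq, abs_div, abs_div, abs_of_pos hr0]
        gcongr
        exact him w hw
      gcongr)
    (fun k w _ => by
      rw [norm_smul, Complex.imCLM_norm, Real.norm_of_nonneg (by positivity)]
      have : 1 ≤ (1 + |(k : ℝ)|) ^ 2 := by nlinarith [abs_nonneg (k : ℝ)]
      gcongr)
    (fun k w _ => by
      rw [norm_neg, norm_mul, norm_two_pi_I, Complex.norm_intCast]
      have : |(k : ℝ)| ≤ (1 + |(k : ℝ)|) ^ 2 := by nlinarith [abs_nonneg (k : ℝ)]
      gcongr)
    (fun k w hw => by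
      have h1 : (-thetaExponent w τ k).re =
          Real.pi * v * (k ^ 2 + k) + 2 * Real.pi * k * w.im := by
        simp [thetaExponent, sq, ← hv]
        ring
      rw [h1, mul_pow, Real.sq_sqrt (by positivity)]
      have h2 : -Real.pi * (((k : ℝ) + 1 / 2 + w.im / v) ^ 2 * (2 * v)) +
          (Real.pi * v * (k ^ 2 + k) + 2 * Real.pi * k * w.im) =
          -(Real.pi * v) * k ^ 2 + Real.pi * v * (-k) + 2 * Real.pi * (-(k * w.im)) -
            2 * Real.pi * v * (1 / 2 + w.im / v) ^ 2 := by
        field_simp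
        ring
      rw [h2]
      have h3 : Real.pi * v * (-k) ≤ Real.pi * v * |(k : ℝ)| := by
        gcongr; exact neg_le_abs _
      have h4 : -(k * w.im) ≤ |(k : ℝ)| * r := by
        refine (neg_le_abs _).trans ?_
        rw [abs_mul]
        gcongr
        exact him w hw
      have h5 : 2 * Real.pi * (-(k * w.im)) ≤ 2 * Real.pi * (|(k : ℝ)| * r) := by gcongr
      have h6 : 0 ≤ 2 * Real.pi * v * (1 / 2 + w.im / v) ^ 2 := by positivity
      have h7 : 0 ≤ Real.pi * v + 2 * Real.pi * r := by positivity
      nlinarith)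
    (w := u) (by rw [mem_ball_zero_iff]; linarith)
  obtain ⟨h1, D, h2, h3⟩ := key
  -- The Gaussian factor turns `exp (-thetaExponent)` into the conjugate of `exp thetaExponent`.
  refine ⟨h1, D, h2, ?_⟩
  rw [h3, theta_eq_tsum, Complex.conj_tsum, ← tsum_mul_right, ← tsum_mul_left]
  refine tsum_congr fun k => ?_
  rw [← Complex.exp_conj, Complex.ofReal_exp, ← Complex.exp_add]
  have he : -(Real.pi : ℂ) * ((((k : ℝ) + 1 / 2 + u.im / v) * Real.sqrt (2 * v) : ℝ) : ℂ) ^ 2 +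
      -thetaExponent u τ k = (starRingEnd ℂ) (thetaExponent u τ k) +
        ((-(2 * Real.pi / v) * (u.im + v / 2) ^ 2 : ℝ) : ℂ) := by
    rw [← Complex.ofReal_pow, mul_pow, Real.sq_sqrt (by positivity)]
    apply Complex.ext
    · rw [Complex.add_re, Complex.add_re, Complex.conj_re]
      simp [thetaExponent, sq, ← hv]
      field_simp
      ring
    · rw [Complex.add_im, Complex.add_im, Complex.conj_im]
      simp [thetaExponent, sq, ← hv]
  rw [he]
  simp

lemma rho_add_one (u τ : ℂ) : rho (u + 1) τ = rho u τ := by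
  refine tsum_congr fun k => ?_
  have : Complex.exp (-thetaExponent (u + 1) τ k) = Complex.exp (-thetaExponent u τ k) := by
    rw [Complex.exp_eq_exp_iff_exists_int]
    exact ⟨-k, by rw [thetaExponent, thetaExponent]; push_cast; ring⟩
  rw [rhoTerm, rhoTerm, this]
  simp

/-- The jump of the sign function is the source of the inhomogeneous term in `rho_add_tau`. -/
lemma sign_int_sub_half (k : ℤ) : Real.sign ((k : ℝ) - 1 / 2) =
    Real.sign ((k : ℝ) + 1 / 2) - if k = 0 then 2 else 0 := by
  rcases lt_trichotomy k 0 with h | h | h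
  · have h' : (k : ℝ) ≤ -1 := by exact_mod_cast Int.le_sub_one_of_lt h
    rw [Real.sign_of_neg (by linarith), Real.sign_of_neg (by linarith), if_neg h.ne, sub_zero]
  · subst h
    rw [Real.sign_of_neg (by norm_num), Real.sign_of_pos (by norm_num), if_pos rfl]
    norm_num
  · have h' : (1 : ℝ) ≤ k := by exact_mod_cast h
    rw [Real.sign_of_pos (by linarith), Real.sign_of_pos (by linarith), if_neg h.ne', sub_zero]

lemma rho_add_tau {τ : ℂ} (hτ : 0 < τ.im) (u : ℂ) :
    rho (u + τ) τ = -(ex u * ex τ) * (rho u τ - 2) := by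
  have h0 : HasSum (fun k : ℤ => if k = 0 then (2 : ℂ) else 0) 2 := hasSum_ite_eq 0 2
  have h1 := (((rho_hasFDerivAt hτ u).1.hasSum.sub h0).mul_left (-(ex u * ex τ))).tsum_eq
  rw [rho, ← (Equiv.subRight (1 : ℤ)).tsum_eq, rho, ← h1]
  refine tsum_congr fun k => ?_
  have hx : (((k - 1 : ℤ) : ℝ) + 1 / 2 + (u + τ).im / τ.im) = (k : ℝ) + 1 / 2 + u.im / τ.im := by
    rw [Complex.add_im]
    push_cast
    field_simp
    ring
  have he : Complex.exp (-thetaExponent (u + τ) τ (k - 1)) =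
      -(ex u * ex τ) * Complex.exp (-thetaExponent u τ k) := by
    have : -(ex u * ex τ) = Complex.exp (Real.pi * Complex.I + 2 * Real.pi * Complex.I * u +
        2 * Real.pi * Complex.I * τ) := by
      rw [Complex.exp_add, Complex.exp_add, Complex.exp_pi_mul_I, ex, ex]
      ring
    rw [this, ← Complex.exp_add]
    congr 1
    rw [thetaExponent, thetaExponent]
    push_cast
    ring
  have hk : Complex.exp (-thetaExponent u τ k) * (if k = 0 then (2 : ℂ) else 0) =
      if k = 0 then (2 : ℂ) else 0 := by
    split_ifs with h
    · simp [h, thetaExponent]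
    · simp
  rw [Equiv.subRight_apply, rhoTerm, rhoTerm, hx, he, show ((k - 1 : ℤ) : ℝ) + 1 / 2 =
    (k : ℝ) - 1 / 2 by push_cast; ring, sign_int_sub_half]
  push_cast
  rw [← hk]
  split_ifs <;> push_cast <;> ring

/-! ### The function `R(0;τ)` -/

/-- `R(0;τ)` as a function of a complex variable. -/
def rZero (τ : ℂ) : ℂ := ∑' k : ℤ, ((Real.sign ((k : ℝ) + 1 / 2)
      - errE (((k : ℝ) + 1 / 2) * Real.sqrt (2 * τ.im)) : ℝ) : ℂ) *
    Complex.exp (-(Real.pi * Complex.I * k + Real.pi * Complex.I * (k + 1 / 2) ^ 2 * τ))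

lemma RTerm_zero (τ : ℍ) (k : ℤ) : RTerm 0 τ k = ((Real.sign ((k : ℝ) + 1 / 2)
      - errE (((k : ℝ) + 1 / 2) * Real.sqrt (2 * τ.im)) : ℝ) : ℂ) *
    Complex.exp (-(Real.pi * Complex.I * k + Real.pi * Complex.I * (k + 1 / 2) ^ 2 * τ)) := by
  have h : Complex.exp (-(Real.pi * Complex.I * k)) = (-1) ^ k := by
    rw [show -(Real.pi * Complex.I * k : ℂ) = ((-k : ℤ) : ℂ) * (Real.pi * Complex.I) by
      push_cast; ring, exp_neg_one_pow, zpow_neg, ← inv_zpow, inv_neg_one]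
  rw [RTerm, neg_add, Complex.exp_add, h, qPow]
  simp only [Complex.zero_im, zero_div, add_zero, mul_zero, Complex.exp_zero, mul_one]
  rw [mul_assoc]
  congr 3
  ring

lemma R_zero (τ : ℍ) : R 0 τ = rZero τ := tsum_congr (RTerm_zero τ)

lemma hasSum_serT {τ : ℂ} (hτ : 0 < τ.im) :
    HasSum (fun k : ℤ => ((k : ℂ) + 1 / 2) *
      Complex.exp (Real.pi * Complex.I * k + Real.pi * Complex.I * (k + 1 / 2) ^ 2 * τ))
      (serT τ) := by
  have h1 := (hasSum_jacobiTheta₂'_term (0 + 1 / 2 + τ / 2) hτ).div_const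
    (2 * Real.pi * Complex.I)
  have h2 := (hasSum_jacobiTheta₂_term (0 + 1 / 2 + τ / 2) hτ).div_const 2
  have h3 := (h1.add h2).mul_left (Complex.exp (2 * Real.pi * Complex.I * τ / 8))
  rw [theta_deriv_zero hτ, show jacobiTheta₂ (0 + 1 / 2 + τ / 2) τ = 0 from theta_zero τ,
    mul_div_cancel_left₀ _ Complex.two_pi_I_ne_zero, zero_div, add_zero] at h3
  convert! h3 using 1
  funext k
  have h4 : jacobiTheta₂_term k (0 + 1 / 2 + τ / 2) τ = Complex.exp (Real.pi * Complex.I * k +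
      Real.pi * Complex.I * (k + 1 / 2) ^ 2 * τ) *
        (Complex.exp (2 * Real.pi * Complex.I * τ / 8))⁻¹ := by
    rw [jacobiTheta₂_term, ← Complex.exp_neg, ← Complex.exp_add]
    ring_nf
  have hpi := Complex.two_pi_I_ne_zero
  have he := Complex.exp_ne_zero (2 * Real.pi * Complex.I * τ / 8)
  rw [jacobiTheta₂'_term, h4]
  field_simp

/-- The Wirtinger derivative of `R(0;τ)` is a multiple of the conjugate of `η³`. -/
theorem rZero_hasFDerivAt {τ : ℂ} (hτ : 0 < τ.im) :
    (Summable fun k : ℤ => ((Real.sign ((k : ℝ) + 1 / 2)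
      - errE (((k : ℝ) + 1 / 2) * Real.sqrt (2 * τ.im)) : ℝ) : ℂ) *
    Complex.exp (-(Real.pi * Complex.I * k + Real.pi * Complex.I * (k + 1 / 2) ^ 2 * τ))) ∧
    ∃ D : ℂ →L[ℝ] ℂ, HasFDerivAt rZero D τ ∧
      dbarL D = -Complex.I * ((Real.sqrt (2 * τ.im))⁻¹ : ℝ) * (starRingEnd ℂ) (serT τ) := by
  set v := τ.im with hv
  have hpi := Real.pi_pos
  have key := hasFDerivAt_tsum_errE (U := {w : ℂ | v / 2 < w.im})
    (isOpen_lt continuous_const Complex.continuous_im) (convex_halfSpace_im_gt _).isPreconnected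
    (s := fun k => Real.sign ((k : ℝ) + 1 / 2))
    (X := fun k w => ((k : ℝ) + 1 / 2) * Real.sqrt (2 * w.im))
    (A := fun k w => -(Real.pi * Complex.I * k + Real.pi * Complex.I * (k + 1 / 2) ^ 2 * w))
    (X' := fun k w => (((k : ℝ) + 1 / 2) * (Real.sqrt (2 * w.im))⁻¹) • Complex.imCLM)
    (A' := fun k _ => -(Real.pi * Complex.I * (k + 1 / 2) ^ 2))
    (M₀ := 2) (M₁ := (Real.sqrt v)⁻¹) (M₂ := Real.pi) (c := Real.pi * (v / 2))
    (C := Real.pi * (v / 2)) (by positivity)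
    (fun k w hw => by
      have hw' : 0 < w.im := by
        have : v / 2 < w.im := hw
        linarith
      have h := (((Complex.imCLM.hasFDerivAt (x := w)).const_mul 2).sqrt (by
        simpa using hw'.ne')).const_mul ((k : ℝ) + 1 / 2)
      refine h.congr_fderiv ?_
      rw [smul_smul, smul_smul]
      congr 1
      simp only [Complex.imCLM_apply]
      field_simp)
    (fun k w _ => by
      have h := (((hasDerivAt_id w).const_mul (Real.pi * Complex.I * (k + 1 / 2) ^ 2)).const_add
        (Real.pi * Complex.I * k)).neg
      exact h.congr_deriv (by simp))
    (fun k w hw => by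
      have hw' : 0 < w.im := by
        have : v / 2 < w.im := hw
        linarith
      simpa using abs_sign_sub_errE_le 0 (int_add_half_ne_zero k) hw')
    (fun k w hw => by
      have hw' : v ≤ 2 * w.im := by
        have : v / 2 < w.im := hw
        linarith
      rw [norm_smul, Complex.imCLM_norm, mul_one, norm_mul, norm_inv,
        Real.norm_of_nonneg (Real.sqrt_nonneg _), Real.norm_eq_abs, mul_comm]
      have h1 : |(k : ℝ) + 1 / 2| ≤ (1 + |(k : ℝ)|) ^ 2 := by
        have := abs_add_half_le k
        nlinarith [abs_nonneg (k : ℝ)]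
      have h2 : (Real.sqrt (2 * w.im))⁻¹ ≤ (Real.sqrt v)⁻¹ := by gcongr
      gcongr)
    (fun k w _ => by
      have h1 : ‖(k + 1 / 2 : ℂ)‖ = |(k : ℝ) + 1 / 2| := by
        rw [← Real.norm_eq_abs, ← Complex.norm_real]
        push_cast
        rfl
      rw [norm_neg, norm_mul, norm_mul, Complex.norm_I, Complex.norm_real, norm_pow, h1,
        Real.norm_of_nonneg hpi.le, mul_one]
      gcongr
      exact abs_add_half_le k)
    (fun k w hw => by
      have hw' : v / 2 ≤ w.im := le_of_lt hw
      have hw0 : 0 < w.im := by linarith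
      have h1 : (-(Real.pi * Complex.I * k + Real.pi * Complex.I * (k + 1 / 2) ^ 2 * w)).re =
          Real.pi * ((k : ℝ) + 1 / 2) ^ 2 * w.im := by
        simp [sq]
      rw [h1, mul_pow, Real.sq_sqrt (by positivity)]
      have h2 : Real.pi * ((k : ℝ) + 1 / 2) ^ 2 * (v / 2) ≤
          Real.pi * ((k : ℝ) + 1 / 2) ^ 2 * w.im := by gcongr
      have h3 : Real.pi * (v / 2) * (-k) ≤ Real.pi * (v / 2) * |(k : ℝ)| := by
        gcongr; exact neg_le_abs _
      have h4 : 0 ≤ Real.pi * (v / 2) := by positivity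
      nlinarith)
    (w := τ) (by change v / 2 < τ.im; linarith)
  obtain ⟨h1, D, h2, h3⟩ := key
  refine ⟨h1, D, h2, ?_⟩
  rw [h3, ← (hasSum_serT hτ).tsum_eq, Complex.conj_tsum, ← tsum_mul_left]
  refine tsum_congr fun k => ?_
  rw [map_mul, ← Complex.exp_conj]
  have he : -(Real.pi : ℂ) * (((((k : ℝ) + 1 / 2) * Real.sqrt (2 * τ.im) : ℝ)) : ℂ) ^ 2 +
      -(Real.pi * Complex.I * k + Real.pi * Complex.I * (k + 1 / 2) ^ 2 * τ) =
      (starRingEnd ℂ) (Real.pi * Complex.I * k + Real.pi * Complex.I * (k + 1 / 2) ^ 2 * τ) := by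
    rw [← Complex.ofReal_pow, mul_pow, Real.sq_sqrt (by positivity)]
    apply Complex.ext
    · rw [Complex.add_re, Complex.conj_re]
      simp [sq]
      ring
    · rw [Complex.add_im, Complex.conj_im]
      simp [sq]
  rw [he]
  have h4 : (starRingEnd ℂ) ((k : ℂ) + 1 / 2) = (k : ℂ) + 1 / 2 := by
    simp [map_ofNat]
  rw [h4]
  simp [← hv]
  ring

lemma summable_RTerm (τ : ℍ) : Summable (RTerm 0 τ) := by
  rw [funext (RTerm_zero τ)]
  exact (rZero_hasFDerivAt τ.im_pos).1

lemma rZero_add_one (τ : ℂ) :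
    rZero (τ + 1) = Complex.exp (-(Real.pi * Complex.I / 4)) * rZero τ := by
  rw [rZero, rZero, ← tsum_mul_left]
  refine tsum_congr fun k => ?_
  have : Complex.exp (-(Real.pi * Complex.I * k + Real.pi * Complex.I * (k + 1 / 2) ^ 2 *
      (τ + 1))) = Complex.exp (-(Real.pi * Complex.I / 4)) *
      Complex.exp (-(Real.pi * Complex.I * k + Real.pi * Complex.I * (k + 1 / 2) ^ 2 * τ)) := by
    rw [← Complex.exp_add, Complex.exp_eq_exp_iff_exists_int]
    obtain ⟨m, hm⟩ := Int.even_mul_succ_self k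
    refine ⟨-m, ?_⟩
    have hm' : (k * (k + 1) : ℂ) = m + m := by exact_mod_cast hm
    push_cast
    linear_combination (-Real.pi * Complex.I) * hm'
  rw [this, Complex.add_im, Complex.one_im, add_zero]
  ring

lemma serT_mul_rZero (τ : ℂ) : serT τ * rZero τ = serP τ * rho 0 τ := by
  have h : Complex.exp (2 * Real.pi * Complex.I * τ / 8) * rZero τ = rho 0 τ := by
    rw [rZero, rho, ← tsum_mul_left]
    refine tsum_congr fun k => ?_
    have : Complex.exp (-thetaExponent 0 τ k) = Complex.exp (2 * Real.pi * Complex.I * τ / 8) *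
        Complex.exp (-(Real.pi * Complex.I * k + Real.pi * Complex.I * (k + 1 / 2) ^ 2 * τ)) := by
      rw [← Complex.exp_add, thetaExponent]
      ring_nf
    rw [rhoTerm, this, Complex.zero_im, zero_div, add_zero]
    ring
  rw [← h, serT]
  ring

/-- `R(0;τ)` decays exponentially at the cusp. -/
lemma tendsto_rZero : Filter.Tendsto (fun τ : ℍ => rZero τ) atImInfty (nhds 0) := by
  have hpi := Real.pi_pos
  set S := ∑' k : ℤ, 2 * Real.exp (-Real.pi * ((k : ℝ) + 1 / 2) ^ 2) with hS
  have hsum : Summable fun k : ℤ => 2 * Real.exp (-Real.pi * ((k : ℝ) + 1 / 2) ^ 2) := by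
    refine Summable.mul_left 2 (Summable.of_nonneg_of_le (fun k => (Real.exp_pos _).le)
      (fun k => Real.exp_le_exp.2 ?_) (summable_exp_quadratic (c := Real.pi) hpi Real.pi))
    have h3 : Real.pi * (-k) ≤ Real.pi * |(k : ℝ)| := by
      gcongr; exact neg_le_abs _
    nlinarith
  have hb : ∀ τ : ℍ, 1 ≤ τ.im →
      ‖rZero τ‖ ≤ Real.exp (Real.pi / 4) * S * Real.exp (-(Real.pi / 4 * τ.im)) := fun τ hτ => by
    rw [hS, ← tsum_mul_left, ← tsum_mul_right]
    refine tsum_of_norm_bounded ((hsum.mul_left _).mul_right _).hasSum fun k => ?_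
    have h1 := abs_sign_sub_errE_le 0 (int_add_half_ne_zero k) τ.im_pos
    have h2 : (-(Real.pi * Complex.I * k + Real.pi * Complex.I * (k + 1 / 2) ^ 2 * (τ : ℂ))).re =
        Real.pi * ((k : ℝ) + 1 / 2) ^ 2 * τ.im := by
      simp [sq]
    rw [norm_mul, Complex.norm_real, Real.norm_eq_abs, Complex.norm_exp, h2]
    simp only [add_zero, ne_eq, OfNat.ofNat_ne_zero, not_false_eq_true, zero_pow, mul_zero,
      Real.exp_zero, mul_one] at h1
    refine (mul_le_mul_of_nonneg_right h1 (Real.exp_pos _).le).trans ?_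
    rw [mul_pow, Real.sq_sqrt (by have := τ.im_pos; positivity), mul_assoc, ← Real.exp_add,
      show ∀ a b c : ℝ, Real.exp a * (2 * Real.exp b) * Real.exp c = 2 * Real.exp (a + b + c) from
        fun a b c => by rw [Real.exp_add, Real.exp_add]; ring]
    refine mul_le_mul_of_nonneg_left (Real.exp_le_exp.2 ?_) zero_le_two
    have h4 : (1 / 4 : ℝ) ≤ ((k : ℝ) + 1 / 2) ^ 2 := by
      have : (0 : ℝ) ≤ k * (k + 1) := by
        have : 0 ≤ k * (k + 1) := by
          rcases le_or_gt 0 k with h | h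
          · positivity
          · nlinarith
        exact_mod_cast this
      nlinarith
    have h5 := mul_nonneg (mul_nonneg hpi.le (sub_nonneg.2 hτ)) (sub_nonneg.2 h4)
    nlinarith
  have h := (tendsto_exp_neg_im (Real.pi / 4) (by positivity)).const_mul
    (Real.exp (Real.pi / 4) * S)
  rw [mul_zero] at h
  refine squeeze_zero_norm' ?_ h
  rw [Filter.eventually_iff, UpperHalfPlane.atImInfty_mem]
  exact ⟨1, fun τ hτ => hb τ hτ⟩

/-! ### The modular completion of the Appell function -/

lemma dbarL_add (D E : ℂ →L[ℝ] ℂ) : dbarL (D + E) = dbarL D + dbarL E := by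
  simp only [dbarL, add_apply]
  ring

lemma dbarL_sub (D E : ℂ →L[ℝ] ℂ) : dbarL (D - E) = dbarL D - dbarL E := by
  simp only [dbarL, sub_apply]
  ring

lemma dbarL_smul (c : ℂ) (D : ℂ →L[ℝ] ℂ) : dbarL (c • D) = c * dbarL D := by
  simp only [dbarL, smul_apply, smul_eq_mul]
  ring

lemma dbarL_one : dbarL (1 : ℂ →L[ℝ] ℂ) = 0 := by
  simp [dbarL]

lemma dbarL_comp_smul (D : ℂ →L[ℝ] ℂ) (c : ℂ) :
    dbarL (D.comp (c • (1 : ℂ →L[ℝ] ℂ))) = (starRingEnd ℂ) c * dbarL D := by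
  have h : ∀ a b : ℝ, D (a + b * Complex.I) = a * D 1 + b * D Complex.I := fun a b => by
    have : (a + b * Complex.I : ℂ) = a • (1 : ℂ) + b • Complex.I := by simp
    rw [this, map_add, map_smul, map_smul]
    simp
  have hc : (c : ℂ) = c.re + c.im * Complex.I := (Complex.re_add_im c).symm
  have hc2 : c * Complex.I = ((-c.im : ℝ) : ℂ) + (c.re : ℝ) * Complex.I := by
    conv_lhs => rw [hc]
    push_cast
    linear_combination (c.im : ℂ) * Complex.I_sq
  have hc3 : (starRingEnd ℂ) c = c.re - c.im * Complex.I := by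
    apply Complex.ext <;> simp
  have e1 : D c = c.re * D 1 + c.im * D Complex.I := by rw [← h, ← hc]
  simp only [dbarL, ContinuousLinearMap.comp_apply, smul_apply,
    one_apply_eq_self, smul_eq_mul, mul_one]
  rw [hc2, h, hc3, e1]
  push_cast
  linear_combination (c.im : ℂ) * D Complex.I / 2 * Complex.I_sq

lemma HasDerivAt.hasFDerivAt_real {f : ℂ → ℂ} {f' w : ℂ} (h : HasDerivAt f f' w) :
    HasFDerivAt f (f' • (1 : ℂ →L[ℝ] ℂ)) w := h.complexToReal_fderiv

lemma dbarL_smul_one (c : ℂ) : dbarL (c • (1 : ℂ →L[ℝ] ℂ)) = 0 := by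
  rw [dbarL_smul, dbarL_one, mul_zero]

/-- The completed Appell function `L - θρ/2`. -/
def lHat (u τ : ℂ) : ℂ := serL u τ - 1 / 2 * (theta u τ * rho u τ)

/-- The invariant `√v |θ(u;τ)|² exp(-2π (Im u + v/2)² / v)`. -/
def jFun (u τ : ℂ) : ℝ := ‖theta u τ‖ ^ 2 * (Real.sqrt τ.im *
  Real.exp (-(2 * Real.pi / τ.im) * (u.im + τ.im / 2) ^ 2))

lemma lHat_hasFDerivAt {τ : ℂ} (hτ : 0 < τ.im) (u : ℂ) :
    ∃ D : ℂ →L[ℝ] ℂ, HasFDerivAt (fun w => lHat w τ) D u ∧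
      dbarL D = Complex.I * (Real.sqrt 2 / 2 : ℝ) * (jFun u τ / τ.im : ℝ) := by
  obtain ⟨-, D, hD, hdb⟩ := rho_hasFDerivAt hτ u
  have h1 := HasDerivAt.hasFDerivAt_real (theta_hasDerivAt hτ u)
  have h2 := HasDerivAt.hasFDerivAt_real (serL_hasDerivAt hτ u)
  have h3 := h2.sub ((h1.mul hD).const_mul (1 / 2 : ℂ))
  refine ⟨_, h3, ?_⟩
  rw [dbarL_sub, dbarL_smul, dbarL_smul, dbarL_add, dbarL_smul, dbarL_smul, dbarL_smul, hdb,
    dbarL_one, jFun, Real.sqrt_mul zero_le_two]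
  have h4 : ((‖theta u τ‖ : ℂ)) ^ 2 = theta u τ * (starRingEnd ℂ) (theta u τ) := by
    rw [Complex.mul_conj, Complex.normSq_eq_norm_sq]
    push_cast
    rfl
  push_cast
  rw [h4]
  ring

/-- Since `θ` vanishes at the origin, `lHat` is complex differentiable there. -/
lemma lHat_hasFDerivAt_zero {τ : ℂ} (hτ : 0 < τ.im) :
    HasFDerivAt (fun w => lHat w τ) ((4 * Real.pi * Complex.I * (serHd 0 0 τ -
      serT τ * rZero τ / 4)) • (1 : ℂ →L[ℝ] ℂ)) 0 := by
  obtain ⟨-, D, hD, -⟩ := rho_hasFDerivAt hτ 0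
  have h1 := HasDerivAt.hasFDerivAt_real (theta_hasDerivAt hτ 0)
  have h2 := HasDerivAt.hasFDerivAt_real (serL_hasDerivAt hτ 0)
  have h3 := h2.sub ((h1.mul hD).const_mul (1 / 2 : ℂ))
  refine h3.congr_fderiv ?_
  rw [theta_zero, theta_deriv_zero hτ, serT_mul_rZero, zero_smul, zero_add, smul_smul, smul_smul,
    ← sub_smul, neg_zero]
  congr 1
  ring

lemma lHat_add_one {τ : ℂ} (u : ℂ) : lHat (u + 1) τ = lHat u τ := by
  rw [lHat, lHat, theta_add_one, rho_add_one, serL, serL, serH_add_one, serH_neg_add_one]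

lemma lHat_add_tau {τ : ℂ} (hτ : 0 < τ.im) (u : ℂ) : lHat (u + τ) τ = lHat u τ + 1 := by
  have h1 := ex_ne_zero u
  have h2 := ex_ne_zero τ
  rw [lHat, lHat, theta_add_tau', rho_add_tau hτ, serL_shift hτ]
  field_simp
  ring

lemma sqrt_neg_I_mul_sq (τ : ℂ) : ((-Complex.I * τ) ^ (1 / 2 : ℂ)) ^ 2 = -Complex.I * τ := by
  rw [← Complex.cpow_nat_mul]
  norm_num

lemma theta_neg_inv {τ : ℂ} (hτ : 0 < τ.im) (u : ℂ) : theta (u / τ) (-1 / τ) =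
    (-Complex.I * τ) ^ (1 / 2 : ℂ) *
      Complex.exp (Real.pi * Complex.I * ((u - 1 / 2 + τ / 2) ^ 2 / τ)) * theta u τ := by
  have h0 : τ ≠ 0 := fun h => by simp [h] at hτ
  have hs0 : (-Complex.I * τ) ^ (1 / 2 : ℂ) ≠ 0 := fun h => by
    have := sqrt_neg_I_mul_sq τ
    rw [h] at this
    simp [h0] at this
  have h := jacobiTheta₂_functional_equation (u + 1 / 2 + τ / 2) τ
  have h2 := jacobiTheta₂_add_left' ((u + 1 / 2 + τ / 2) / τ) (-1 / τ)
  have h3 : u / τ + 1 / 2 + -1 / τ / 2 = (u + 1 / 2 + τ / 2) / τ + -1 / τ := by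
    field_simp
    ring
  rw [theta, theta, h3, h2, h]
  have h4 : Complex.exp (-Real.pi * Complex.I * (-1 / τ + 2 * ((u + 1 / 2 + τ / 2) / τ))) =
      Complex.exp (Real.pi * Complex.I * ((u - 1 / 2 + τ / 2) ^ 2 / τ)) *
        Complex.exp (-Real.pi * Complex.I * (u + 1 / 2 + τ / 2) ^ 2 / τ) := by
    rw [← Complex.exp_add]
    congr 1
    field_simp
    ring
  rw [h4]
  field_simp

lemma neg_inv_im (τ : ℂ) : (-1 / τ).im = τ.im / Complex.normSq τ := by
  rw [Complex.div_im]
  simp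
  ring

/-- `jFun` is the invariant norm of the Jacobi form `theta` of weight and index `1/2`. -/
lemma jFun_neg_inv {τ : ℂ} (hτ : 0 < τ.im) (u : ℂ) : jFun (u / τ) (-1 / τ) = jFun u τ := by
  have h0 : τ ≠ 0 := fun h => by simp [h] at hτ
  have hn : 0 < ‖τ‖ := norm_pos_iff.2 h0
  have hs : ‖(-Complex.I * τ) ^ (1 / 2 : ℂ)‖ ^ 2 = ‖τ‖ := by
    rw [← norm_pow, sqrt_neg_I_mul_sq]
    simp
  have hsqrt : Real.sqrt (-1 / τ).im = Real.sqrt τ.im / ‖τ‖ := by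
    rw [neg_inv_im, Real.sqrt_div hτ.le, Complex.normSq_eq_norm_sq, Real.sqrt_sq hn.le]
  have hexp : Real.exp ((Real.pi * Complex.I * ((u - 1 / 2 + τ / 2) ^ 2 / τ)).re) ^ 2 *
      Real.exp (-(2 * Real.pi / (-1 / τ).im) * ((u / τ).im + (-1 / τ).im / 2) ^ 2) =
      Real.exp (-(2 * Real.pi / τ.im) * (u.im + τ.im / 2) ^ 2) := by
    rw [← Real.exp_nat_mul, ← Real.exp_add]
    congr 1
    have hns : Complex.normSq τ ≠ 0 := (Complex.normSq_pos.2 h0).ne'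
    have e1 : (Real.pi * Complex.I * ((u - 1 / 2 + τ / 2) ^ 2 / τ)).re =
        -Real.pi * ((u - 1 / 2 + τ / 2) ^ 2 / τ).im := by
      simp
    have e2 : (u - 1 / 2 + τ / 2).re = u.re - 1 / 2 + τ.re / 2 := by simp
    have e3 : (u - 1 / 2 + τ / 2).im = u.im + τ.im / 2 := by simp
    have e4 : (u / τ).im = (u.im * τ.re - u.re * τ.im) / Complex.normSq τ := by
      rw [Complex.div_im]; ring
    have e5 : ((u - 1 / 2 + τ / 2) ^ 2 / τ).im = (2 * (u.re - 1 / 2 + τ.re / 2) *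
        (u.im + τ.im / 2) * τ.re - ((u.re - 1 / 2 + τ.re / 2) ^ 2 - (u.im + τ.im / 2) ^ 2) *
          τ.im) / Complex.normSq τ := by
      rw [Complex.div_im, sq, Complex.mul_re, Complex.mul_im, e2, e3]; ring
    rw [e1, neg_inv_im, e4, e5]
    have hv := hτ.ne'
    have hN : Complex.normSq τ = τ.re ^ 2 + τ.im ^ 2 := by rw [Complex.normSq_apply]; ring
    push_cast
    field_simp
    rw [hN]
    ring
  rw [jFun, jFun, theta_neg_inv hτ, norm_mul, norm_mul, mul_pow, mul_pow, hs, hsqrt,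
    Complex.norm_exp, ← hexp]
  field_simp

/-- The function `lHat(u;τ) - τ⁻¹ lHat(u/τ;-1/τ)` is entire, by the invariance of `jFun`, and
quasi-periodic, hence affine. -/
theorem lHat_neg_inv {τ : ℂ} (hτ : 0 < τ.im) (u : ℂ) :
    lHat u τ - τ⁻¹ * lHat (u / τ) (-1 / τ) =
      lHat 0 τ - τ⁻¹ * lHat (0 / τ) (-1 / τ) + τ⁻¹ * u := by
  have h0 : τ ≠ 0 := fun h => by simp [h] at hτ
  have hτ' := neg_inv_im_pos hτ
  have hdiff : Differentiable ℂ fun u => lHat u τ - τ⁻¹ * lHat (u / τ) (-1 / τ) := fun u => by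
    obtain ⟨D, hD, hdb⟩ := lHat_hasFDerivAt hτ u
    obtain ⟨E, hE, hdbE⟩ := lHat_hasFDerivAt hτ' (u / τ)
    have hdiv := HasDerivAt.hasFDerivAt_real ((hasDerivAt_id u).div_const τ)
    rw [one_div] at hdiv
    have h1 := hD.sub ((hE.comp u hdiv).const_mul τ⁻¹)
    refine differentiableAt_complex_iff_differentiableAt_real.2 ⟨h1.differentiableAt, ?_⟩
    rw [show fderiv ℝ (fun u => lHat u τ - τ⁻¹ * lHat (u / τ) (-1 / τ)) u = _ from h1.fderiv]
    have h2 : dbarL (D - τ⁻¹ • E.comp (τ⁻¹ • (1 : ℂ →L[ℝ] ℂ))) = 0 := by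
      rw [dbarL_sub, dbarL_smul, dbarL_comp_smul,
        hdb, hdbE, jFun_neg_inv hτ, neg_inv_im]
      have h3 : τ⁻¹ * (starRingEnd ℂ) τ⁻¹ = ((Complex.normSq τ)⁻¹ : ℝ) := by
        rw [Complex.mul_conj, Complex.normSq_inv]
      have h4 : (Complex.normSq τ : ℂ) ≠ 0 := by
        exact_mod_cast (Complex.normSq_pos.2 h0).ne'
      have h5 : (τ.im : ℂ) ≠ 0 := by exact_mod_cast hτ.ne'
      rw [← mul_assoc τ⁻¹, h3]
      push_cast
      field_simp
      ring
    rw [dbarL] at h2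
    -- The vanishing of the Wirtinger derivative is the Cauchy-Riemann equation.
    have h6 := (div_eq_zero_iff.1 h2).resolve_right two_ne_zero
    rw [smul_eq_mul]
    linear_combination (-Complex.I) * h6 + ((D - τ⁻¹ • E.comp (τ⁻¹ • (1 : ℂ →L[ℝ] ℂ)))
      Complex.I) * Complex.I_sq
  have hA : ∀ u, lHat (u / τ + -1 / τ) (-1 / τ) = lHat (u / τ) (-1 / τ) + 1 :=
    fun u => lHat_add_tau hτ' (u / τ)
  exact (entire_affine_of_quasiperiodic hτ hdiff (α := τ⁻¹) (β := 1)
    (fun u => by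
      have h1 := hA (u + 1)
      rw [show (u + 1) / τ + -1 / τ = u / τ by field_simp; ring] at h1
      rw [lHat_add_one, h1]
      ring)
    (fun u => by
      have : (u + τ) / τ = u / τ + 1 := by field_simp
      rw [this, lHat_add_one, lHat_add_tau hτ]
      ring)).2 u

/-- The completed series `B = -∑ (-1)^s s q^(rs/2) + η³ R(0;τ) / 4`, where the sum is over
`r > s ≥ 1` of opposite parity. -/
def bHat (τ : ℂ) : ℂ := -serHd 0 0 τ + serT τ * rZero τ / 4

/-- The derivative of `lHat_neg_inv` at the origin. -/
theorem bHat_neg_inv {τ : ℂ} (hτ : 0 < τ.im) :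
    bHat (-1 / τ) = τ ^ 2 * bHat τ + τ / (4 * Real.pi * Complex.I) := by
  have h0 : τ ≠ 0 := fun h => by simp [h] at hτ
  have hτ' := neg_inv_im_pos hτ
  have hdiv := HasDerivAt.hasFDerivAt_real ((hasDerivAt_id (0 : ℂ)).div_const τ)
  rw [one_div] at hdiv
  have h2 := lHat_hasFDerivAt_zero hτ'
  rw [← zero_div τ] at h2
  have h1 := (lHat_hasFDerivAt_zero hτ).sub ((h2.comp 0 hdiv).const_mul τ⁻¹)
  have h3 := HasDerivAt.hasFDerivAt_real (((hasDerivAt_id (0 : ℂ)).const_mul τ⁻¹).const_add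
    (lHat 0 τ - τ⁻¹ * lHat (0 / τ) (-1 / τ)))
  have h4 := h1.congr_of_eventuallyEq (f₁ := fun u => lHat 0 τ - τ⁻¹ * lHat (0 / τ) (-1 / τ) +
    τ⁻¹ * u) (Filter.Eventually.of_forall fun u => (lHat_neg_inv hτ u).symm)
  have h5 := congrArg (fun D : ℂ →L[ℝ] ℂ => D 1) (h4.unique h3)
  simp only [sub_apply, smul_apply, ContinuousLinearMap.comp_apply,
    one_apply_eq_self, smul_eq_mul, mul_one, zero_div] at h5
  have hpi : (Real.pi : ℂ) ≠ 0 := by exact_mod_cast Real.pi_ne_zero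
  have hI := Complex.I_ne_zero
  rw [bHat, bHat]
  field_simp at h5 ⊢
  linear_combination h5

/-! ### Passing between functions on `ℍ` and on `ℂ` -/

lemma holo_of_eq {f : ℍ → ℂ} (F : ℂ → ℂ) (h : ∀ τ : ℍ, f τ = F τ)
    (hF : ∀ w : ℂ, 0 < w.im → DifferentiableAt ℂ F w) : Holo f := by
  refine DifferentiableOn.congr (f := F) (fun w hw => (hF w hw).differentiableWithinAt)
    fun w hw => ?_
  rw [h, ofComplex_apply_of_im_pos hw]

lemma realDiff_of_eq {f : ℍ → ℂ} (F : ℂ → ℂ) (h : ∀ τ : ℍ, f τ = F τ)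
    (hF : ∀ w : ℂ, 0 < w.im → DifferentiableAt ℝ F w) : RealDiff f := by
  refine DifferentiableOn.congr (f := F) (fun w hw => (hF w hw).differentiableWithinAt)
    fun w hw => ?_
  rw [h, ofComplex_apply_of_im_pos hw]

lemma dbar_of_eq {f : ℍ → ℂ} (F : ℂ → ℂ) (h : ∀ τ : ℍ, f τ = F τ) {τ : ℍ} {D : ℂ →L[ℝ] ℂ}
    (hD : HasFDerivAt F D τ) : dbar f τ = dbarL D := by
  have h1 := hD.congr_of_eventuallyEq (f₁ := fun z : ℂ => f (UpperHalfPlane.ofComplex z)) (by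
    filter_upwards [(isOpen_lt continuous_const Complex.continuous_im).mem_nhds τ.im_pos] with w hw
    rw [h, ofComplex_apply_of_im_pos hw])
  rw [dbar, h1.fderiv, dbarL]

lemma qPow_add (τ : ℍ) (r s : ℂ) : qPow τ (r + s) = qPow τ r * qPow τ s := by
  rw [qPow, qPow, qPow, ← Complex.exp_add]
  ring_nf

lemma qPow_zero (τ : ℍ) : qPow τ 0 = 1 := by simp [qPow]

lemma eta_cube_eq (τ : ℍ) : eta τ ^ 3 = qPow τ (1 / 8) * serP τ := by
  rw [eta_cube, serT, qPow]
  ring_nf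

lemma norm_qPow (τ : ℍ) (r : ℝ) : ‖qPow τ r‖ = Real.exp (-(2 * Real.pi * r * τ.im)) := by
  rw [qPow, Complex.norm_exp]
  simp

/-! ### The cusp form of weight `3/2` -/

lemma eta_cube_isZeroAtImInfty : IsZeroAtImInfty fun τ => eta τ ^ 3 := by
  have h1 : Filter.Tendsto (fun τ : ℍ => qPow τ (1 / 8)) atImInfty (nhds 0) := by
    rw [tendsto_zero_iff_norm_tendsto_zero]
    refine (tendsto_exp_neg_im (Real.pi / 4) (by positivity)).congr fun τ => ?_
    have := norm_qPow τ (1 / 8)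
    push_cast at this
    rw [this]
    ring_nf
  have h2 := h1.mul tendsto_serP
  rw [zero_mul] at h2
  exact h2.congr fun τ => (eta_cube_eq τ).symm

lemma isCuspForm_const_mul_eta_cube (c : ℂ) :
    IsCuspForm (3 / 2) (fun γ => nuEta γ ^ 3) fun τ => c * eta τ ^ 3 where
  holo := holo_of_eq (fun w => c * serT w) (fun τ => by rw [eta_cube])
    fun w hw => (serT_differentiableAt hw).const_mul c
  transforms γ τ := by
    have := eta_cube_transforms γ τ
    beta_reduce at this ⊢
    rw [this]
    ring
  zero_at_cusp := by
    have h := Filter.Tendsto.const_mul c eta_cube_isZeroAtImInfty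
    rw [mul_zero] at h
    exact h

lemma cy_eq (τ : ℍ) : cy τ = -(qPow τ (1 / 16) * eta τ ^ 3) := by
  rw [cy, tsum_cyTerm, eta_cube_eq, show (3 / 16 : ℂ) = 1 / 16 + 1 / 8 by norm_num, qPow_add]
  ring

lemma isCuspForm_cy :
    IsCuspForm (3 / 2) (fun γ => nuEta γ ^ 3) fun τ => qPow τ (-1 / 16) * cy τ := by
  have h : (fun τ => qPow τ (-1 / 16) * cy τ) = fun τ => (-1) * eta τ ^ 3 := by
    funext τ
    have h1 := qPow_add τ (-1 / 16) (1 / 16)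
    norm_num [qPow_zero] at h1
    rw [cy_eq, show (-1 / 16 : ℂ) = -(1 / 16) by norm_num]
    linear_combination eta τ ^ 3 * h1
  rw [h]
  exact isCuspForm_const_mul_eta_cube _

/-! ### The coefficient of weight two -/

lemma serHd_differentiableAt (w : ℕ) {τ : ℂ} (hτ : 0 < τ.im) :
    DifferentiableAt ℂ (fun τ => serHd w 0 τ) τ :=
  ((adm_H w).mul_n.hasDerivAt_tau hτ 0).differentiableAt

lemma qPow_mul_cyz2 (τ : ℍ) :
    qPow τ (1 / 12) * cyz2 τ = -6 * serHd 0 0 τ - 3 * serN 0 τ := by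
  rw [cyz2, tsum_cyz2Term, ← mul_assoc, ← qPow_add]
  norm_num [qPow_zero]

/-- The completion is a combination of the completed series `bHat` and of `E₂`; the anomalies of
the two under inversion cancel. -/
lemma cyz2Hat_eq (τ : ℍ) : cyz2Hat τ = 6 * bHat τ - (1 + 12 * serN 0 τ) / 4 := by
  rw [cyz2Hat, qPow_mul_cyz2, eta_cube, R_zero, bHat]
  ring

lemma serN_add_one (τ : ℂ) : serN 0 (τ + 1) = serN 0 τ := by
  rw [serN, serN, serH, serH, neg_zero, qSeries_tau_add_one, serH]

lemma bHat_add_one (τ : ℂ) : bHat (τ + 1) = bHat τ := by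
  have h : Complex.exp (Real.pi * Complex.I / 4) *
      Complex.exp (-(Real.pi * Complex.I / 4)) = 1 := by
    rw [← Complex.exp_add, add_neg_cancel, Complex.exp_zero]
  rw [bHat, bHat, serT_add_one, rZero_add_one, serHd, serHd, qSeries_tau_add_one]
  linear_combination serT τ * rZero τ / 4 * h

lemma cyz2Hat_S (τ : ℍ) : cyz2Hat (ModularGroup.S • τ) = (τ : ℂ) ^ 2 * cyz2Hat τ := by
  have hpi : (Real.pi : ℂ) ≠ 0 := by exact_mod_cast Real.pi_ne_zero
  rw [cyz2Hat_eq, cyz2Hat_eq, coe_S_smul, bHat_neg_inv τ.im_pos, serN_zero_neg_inv τ.im_pos]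
  field_simp
  ring

lemma cyz2Hat_T (τ : ℍ) : cyz2Hat (ModularGroup.T • τ) = cyz2Hat τ := by
  rw [cyz2Hat_eq, cyz2Hat_eq, coe_T_smul, bHat_add_one, serN_add_one]

lemma cyz2Hat_transforms : TransformsLike 2 (fun _ => 1) cyz2Hat :=
  (transformsLike_of_generators 2 cyz2Hat_S cyz2Hat_T).congr_weight (by norm_num)

lemma cyz2Hat_hasFDerivAt {τ : ℂ} (hτ : 0 < τ.im) : ∃ D : ℂ →L[ℝ] ℂ,
    HasFDerivAt (fun w => 6 * bHat w - (1 + 12 * serN 0 w) / 4) D τ ∧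
      dbarL D = -(3 / 2) * Complex.I * ((Real.sqrt (2 * τ.im))⁻¹ : ℝ) *
        (serT τ * (starRingEnd ℂ) (serT τ)) := by
  obtain ⟨-, D, hD, hdb⟩ := rZero_hasFDerivAt hτ
  have h1 := HasDerivAt.hasFDerivAt_real (serT_differentiableAt hτ).hasDerivAt
  have h2 := HasDerivAt.hasFDerivAt_real (serHd_differentiableAt 0 hτ).hasDerivAt
  have h3 := HasDerivAt.hasFDerivAt_real
    ((((serN_hasDerivAt_tau hτ).const_mul 12).const_add 1).div_const 4)
  have h4 := ((h2.neg.add ((h1.mul hD).mul_const (1 / 4 : ℂ))).const_mul (6 : ℂ)).sub h3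
  -- Only the factor `rZero` has a Wirtinger derivative.
  refine ⟨_, h4.congr_of_eventuallyEq (Filter.Eventually.of_forall fun w => ?_), ?_⟩
  · simp only [Pi.sub_apply, Pi.add_apply, Pi.neg_apply, Pi.mul_apply, bHat]
    ring
  · rw [dbarL_sub, dbarL_smul_one, dbarL_smul, dbarL_add, ← neg_one_smul ℂ, dbarL_smul,
      dbarL_smul_one, dbarL_smul, dbarL_add, dbarL_smul, dbarL_smul, dbarL_smul_one, hdb]
    ring

lemma cyz2Hat_realDiff : RealDiff cyz2Hat :=
  realDiff_of_eq _ cyz2Hat_eq fun _ hw =>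
    (cyz2Hat_hasFDerivAt hw).choose_spec.1.differentiableAt

/-- The powers of `v` that occur in the shadows. -/
lemma rpow_div_sqrt {v : ℝ} (hv : 0 < v) (k : ℝ) :
    v ^ k * (Real.sqrt (2 * v))⁻¹ = (Real.sqrt 2)⁻¹ * v ^ (k - 1 / 2) := by
  rw [Real.rpow_sub hv, ← Real.sqrt_eq_rpow, Real.sqrt_mul zero_le_two]
  field_simp

lemma xi_cyz2Hat (τ : ℍ) : xi 2 cyz2Hat τ =
    ((-(3 / Real.sqrt 2) * τ.im ^ (3 / 2 : ℝ) * ‖eta τ‖ ^ 6 : ℝ) : ℂ) := by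
  obtain ⟨D, hD, hdb⟩ := cyz2Hat_hasFDerivAt τ.im_pos
  rw [UpperHalfPlane.coe_im] at hdb
  have h1 := rpow_div_sqrt τ.im_pos 2
  have h2 : serT τ * (starRingEnd ℂ) (serT τ) = ((‖eta τ‖ ^ 6 : ℝ) : ℂ) := by
    rw [Complex.mul_conj, Complex.normSq_eq_norm_sq, ← eta_cube, norm_pow]
    ring_nf
  rw [xi, dbar_of_eq _ cyz2Hat_eq hD, hdb, h2]
  simp only [map_mul, map_neg, Complex.conj_I, Complex.conj_ofReal, map_div₀, map_ofNat]
  have h3 : ((τ.im ^ (2 : ℝ) : ℝ) : ℂ) * ((Real.sqrt (2 * τ.im))⁻¹ : ℝ) =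
      ((Real.sqrt 2)⁻¹ : ℝ) * ((τ.im ^ (3 / 2 : ℝ) : ℝ) : ℂ) := by
    rw [← Complex.ofReal_mul, h1, ← Complex.ofReal_mul]
    norm_num
  rw [Complex.ofReal_mul, Complex.ofReal_mul, show (-(3 / Real.sqrt 2) : ℝ) =
    -3 * (Real.sqrt 2)⁻¹ by ring]
  push_cast at h3 ⊢
  linear_combination (3 * Complex.I ^ 2 * (‖eta τ‖ : ℂ) ^ 6) * h3 + 3 * (Real.sqrt 2 : ℂ)⁻¹ *
    ((τ.im ^ (3 / 2 : ℝ) : ℝ) : ℂ) * (‖eta τ‖ : ℂ) ^ 6 * Complex.I_sq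

/-! ### The mock modular form -/

/-- The holomorphic part of `cyz2Hat`, divided by `η³`. -/
def mockH (τ : ℍ) : ℂ := (qPow τ (1 / 12) * cyz2 τ - 1 / 4) / eta τ ^ 3

lemma eta_cube_mul_mockH (τ : ℍ) : eta τ ^ 3 * mockH τ = qPow τ (1 / 12) * cyz2 τ - 1 / 4 :=
  mul_div_cancel₀ _ (pow_ne_zero 3 (eta_ne_zero τ))

lemma serT_ne_zero {w : ℂ} (hw : 0 < w.im) : serT w ≠ 0 := by
  have := eta_cube ⟨w, hw⟩
  rw [← this]
  exact pow_ne_zero 3 (eta_ne_zero _)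

lemma mockH_eq (τ : ℍ) : mockH τ = (-6 * serHd 0 0 τ - 3 * serN 0 τ - 1 / 4) / serT τ := by
  rw [mockH, qPow_mul_cyz2, eta_cube]

lemma mockH_differentiableAt {w : ℂ} (hw : 0 < w.im) : DifferentiableAt ℂ
    (fun w => (-6 * serHd 0 0 w - 3 * serN 0 w - 1 / 4) / serT w) w :=
  ((((serHd_differentiableAt 0 hw).const_mul (-6)).sub
    ((serN_hasDerivAt_tau hw).differentiableAt.const_mul 3)).sub_const _).div
    (serT_differentiableAt hw) (serT_ne_zero hw)

lemma Adm.tendsto_qSeries {ι : Type*} {c : ι → ℂ} {e n : ι → ℕ} (h : Adm c e n)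
    (he : ∀ i, 1 ≤ e i) :
    Filter.Tendsto (fun τ : ℍ => qSeries c e n 0 τ) atImInfty (nhds 0) := by
  obtain ⟨C, hC⟩ := h.norm_qSeries_le he
  have h := (tendsto_exp_neg_im (2 * Real.pi) (by positivity)).const_mul C
  rw [mul_zero] at h
  refine squeeze_zero_norm' ?_ h
  rw [Filter.eventually_iff, UpperHalfPlane.atImInfty_mem]
  exact ⟨1, fun τ hτ => hC τ hτ⟩

lemma one_le_expH (p : ℕ × ℕ) : 1 ≤ expH p := by
  rw [expH, tri_succ]
  omega

/-- The pole of `mockH` at the cusp comes from the factor `q^(-1/8)` of `η⁻³`. -/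
lemma mockH_growth :
    IsBoundedAtImInfty fun τ : ℍ => (Real.exp (-(Real.pi / 4) * τ.im) : ℂ) * mockH τ := by
  have h1 : Filter.Tendsto (fun τ : ℍ => serHd 0 0 τ) atImInfty (nhds 0) :=
    (adm_H 0).mul_n.tendsto_qSeries one_le_expH
  have h2 : Filter.Tendsto (fun τ : ℍ => serN 0 τ) atImInfty (nhds 0) := by
    have h := ((adm_H 1).tendsto_qSeries one_le_expH).add
      ((adm_H 1).tendsto_qSeries one_le_expH)
    rw [add_zero] at h
    refine h.congr fun τ => ?_
    rw [serN, neg_zero, serH]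
  have h3 := ((((h1.const_mul (-6)).sub (h2.const_mul 3)).sub_const (1 / 4)).div tendsto_serP
    one_ne_zero).isBigO_one ℝ
  refine Asymptotics.isBigO_norm_left.1 ((Asymptotics.isBigO_norm_left.2 h3).congr_left
    fun τ => ?_)
  have h4 := norm_qPow τ (1 / 8)
  push_cast at h4
  rw [Pi.div_apply, mockH, eta_cube_eq, qPow_mul_cyz2, norm_mul, norm_div, norm_div, norm_mul, h4,
    Complex.norm_real, Real.norm_of_nonneg (Real.exp_pos _).le]
  have h5 : Real.exp (-(Real.pi / 4) * τ.im) = Real.exp (-(2 * Real.pi * (1 / 8) * τ.im)) := by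
    ring_nf
  have h6 := (Real.exp_pos (-(2 * Real.pi * (1 / 8) * τ.im))).ne'
  rw [h5]
  field_simp

lemma R_zero_realDiff : RealDiff fun τ => 3 / 2 * R 0 τ :=
  realDiff_of_eq (fun w => 3 / 2 * rZero w) (fun τ => by rw [R_zero]) fun w hw => by
    obtain ⟨-, D, hD, -⟩ := rZero_hasFDerivAt hw
    exact (hD.const_mul (3 / 2 : ℂ)).differentiableAt

lemma R_zero_decay : IsZeroAtImInfty fun τ => 3 / 2 * R 0 τ := by
  have h := tendsto_rZero.const_mul (3 / 2)
  rw [mul_zero] at h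
  exact h.congr fun τ => by rw [R_zero]

lemma xi_mockH (τ : ℍ) : xi (1 / 2) (fun τ => mockH τ + 3 / 2 * R 0 τ) τ =
    ((-(3 / Real.sqrt 2) : ℝ) : ℂ) * eta τ ^ 3 := by
  obtain ⟨-, D, hD, hdb⟩ := rZero_hasFDerivAt τ.im_pos
  have h1 := HasDerivAt.hasFDerivAt_real (mockH_differentiableAt τ.im_pos).hasDerivAt
  have h2 := h1.add (hD.const_mul (3 / 2 : ℂ))
  rw [UpperHalfPlane.coe_im] at hdb
  rw [xi, dbar_of_eq _ (fun z => by rw [mockH_eq, R_zero]; rfl) h2, dbarL_add, dbarL_smul_one,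
    dbarL_smul, hdb, eta_cube]
  have h3 : ((τ.im ^ (1 / 2 : ℝ) : ℝ) : ℂ) * ((Real.sqrt (2 * τ.im))⁻¹ : ℝ) =
      ((Real.sqrt 2)⁻¹ : ℝ) := by
    rw [← Complex.ofReal_mul, rpow_div_sqrt τ.im_pos]
    norm_num
  simp only [zero_add, map_mul, map_neg, Complex.conj_I, Complex.conj_ofReal, map_div₀, map_ofNat,
    Complex.conj_conj]
  rw [show (-(3 / Real.sqrt 2) : ℝ) = -3 * (Real.sqrt 2)⁻¹ by ring]
  push_cast at h3 ⊢
  linear_combination (3 * Complex.I ^ 2 * serT τ) * h3 + 3 * (Real.sqrt 2 : ℂ)⁻¹ *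
    serT τ * Complex.I_sq

lemma isMockModular_mockH : IsMockModular (1 / 2) (fun γ => nuEta γ ^ (-3 : ℤ)) mockH
    (fun τ => 3 / 2 * R 0 τ) (fun τ => ((-(3 / Real.sqrt 2) : ℝ) : ℂ) * eta τ ^ 3) where
  holo := holo_of_eq _ mockH_eq fun _ hw => mockH_differentiableAt hw
  growth := ⟨Real.pi / 4, mockH_growth⟩
  realDiff := R_zero_realDiff
  decay := R_zero_decay
  transforms := by
    refine TransformsLike.of_mul_eta_cube ?_
    have : (fun τ => eta τ ^ 3 * (mockH τ + 3 / 2 * R 0 τ)) = cyz2Hat := by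
      funext τ
      rw [mul_add, eta_cube_mul_mockH, cyz2Hat]
      ring
    rw [this]
    exact cyz2Hat_transforms.congr_weight (by norm_num)
  shadow := xi_mockH
  shadow_cusp := by
    have h := isCuspForm_const_mul_eta_cube ((-(3 / Real.sqrt 2) : ℝ) : ℂ)
    simp only [conj_nuEta]
    rwa [show (2 - 1 / 2 : ℝ) = 3 / 2 by norm_num]

lemma cyz2_eq (τ : ℍ) : cyz2 τ = qPow τ (-1 / 12) * (1 / 4 + eta τ ^ 3 * mockH τ) := by
  have h := qPow_add τ (-1 / 12) (1 / 12)
  norm_num [qPow_zero] at h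
  rw [eta_cube_mul_mockH, show (-1 / 12 : ℂ) = -(1 / 12) by norm_num]
  linear_combination cyz2 τ * h

/-! ### The coefficient of weight `5/2` -/

lemma qPow_mul_cyz4 (τ : ℍ) : qPow τ (11 / 48) * cyz4 τ = qPow τ (-1 / 8) * serS4 τ := by
  rw [cyz4, tsum_cyz4Term, ← mul_assoc, ← qPow_add]
  norm_num

/-- Up to a factor `η³`, the completion is a combination of the modular forms
`E₄ = E₂² - 12 q dE₂/dq` and `cyz2Hat²` of weight four. -/
lemma eta_cube_mul_cyz4Hat (τ : ℍ) : eta τ ^ 3 * cyz4Hat τ =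
    ((1 + 12 * serN 0 τ) ^ 2 - 12 * dE2 τ) / 48 - cyz2Hat τ ^ 2 / 3 := by
  have h1 := serP_mul_serS4 τ.im_pos
  have h2 : eta τ ^ 3 * (qPow τ (-1 / 8) * serS4 τ) = serP τ * serS4 τ := by
    have h := qPow_add τ (-1 / 8) (1 / 8)
    norm_num [qPow_zero] at h
    rw [eta_cube_eq, show (-1 / 8 : ℂ) = -(1 / 8) by norm_num]
    linear_combination -(serP τ * serS4 τ) * h
  rw [cyz4Hat, cyz2Hat, qPow_mul_cyz4, qPow_mul_cyz2, dE2]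
  linear_combination h2 + h1

lemma cyz4Hat_transforms :
    TransformsLike (5 / 2) (fun γ => nuEta γ ^ (-3 : ℤ)) cyz4Hat := by
  refine TransformsLike.of_mul_eta_cube ?_
  rw [funext eta_cube_mul_cyz4Hat]
  refine (transformsLike_of_generators 4 (fun τ => ?_) fun τ => ?_).congr_weight (by norm_num)
  · rw [cyz2Hat_S, coe_S_smul, E2_sq_sub_neg_inv τ.im_pos]
    ring
  · have h : dE2 ((τ : ℂ) + 1) = dE2 τ := by
      rw [dE2, dE2, serHd, serHd, serHdd, serHdd, qSeries_tau_add_one, qSeries_tau_add_one]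
    rw [cyz2Hat_T, coe_T_smul, serN_add_one, h]

/-- The completion `cyz4Hat` as a polynomial in `R(0;τ)`. -/
def cyz4Poly : Polynomial (ℍ → ℂ) :=
  Polynomial.C (fun τ => (-3 / 4) * eta τ ^ 3) * Polynomial.X ^ 2 +
    Polynomial.C (fun τ => -(qPow τ (1 / 12) * cyz2 τ) + 1 / 4) * Polynomial.X +
    Polynomial.C (fun τ => qPow τ (11 / 48) * cyz4 τ)

lemma holo_coeff_cyz4Poly (i : ℕ) : Holo (cyz4Poly.coeff i) := by
  have h0 : Holo fun τ => qPow τ (11 / 48) * cyz4 τ :=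
    holo_of_eq (fun w => Complex.exp (2 * Real.pi * Complex.I * (-1 / 8) * w) * serS4 w)
      (fun τ => by rw [qPow_mul_cyz4, qPow]) fun w hw => by
        have := (adm_S4.hasDerivAt_tau hw 0).differentiableAt
        exact DifferentiableAt.mul (by fun_prop) this
  have h1 : Holo fun τ => -(qPow τ (1 / 12) * cyz2 τ) + 1 / 4 :=
    holo_of_eq (fun w => -(-6 * serHd 0 0 w - 3 * serN 0 w) + 1 / 4)
      (fun τ => by rw [qPow_mul_cyz2]) fun w hw =>
        (((serHd_differentiableAt 0 hw).const_mul (-6)).sub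
          ((serN_hasDerivAt_tau hw).differentiableAt.const_mul 3)).neg.add_const _
  have h2 : Holo fun τ => (-3 / 4) * eta τ ^ 3 :=
    (isCuspForm_const_mul_eta_cube (-3 / 4)).holo
  have h3 : Holo 0 := holo_of_eq 0 (fun _ => rfl) fun w _ => differentiableAt_const 0
  match i with
  | 0 => simpa [cyz4Poly] using h0
  | 1 => simpa [cyz4Poly, Polynomial.coeff_C] using h1
  | 2 => simpa [cyz4Poly, Polynomial.coeff_X, Polynomial.coeff_C] using h2
  | i + 3 =>
    have : cyz4Poly.coeff (i + 3) = 0 := Polynomial.coeff_eq_zero_of_natDegree_lt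
      ((Polynomial.natDegree_quadratic_le).trans_lt (by omega))
    rwa [this]

lemma natDegree_cyz4Poly : cyz4Poly.natDegree = 2 := by
  refine Polynomial.natDegree_quadratic fun h => ?_
  have h1 := congrFun h UpperHalfPlane.I
  have h2 := eta_ne_zero UpperHalfPlane.I
  simp [h2] at h1

lemma eval_cyz4Poly : cyz4Poly.eval (R 0) = cyz4Hat := by
  funext τ
  simp only [cyz4Poly, Polynomial.eval_add, Polynomial.eval_mul, Polynomial.eval_C,
    Polynomial.eval_pow, Polynomial.eval_X, Pi.add_apply, Pi.mul_apply, Pi.pow_apply, cyz4Hat]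
  ring

end GW236

end

theorem mainTheorem2 :
    -- all defining series converge absolutely
    (∀ τ : UpperHalfPlane, Summable (GW236.cyTerm τ) ∧ Summable (GW236.cyz2Term τ) ∧
      Summable (GW236.cyz4Term τ) ∧ Summable (GW236.RTerm 0 τ)) ∧
    -- `ν_η` is the multiplier of `η`
    GW236.TransformsLike (1 / 2) GW236.nuEta GW236.eta ∧
    -- the coefficient `c_y`
    ((∀ τ : UpperHalfPlane, GW236.cy τ = -(GW236.qPow τ (1 / 16) * GW236.eta τ ^ 3)) ∧
      GW236.IsCuspForm (3 / 2) (fun γ => GW236.nuEta γ ^ 3)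
        (fun τ => GW236.qPow τ (-1 / 16) * GW236.cy τ)) ∧
    -- the coefficient `c_{yz2}`
    (GW236.TransformsLike 2 (fun _ => 1) GW236.cyz2Hat ∧
      GW236.RealDiff GW236.cyz2Hat ∧
      (∀ τ : UpperHalfPlane, GW236.xi 2 GW236.cyz2Hat τ =
        ((-(3 / Real.sqrt 2) * τ.im ^ (3 / 2 : ℝ) * ‖GW236.eta τ‖ ^ 6 : ℝ) : ℂ)) ∧
      ∃ h : UpperHalfPlane → ℂ,
        GW236.IsMockModular (1 / 2) (fun γ => GW236.nuEta γ ^ (-3 : ℤ)) h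
          (fun τ => 3 / 2 * GW236.R 0 τ)
          (fun τ => ((-(3 / Real.sqrt 2) : ℝ) : ℂ) * GW236.eta τ ^ 3) ∧
        ∀ τ : UpperHalfPlane, GW236.cyz2 τ =
          GW236.qPow τ (-1 / 12) * (1 / 4 + GW236.eta τ ^ 3 * h τ)) ∧
    -- the coefficient `c_{yz4}`
    (GW236.TransformsLike (5 / 2) (fun γ => GW236.nuEta γ ^ (-3 : ℤ)) GW236.cyz4Hat ∧
      ∃ P : Polynomial (UpperHalfPlane → ℂ), P.natDegree = 2 ∧
        (∀ i : ℕ, GW236.Holo (P.coeff i)) ∧ P.eval (GW236.R 0) = GW236.cyz4Hat) :=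
  ⟨fun τ => ⟨GW236.summable_cyTerm τ, GW236.summable_cyz2Term τ, GW236.summable_cyz4Term τ,
      GW236.summable_RTerm τ⟩,
    GW236.eta_transforms, ⟨GW236.cy_eq, GW236.isCuspForm_cy⟩,
    ⟨GW236.cyz2Hat_transforms, GW236.cyz2Hat_realDiff, GW236.xi_cyz2Hat, GW236.mockH,
      GW236.isMockModular_mockH, GW236.cyz2_eq⟩,
    GW236.cyz4Hat_transforms, GW236.cyz4Poly, GW236.natDegree_cyz4Poly,
    GW236.holo_coeff_cyz4Poly, GW236.eval_cyz4Poly⟩
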